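/- **Setting.** Fix a reference curve $\gamma_0$: a smooth arclength-parametrized curve $\mathbb R\to\mathbb R^3$ whose two ends are asymptotic, up to shifts of the parameter, to one oriented straight line (e.g. the line itself). Let $\mathrm{BAL}$ be the set of smooth arclength-parametrized curves $\gamma:\mathbb R\to\mathbb R^3$ with nowhere vanishing curvature $\kappa$ and torsion $\tau$ such that $\kappa P\to 0$ as $s\to\pm\infty$ for every polynomial $P(s)$; each of the functions $\kappa^{-1}\partial_s^n\kappa$, $\partial_s^n\tau$ ($n\ge 0$) is $o(P)$ as $s\to\pm\infty$ for some nonzero polynomial $P$; and $\gamma(s\pm L)-\gamma_0(s)\to0$ as $s\to\pm\infty$ for some (unique) $L\in\mathbb R$. Put $\ell=2L$ (renormalized length). Let $T,N,B$ be the Frenet frame. Scalar fields are functions of $(\gamma,s)\in\mathrm{BAL}\times\mathbb R$; put $\int f=\int_{-\infty}^{\infty}f\,ds$ and $\partial_s^{-1}f(s)=\frac12\bigl(\int_{-\infty}^s f-\int_s^\infty f\bigr)$. Let $\mathcal A_n$ ($n\in\mathbb Z$) be the smallest spaces of scalar fields such that $\kappa\in\mathcal A_1$, $\kappa^{-1}\in\mathcal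 A_{-1}$, $\tau,s,\ell,1\in\mathcal A_0$; each $\mathcal A_n$ is a real vector space closed under $\partial_s$; $\mathcal A_n\subset\mathcal A_{n-1}$; $\mathcal A_i\mathcal A_j\subset\mathcal A_{i+j}$; and $\partial_s^{-1}f,\int f\in\mathcal A_0$ for $f\in\mathcal A_2$. By an expression of degree $n$ in variables of degree $1$ we mean one formed by the same rules with these variables as additional members of degree $1$. Let $\mathcal F$ be the real algebra generated by $1$, $\ell$ and the functionals $\int f$, $f\in\mathcal A_2$. Vector fields are the elements of $\mathcal X=\{g\mathbf N+h\mathbf B : g,h\in\mathcal A_1\}$. Let $\wp(g\mathbf N+h\mathbf B)=\partial_s^{-1}(\kappa g)T+gN+hB$ and $\varphi(fT+gN+hB)=g\mathbf N+h\mathbf B$. For $X\in\mathcal X$ let $\delta_X$ be the derivative along smooth one-parameter families in $\mathrm{BAL}$ with initial velocity $\wp(X)$ (along which the asymptotic conditions hold locally uniformly, as do the corresponding ones for the parameter derivative), acting on scalar fields and on $\mathbb R^3$-valued tangent fields. Put $XF=\delta_XF$ for $F\in\mathcal F$, $[X,Y]=\varphi(\delta_X\wp(Y)-\delta_Y\wp(X))$,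 and $g(X,Y)=\int\langle X,Y\rangle$, where $\langle g_1\mathbf N+h_1\mathbf B,\,g_2\mathbf N+h_2\mathbf B\rangle=g_1g_2+h_1h_2$. A 1-form is an $\mathcal F$-linear map $\eta:\mathcal X\to\mathcal F$ such that $\eta(g\mathbf N+h\mathbf B)$ is given by a functional-valued expression in $g,h$, i.e. by an element of the algebra generated by $1$, $\ell$ and the $\int f(g,h)$ with $f(g,h)$ an expression of degree $2$ in the variables $g,h$. Put $(L_X\zeta)(Y)=X(\zeta(Y))-\zeta([X,Y])$. For skew-symmetric ($\xi(H\eta)=-\eta(H\xi)$) $\mathcal F$-linear maps $H,H'$ from 1-forms to $\mathcal X$, the Schouten bracket is $$[H,H'](\xi,\eta,\zeta)=\xi(H L_{H'\eta}\zeta)+(H\leftrightarrow H')+\mathrm{cycle}(\xi,\eta,\zeta).$$ $H$ is Hamiltonian if $[H,H]=0$; Hamiltonian $H,H'$ form a Hamiltonian pair if $[H,H']=0$. Let $J(g\mathbf N+h\mathbf B)=h\mathbf N-g\mathbf B$ (the Marsden–Weinstein structure), $K=J\varphi\partial_s\wp J$, and $R=KJ^{-1}=J\varphi\partial_s\wp$.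 **Theorem.** For every 1-form $\eta$ there is a unique $H_0\eta\in\mathcal X$ with $g(X,H_0\eta)=-\eta(JX)$ for all $X\in\mathcal X$. Put $H_n=R^nH_0$ for $n=0,1,2,\dots$. For every $X\in\mathcal X$, $g(X,\cdot)$ is a 1-form, and $H_0(g(X,\cdot))=JX$, $H_1(g(X,\cdot))=KX$. For all non-negative integers $m,n$, the operators $H_m$ and $H_n$ are skew-symmetric $\mathcal F$-linear maps from 1-forms to $\mathcal X$ and form a Hamiltonian pair; in particular $[H_m,H_n]=0$. -/

import Mathlib

open Filter Topology MeasureTheory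
open scoped Polynomial ContDiff

noncomputable section

namespace VortexFilament

/-! ### Curves in Euclidean 3-space and their Frenet apparatus -/

/-- Euclidean 3-space. -/
abbrev E3 : Type := EuclideanSpace ℝ (Fin 3)

/-- The vector product on `E3`. -/
def cross (a b : E3) : E3 := WithLp.toLp 2 (crossProduct (WithLp.ofLp a) (WithLp.ofLp b))

/-- The unit tangent `T` of an arclength-parametrized curve. -/
def tangent (γ : ℝ → E3) : ℝ → E3 := deriv γ

/-- The curvature `κ` of an arclength-parametrized curve. -/
def curvature (γ : ℝ → E3) (s : ℝ) : ℝ := ‖deriv (tangent γ) s‖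

/-- The principal normal `N`, so that `T' = κ N`. -/
def normal (γ : ℝ → E3) (s : ℝ) : E3 := (curvature γ s)⁻¹ • deriv (tangent γ) s

/-- The binormal `B = T × N`. -/
def binormal (γ : ℝ → E3) (s : ℝ) : E3 := cross (tangent γ s) (normal γ s)

/-- The torsion `τ`, the `B`-component of `N'`. -/
def torsion (γ : ℝ → E3) (s : ℝ) : ℝ := inner ℝ (deriv (normal γ) s) (binormal γ s)

/-- Infinitely extended smooth curves parametrized by arclength. -/
def APC : Set (ℝ → E3) := {γ | ContDiff ℝ ∞ γ ∧ ∀ s, ‖deriv γ s‖ = 1}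

/-- `f(s) / P(s) → 0` as `s → ±∞` for some nonzero polynomial `P`. -/
def AsympPolynomialLike (f : ℝ → ℝ) : Prop :=
  ∃ P : ℝ[X], P ≠ 0 ∧ Tendsto (fun s => f s / P.eval s) (cocompact ℝ) (𝓝 0)

/-- `f(s) P(s) → 0` as `s → ±∞` for every polynomial `P`. -/
def RapidlyDecreasing (f : ℝ → ℝ) : Prop :=
  ∀ P : ℝ[X], Tendsto (fun s => f s * P.eval s) (cocompact ℝ) (𝓝 0)

/-- Admissible reference curves: arclength-parametrized smooth curves both of whose ends are
asymptotic to one and the same oriented straight line. -/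
def IsReferenceCurve (γ₀ : ℝ → E3) : Prop :=
  γ₀ ∈ APC ∧ ∃ p v : E3, ‖v‖ = 1 ∧
    (∃ a : ℝ, Tendsto (fun s => γ₀ s - (p + (s + a) • v)) atTop (𝓝 0)) ∧
    (∃ b : ℝ, Tendsto (fun s => γ₀ s - (p + (s + b) • v)) atBot (𝓝 0))

/-- The balancing condition with `ℓ₊ = ℓ₋ = L`. -/
def IsBalancedWith (γ₀ γ : ℝ → E3) (L : ℝ) : Prop :=
  Tendsto (fun s => γ (s + L) - γ₀ s) atTop (𝓝 0) ∧
    Tendsto (fun s => γ (s - L) - γ₀ s) atBot (𝓝 0)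

/-- Balanced asymptotically linear curves, relative to the reference curve `γ₀`. -/
def BAL (γ₀ : ℝ → E3) : Set (ℝ → E3) :=
  {γ | γ ∈ APC ∧ (∀ s, curvature γ s ≠ 0) ∧ (∃ L, IsBalancedWith γ₀ γ L) ∧
    RapidlyDecreasing (curvature γ) ∧
    (∀ n : ℕ, AsympPolynomialLike
      (fun s => (curvature γ s)⁻¹ * iteratedDeriv n (curvature γ) s)) ∧
    (∀ n : ℕ, AsympPolynomialLike (iteratedDeriv n (torsion γ)))}

/-! ### Scalar fields and tangent fields -/

/-- Scalar fields on `BAL`. A functional is a scalar field that does not depend on `s`. -/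
abbrev ScalarField (γ₀ : ℝ → E3) : Type := BAL γ₀ → ℝ → ℝ

/-- Tangent fields on `BAL`. -/
abbrev TangentField (γ₀ : ℝ → E3) : Type := BAL γ₀ → ℝ → E3

variable {γ₀ : ℝ → E3}

/-- The scalar field `κ`. -/
def kappa : ScalarField γ₀ := fun γ s => curvature γ.1 s

/-- The scalar field `1 / κ`. -/
def kappaInv : ScalarField γ₀ := fun γ s => (curvature γ.1 s)⁻¹

/-- The scalar field `τ`. -/
def tau : ScalarField γ₀ := fun γ s => torsion γ.1 s

/-- The scalar field `s`. -/
def param : ScalarField γ₀ := fun _ s => s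

/-- The renormalized length `ℓ = ℓ₊ + ℓ₋`, as a scalar field not depending on `s`. -/
def renLength : ScalarField γ₀ := fun γ _ => 2 * Classical.choose γ.2.2.2.1

/-- The Frenet frame as tangent fields. -/
def fieldT : TangentField γ₀ := fun γ s => tangent γ.1 s

/-- The Frenet frame as tangent fields. -/
def fieldN : TangentField γ₀ := fun γ s => normal γ.1 s

/-- The Frenet frame as tangent fields. -/
def fieldB : TangentField γ₀ := fun γ s => binormal γ.1 s

/-- `∂ₛ` on scalar fields. -/
def ds (f : ScalarField γ₀) : ScalarField γ₀ := fun γ => deriv (f γ)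

/-- `∇ₛ` on tangent fields. -/
def nablaS (X : TangentField γ₀) : TangentField γ₀ := fun γ => deriv (X γ)

/-- The anti-differentiation `∂ₛ⁻¹`. -/
def dsInv (f : ScalarField γ₀) : ScalarField γ₀ := fun γ s =>
  (1 / 2 : ℝ) * ((∫ t in Set.Iic s, f γ t) - ∫ t in Set.Ioi s, f γ t)

/-- The definite integral, a functional. -/
def integ (f : ScalarField γ₀) : ScalarField γ₀ := fun γ _ => ∫ t, f γ t

/-! ### Algebraic expressions -/

/-- `AlgVar vars n f`: the operator `f` is given by an expression, of degree `n`, in the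
symbols `κ, κ⁻¹, τ, s, ℓ, 1` and in the variables `vars` (which have degree `1`), built by the
algebraic operations: addition, scaling, multiplication, `∂ₛ`, `∂ₛ⁻¹` and `∫`, the last two being
applicable in degree `2` only. -/
inductive AlgVar {W : Type} (vars : Set (W → ScalarField γ₀)) :
    ℤ → (W → ScalarField γ₀) → Prop
  | var {f : W → ScalarField γ₀} (hf : f ∈ vars) : AlgVar vars 1 f
  | kappa : AlgVar vars 1 (fun _ => kappa)
  | kappaInv : AlgVar vars (-1) (fun _ => kappaInv)
  | tau : AlgVar vars 0 (fun _ => tau)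
  | param : AlgVar vars 0 (fun _ => param)
  | renLength : AlgVar vars 0 (fun _ => renLength)
  | one : AlgVar vars 0 (fun _ => 1)
  | add {n : ℤ} {f g : W → ScalarField γ₀} (hf : AlgVar vars n f) (hg : AlgVar vars n g) :
      AlgVar vars n (fun w => f w + g w)
  | smul {n : ℤ} {f : W → ScalarField γ₀} (c : ℝ) (hf : AlgVar vars n f) :
      AlgVar vars n (fun w => c • f w)
  | lower {n : ℤ} {f : W → ScalarField γ₀} (hf : AlgVar vars n f) : AlgVar vars (n - 1) f
  | mul {i j : ℤ} {f g : W → ScalarField γ₀} (hf : AlgVar vars i f) (hg : AlgVar vars j g) :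
      AlgVar vars (i + j) (fun w => f w * g w)
  | ds {n : ℤ} {f : W → ScalarField γ₀} (hf : AlgVar vars n f) :
      AlgVar vars n (fun w => ds (f w))
  | dsInv {f : W → ScalarField γ₀} (hf : AlgVar vars 2 f) :
      AlgVar vars 0 (fun w => dsInv (f w))
  | integ {f : W → ScalarField γ₀} (hf : AlgVar vars 2 f) :
      AlgVar vars 0 (fun w => integ (f w))

/-- The space `𝒜ₙ` of scalar fields having an expression (without variables) of degree `n`. -/
def algSpace (γ₀ : ℝ → E3) (n : ℤ) : Set (ScalarField γ₀) :=
  {f | AlgVar (W := Unit) ∅ n (fun _ => f)}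

/-- The algebra `ℱ` of functionals, generated by `1`, `ℓ` and `∫ f` for `f ∈ 𝒜₂`. -/
def functionals (γ₀ : ℝ → E3) : Subalgebra ℝ (ScalarField γ₀) :=
  Algebra.adjoin ℝ ({renLength} ∪ integ '' algSpace γ₀ 2)

/-! ### Vector fields

A pair `(g, h)` of scalar fields stands for `g N + h B`. The operations below are defined on all
pairs; the vector fields are the pairs lying in the set `vectorFields`. -/

/-- Pairs of scalar fields, `(g, h)` standing for `g N + h B`. -/
abbrev NB (γ₀ : ℝ → E3) : Type := ScalarField γ₀ × ScalarField γ₀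

/-- The space `𝒳` of vector fields: `g N + h B` with `g, h ∈ 𝒜₁`. -/
def vectorFields (γ₀ : ℝ → E3) : Set (NB γ₀) :=
  {X | X.1 ∈ algSpace γ₀ 1 ∧ X.2 ∈ algSpace γ₀ 1}

/-- The product of a scalar field and `g N + h B`. -/
def scale (F : ScalarField γ₀) (X : NB γ₀) : NB γ₀ := (F * X.1, F * X.2)

/-- The projection `φ` forgetting the `T`-component. -/
def proj (Y : TangentField γ₀) : NB γ₀ :=
  (fun γ s => inner ℝ (fieldN γ s) (Y γ s), fun γ s => inner ℝ (fieldB γ s) (Y γ s))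

/-- The map `℘ (g N + h B) = ∂ₛ⁻¹(κ g) T + g N + h B`. -/
def lift (X : NB γ₀) : TangentField γ₀ := fun γ s =>
  dsInv (kappa * X.1) γ s • fieldT γ s + X.1 γ s • fieldN γ s + X.2 γ s • fieldB γ s

/-! ### Variational calculus -/

/-- `c` is a smooth one-parameter family of curves in `BAL` through `γ` with variational vector
field `X` along `γ`, such that the asymptotic conditions defining `BAL`, and the corresponding
ones for the derivative with respect to the parameter, hold locally uniformly in the
parameter. -/
def IsVariation (γ : BAL γ₀) (X : ℝ → E3) (c : ℝ → BAL γ₀) : Prop :=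
  c 0 = γ ∧ (∀ s, HasDerivAt (fun ε => (c ε).1 s) (X s) 0) ∧
  ∃ r : ℝ, 0 < r ∧
    ContDiffOn ℝ ∞ (fun p : ℝ × ℝ => (c p.1).1 p.2) (Set.Ioo (-r) r ×ˢ Set.univ) ∧
    (∀ k : ℕ, ∃ C : ℝ, ∀ ε ∈ Set.Ioo (-r) r, ∀ s,
      curvature (c ε).1 s * (1 + |s|) ^ k ≤ C) ∧
    (∀ k : ℕ, ∃ (C : ℝ) (N : ℕ), ∀ ε ∈ Set.Ioo (-r) r, ∀ s,
      |iteratedDeriv k (curvature (c ε).1) s| ≤ C * (1 + |s|) ^ N * curvature (c ε).1 s) ∧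
    (∀ k : ℕ, ∃ (C : ℝ) (N : ℕ), ∀ ε ∈ Set.Ioo (-r) r, ∀ s,
      |iteratedDeriv k (torsion (c ε).1) s| ≤ C * (1 + |s|) ^ N) ∧
    (∀ k : ℕ, 1 ≤ k → ∃ (C : ℝ) (N : ℕ), ∀ ε ∈ Set.Ioo (-r) r, ∀ s,
      ‖deriv (fun ε' => iteratedDeriv k (c ε').1 s) ε‖
        ≤ C * (1 + |s|) ^ N * curvature (c ε).1 s)

/-- `v` is the variational derivative at `(γ, s)` of the field `f` in the direction `X`: variations
of `γ` in the direction `X` exist, and `f` has derivative `v` along each of them. -/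
def HasVariationAt {E : Type} [NormedAddCommGroup E] [NormedSpace ℝ E]
    (X : TangentField γ₀) (f : BAL γ₀ → ℝ → E) (γ : BAL γ₀) (s : ℝ) (v : E) : Prop :=
  (∃ c, IsVariation γ (X γ) c) ∧
    ∀ c, IsVariation γ (X γ) c → HasDerivAt (fun ε => f (c ε) s) v 0

open Classical in
/-- The variational differential of a scalar field (`E = ℝ`) or of a tangent field (`E = E3`) in
the direction `X`. -/
def vari {E : Type} [NormedAddCommGroup E] [NormedSpace ℝ E]
    (X : TangentField γ₀) (f : BAL γ₀ → ℝ → E) : BAL γ₀ → ℝ → E := fun γ s =>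
  if h : ∃ v, HasVariationAt X f γ s v then h.choose else 0

/-- The action of a vector field on functionals. -/
def act (X : NB γ₀) (F : ScalarField γ₀) : ScalarField γ₀ := vari (lift X) F

/-- The commutator of vector fields. -/
def bracket (X Y : NB γ₀) : NB γ₀ :=
  proj (vari (lift X) (lift Y) - vari (lift Y) (lift X))

/-! ### Riemannian structure, the operators `J`, `K`, `R` -/

/-- The Riemannian structure `g(X, Y) = ∫ ⟨X, Y⟩`. -/
def riem (X Y : NB γ₀) : ScalarField γ₀ := integ (X.1 * Y.1 + X.2 * Y.2)

/-- `J (g N + h B) = h N - g B`. -/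
def opJ (X : NB γ₀) : NB γ₀ := (X.2, -X.1)

/-- `K = J ∘ φ ∘ ∇ₛ ∘ ℘ ∘ J`. -/
def opK (X : NB γ₀) : NB γ₀ := opJ (proj (nablaS (lift (opJ X))))

/-- The recursion operator `R = K J⁻¹ = J ∘ φ ∘ ∇ₛ ∘ ℘`. -/
def opR (X : NB γ₀) : NB γ₀ := opJ (proj (nablaS (lift X)))

/-! ### One-forms

A one-form is given on all pairs, but only its values on vector fields matter. -/

/-- The functional-valued expressions algebraically depending on the components `g, h` of
`g N + h B`: the algebra generated by `1`, `ℓ` and the `∫ f(g, h)` with `f(g, h)` an expression of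
degree `2` in the variables `g, h`. -/
def functionalVars (γ₀ : ℝ → E3) : Subalgebra ℝ (NB γ₀ → ScalarField γ₀) :=
  Algebra.adjoin ℝ ({fun _ => renLength} ∪
    {Φ | ∃ f : NB γ₀ → ScalarField γ₀, AlgVar {Prod.fst, Prod.snd} 2 f ∧
      Φ = fun X => integ (f X)})

/-- One-forms: `ℱ`-linear maps `𝒳 → ℱ` given by an algebraic expression. -/
structure IsOneForm (η : NB γ₀ → ScalarField γ₀) : Prop where
  mem_functionals : ∀ X ∈ vectorFields γ₀, η X ∈ functionals γ₀
  map_add : ∀ X ∈ vectorFields γ₀, ∀ Y ∈ vectorFields γ₀, η (X + Y) = η X + η Y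
  map_scale : ∀ F ∈ functionals γ₀, ∀ X ∈ vectorFields γ₀, η (scale F X) = F * η X
  algebraic : ∃ Φ ∈ functionalVars γ₀, ∀ X ∈ vectorFields γ₀, η X = Φ X

/-- The Lie derivative of a one-form: `(L_X ζ)(Y) = X (ζ Y) - ζ [X, Y]`. -/
def lieForm (X : NB γ₀) (ζ : NB γ₀ → ScalarField γ₀) : NB γ₀ → ScalarField γ₀ :=
  fun Y => act X (ζ Y) - ζ (bracket X Y)

/-! ### Schouten bracket and Hamiltonian pairs -/

/-- Operators from one-forms to vector fields. -/
abbrev FormOp (γ₀ : ℝ → E3) : Type := (NB γ₀ → ScalarField γ₀) → NB γ₀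

/-- The operator maps one-forms to vector fields and is `ℱ`-linear and skew-symmetric. -/
structure IsSkewOperator (H : FormOp γ₀) : Prop where
  mem_vectorFields : ∀ η, IsOneForm η → H η ∈ vectorFields γ₀
  map_add : ∀ ξ η, IsOneForm ξ → IsOneForm η → H (ξ + η) = H ξ + H η
  map_scale : ∀ F ∈ functionals γ₀, ∀ η, IsOneForm η → H (fun X => F * η X) = scale F (H η)
  skew : ∀ ξ η, IsOneForm ξ → IsOneForm η → ξ (H η) = -η (H ξ)

/-- The Schouten bracket
`[H, H'](ξ, η, ζ) = ξ (H L_{H' η} ζ) + (H ↔ H') + cycle (ξ, η, ζ)`. -/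
def schouten (H H' : FormOp γ₀) (ξ η ζ : NB γ₀ → ScalarField γ₀) : ScalarField γ₀ :=
  (ξ (H (lieForm (H' η) ζ)) + ξ (H' (lieForm (H η) ζ))) +
  (η (H (lieForm (H' ζ) ξ)) + η (H' (lieForm (H ζ) ξ))) +
  (ζ (H (lieForm (H' ξ) η)) + ζ (H' (lieForm (H ξ) η)))

/-- The Schouten bracket of two operators vanishes, as a map on triples of one-forms. -/
def SchoutenVanishes (H H' : FormOp γ₀) : Prop :=
  ∀ ξ η ζ, IsOneForm ξ → IsOneForm η → IsOneForm ζ → schouten H H' ξ η ζ = 0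

/-- Hamiltonian operators. -/
def IsHamiltonianOperator (H : FormOp γ₀) : Prop :=
  IsSkewOperator H ∧ SchoutenVanishes H H

/-- Hamiltonian pairs. -/
def IsHamiltonianPair (H H' : FormOp γ₀) : Prop :=
  IsHamiltonianOperator H ∧ IsHamiltonianOperator H' ∧ SchoutenVanishes H H'

/-- `X` is a value of `H₀` at `η`: a vector field with `g(Y, X) = -η (J Y)` for all `Y ∈ 𝒳`. -/
def IsH0 (η : NB γ₀ → ScalarField γ₀) (X : NB γ₀) : Prop :=
  X ∈ vectorFields γ₀ ∧ ∀ Y ∈ vectorFields γ₀, riem Y X = -η (opJ Y)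

open Classical in
/-- The operator `H₀`, determined by `g(Y, H₀ η) = -η (J Y)` for all `Y ∈ 𝒳`. -/
def opH0 : FormOp γ₀ := fun η => if h : ∃ X, IsH0 η X then h.choose else 0

/-- The operators `Hₙ = Rⁿ H₀`. -/
def opH (n : ℕ) : FormOp γ₀ := fun η => opR^[n] (opH0 η)

end VortexFilament

end

open VortexFilament

/-!
Along the lift `℘ X` of a vector field `X` the derivative `(℘ X)'` is orthogonal to the tangent `T`,
and the recursion operator is characterized by `(℘ X)' = T × ℘ (R X)` (`hasDerivAt_lift_cross`).
Conversely, a field `V` with `V' ⟂ T` whose limits at the two ends are opposite multiples of the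
asymptotic direction equals `℘ (φ V)` (`eq_lift_of_hasDerivAt_cross`): its tangential part is an
anti-derivative of `κ ⟨N, V⟩`, and the limits determine the constant. Let `U = ℘ X` and `V = ℘ Y`.
Differentiating `V' = T × ℘ (R Y)` along `U`, with `δ_U T = U'`, and using the Jacobi identity for
the vector product, one finds
`(δ_U V - δ_V U)' = T × (℘ (R X) × ℘ (R Y) + δ_U ℘ (R Y) - δ_V ℘ (R X))`.
Hence `δ_U V - δ_V U = ℘ [X, Y]`, and the second factor on the right is `℘ (R [X, Y])`. One more
differentiation computes `R² [X, Y]` in the same manner, and the result says that the Nijenhuis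
torsion of `R` vanishes (`nijenhuis`).

The two-form `ω (X, Y) = -∫ det (T, ℘ X, ℘ Y)` is closed, because the integrand of `dω (X, Y, Z)` is
the derivative of `-det (℘ X, ℘ Y, ℘ Z)`. Likewise `ω (R X, Y) = -∫ ⟨(℘ X)', ℘ Y⟩` is skew-symmetric
and closed (`extDeriv_symp`, `symp_opR`, `extDeriv_symp_opR`). As `R` is torsion free, induction shows
that every form `ωₙ = ω (Rⁿ ·, ·)` is closed (`extDeriv_sympIter`). The operator `H₀` inverts the map
from vector fields to one-forms given by `ω`. So the terms of the Schouten bracket of `H_m` and `H_n`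
can be expressed by these forms, and their sum reduces to a multiple of `dω_{m+n}`, which is zero
(`schoutenVanishes_opH`).

The remaining work is analytic and makes this calculus legitimate.

* Every expression of degree `n` is bounded by `κⁿ` times a polynomial in `s`, locally uniformly
  along families of curves and together with its derivatives (`Window`, `Window.Tame`). Hence
  expressions can be differentiated along variations, also under the integral signs, and the
  derivative is an expression of the same degree that is linear in the direction
  (`AlgVar.deformable_variation`). For the renormalized length this rests on the formula
  `ℓ = a + ∫ (1 - ⟨T, v⟩)` with the asymptotic direction `v` (`IsReferenceCurve.exists_direction`).
* Variations with initial velocity `℘ X` exist (`exists_isVariation`), so `δ_X` is determined by its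
  defining property and is never a default value.
* Every one-form is `g (Z, ·)` for a vector field `Z` (`IsOneForm.exists_riem`). A one-form is real
  linear, hence equal to its derivative at `0`; this derivative is the integral of a linear expression,
  and integration by parts moves all operators in it to the coefficients
  (`LinExpr.exists_adjoint`). Thus `H₀` is defined. Since `X (η Y) - η [X, Y]` is again such an
  integral, Lie derivatives of one-forms are one-forms (`isOneForm_lieForm`), and the terms of the
  Schouten bracket are meaningful.
-/

noncomputable section

namespace VortexFilament

variable {γ₀ : ℝ → E3}

/-! ### Vector algebra in Euclidean 3-space -/

theorem inner_coord (a b : E3) : inner ℝ a b = a 0 * b 0 + a 1 * b 1 + a 2 * b 2 := by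
  rw [PiLp.inner_apply, Fin.sum_univ_three]
  simp only [RCLike.inner_apply, conj_trivial]
  ring

@[simp] theorem cross_zero_coord (a b : E3) : cross a b 0 = a 1 * b 2 - a 2 * b 1 := by
  simp [cross, crossProduct]

@[simp] theorem cross_one_coord (a b : E3) : cross a b 1 = a 2 * b 0 - a 0 * b 2 := by
  simp [cross, crossProduct]

@[simp] theorem cross_two_coord (a b : E3) : cross a b 2 = a 0 * b 1 - a 1 * b 0 := by
  simp [cross, crossProduct]

theorem E3_ext {a b : E3} (h0 : a 0 = b 0) (h1 : a 1 = b 1) (h2 : a 2 = b 2) : a = b := by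
  ext i
  fin_cases i <;> assumption

theorem cross_add_left (a b c : E3) : cross (a + b) c = cross a c + cross b c := by
  apply E3_ext <;> simp <;> ring

theorem cross_add_right (a b c : E3) : cross a (b + c) = cross a b + cross a c := by
  apply E3_ext <;> simp <;> ring

theorem cross_sub_right (a b c : E3) : cross a (b - c) = cross a b - cross a c := by
  apply E3_ext <;> simp <;> ring

theorem cross_smul_left (r : ℝ) (a b : E3) : cross (r • a) b = r • cross a b := by
  apply E3_ext <;> simp <;> ring

theorem cross_smul_right (r : ℝ) (a b : E3) : cross a (r • b) = r • cross a b := by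
  apply E3_ext <;> simp <;> ring

theorem cross_self (a : E3) : cross a a = 0 := by
  apply E3_ext <;> simp <;> ring

theorem cross_anticomm (a b : E3) : cross a b = -cross b a := by
  apply E3_ext <;> simp <;> ring

theorem inner_cross_left_self (a b : E3) : inner ℝ (cross a b) a = 0 := by
  simp only [inner_coord, cross_zero_coord, cross_one_coord, cross_two_coord]; ring

theorem inner_cross_right_self (a b : E3) : inner ℝ (cross a b) b = 0 := by
  simp only [inner_coord, cross_zero_coord, cross_one_coord, cross_two_coord]; ring

theorem inner_cross_cross (a b c d : E3) :
    inner ℝ (cross a b) (cross c d) =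
      inner ℝ a c * inner ℝ b d - inner ℝ a d * inner ℝ b c := by
  simp only [inner_coord, cross_zero_coord, cross_one_coord, cross_two_coord]; ring

theorem inner_cross_cycle (a b c : E3) : inner ℝ a (cross b c) = inner ℝ (cross a b) c := by
  simp only [inner_coord, cross_zero_coord, cross_one_coord, cross_two_coord]; ring

theorem cross_cross_left (a b c : E3) :
    cross a (cross b c) = (inner ℝ a c : ℝ) • b - (inner ℝ a b : ℝ) • c := by
  apply E3_ext <;> simp [inner_coord] <;> ring

/-- The Jacobi identity, in the form in which derivations by cross products use it. -/
theorem cross_jacobi (t p q : E3) :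
    cross (cross t p) q - cross (cross t q) p = cross t (cross p q) := by
  apply E3_ext <;> simp <;> ring

theorem cross_jacobi' (t p q : E3) :
    cross p (cross t q) + cross (cross t p) q = cross t (cross p q) := by
  apply E3_ext <;> simp <;> ring

/-- The vector product as a continuous bilinear map. -/
def crossL : E3 →L[ℝ] E3 →L[ℝ] E3 :=
  LinearMap.toContinuousLinearMap
    { toFun := fun a => LinearMap.toContinuousLinearMap
        { toFun := cross a
          map_add' := cross_add_right a
          map_smul' := fun r b => cross_smul_right r a b }
      map_add' := fun a b => by ext1 c; exact cross_add_left a b c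
      map_smul' := fun r a => by ext1 c; exact cross_smul_left r a c }

@[simp] theorem crossL_apply (a b : E3) : crossL a b = cross a b := rfl

theorem _root_.HasDerivAt.cross {f g : ℝ → E3} {f' g' : E3} {s : ℝ} (hf : HasDerivAt f f' s)
    (hg : HasDerivAt g g' s) :
    HasDerivAt (fun t => cross (f t) (g t)) (cross f' (g s) + cross (f s) g') s := by
  have := (crossL.isBoundedBilinearMap.hasFDerivAt (f s, g s)).comp_hasDerivAt s
    (hf.prodMk hg)
  simpa [add_comm, Function.comp_def] using this

theorem _root_.ContDiff.cross {f g : ℝ → E3} {n : WithTop ℕ∞} (hf : ContDiff ℝ n f)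
    (hg : ContDiff ℝ n g) : ContDiff ℝ n (fun t => VortexFilament.cross (f t) (g t)) := by
  have : ContDiff ℝ n (fun t => crossL (f t) (g t)) := (crossL.contDiff.comp hf).clm_apply hg
  simpa using this

theorem _root_.Filter.Tendsto.cross {α : Type*} {l : Filter α} {f g : α → E3} {a b : E3}
    (hf : Tendsto f l (𝓝 a)) (hg : Tendsto g l (𝓝 b)) :
    Tendsto (fun x => VortexFilament.cross (f x) (g x)) l (𝓝 (VortexFilament.cross a b)) := by
  have hc : Continuous fun p : E3 × E3 => crossL p.1 p.2 :=
    (crossL.continuous.comp continuous_fst).clm_apply continuous_snd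
  simp only [crossL_apply] at hc
  have h := (hc.tendsto (a, b)).comp (hf.prodMk_nhds hg)
  simpa only [Function.comp_def] using h

theorem norm_cross_le (a b : E3) : ‖cross a b‖ ≤ ‖a‖ * ‖b‖ := by
  have h := inner_cross_cross a b a b
  rw [real_inner_self_eq_norm_sq, real_inner_self_eq_norm_sq, real_inner_self_eq_norm_sq,
    real_inner_comm] at h
  refine abs_le_of_sq_le_sq (?_) (by positivity) |> le_of_abs_le
  nlinarith [mul_self_nonneg (inner ℝ a b : ℝ)]

/-! ### The Frenet frame -/

/-- A pair of orthonormal vectors, completed by its vector product, spans. -/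
theorem frame_expansion {t n : E3} (ht : ‖t‖ = 1) (hn : ‖n‖ = 1) (htn : inner ℝ t n = (0 : ℝ))
    (v : E3) : v = (inner ℝ t v : ℝ) • t + (inner ℝ n v : ℝ) • n +
      (inner ℝ (cross t n) v : ℝ) • cross t n := by
  have ht' : inner ℝ t t = (1 : ℝ) := by rw [real_inner_self_eq_norm_sq, ht]; norm_num
  have hn' : inner ℝ n n = (1 : ℝ) := by rw [real_inner_self_eq_norm_sq, hn]; norm_num
  -- expand `(t × n) × (v × (t × n))` and `v × (t × n)` by the double product formula
  have h1 := cross_cross_left (cross t n) v (cross t n)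
  have h2 : cross v (cross t n) = (inner ℝ v n : ℝ) • t - (inner ℝ v t : ℝ) • n :=
    cross_cross_left v t n
  rw [inner_cross_cross, ht', hn', htn, h2, cross_sub_right, cross_smul_right,
    cross_smul_right] at h1
  have h3 : cross (cross t n) t = n := by
    rw [cross_anticomm, cross_cross_left, ht', htn]; simp
  have h4 : cross (cross t n) n = -t := by
    rw [cross_anticomm, cross_cross_left, hn', real_inner_comm, htn]; simp
  rw [h3, h4, real_inner_comm n v, real_inner_comm t v] at h1
  simp only [mul_one, zero_mul, sub_zero, one_smul] at h1
  rw [eq_comm, sub_eq_iff_eq_add] at h1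
  nth_rewrite 1 [h1]
  simp only [smul_neg, sub_neg_eq_add]
  abel

/-- Smooth unit speed curves with nowhere vanishing curvature, for which the Frenet frame is
defined. -/
structure FrenetCurve (γ : ℝ → E3) : Prop where
  smooth : ContDiff ℝ ∞ γ
  unit : ∀ s, ‖deriv γ s‖ = 1
  curv : ∀ s, curvature γ s ≠ 0

theorem BAL.frenet (γ : BAL γ₀) : FrenetCurve γ.1 :=
  ⟨γ.2.1.1, γ.2.1.2, γ.2.2.1⟩

namespace FrenetCurve

variable {γ : ℝ → E3}

theorem smooth_tangent (h : FrenetCurve γ) : ContDiff ℝ ∞ (tangent γ) := by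
  have : ContDiff ℝ (∞ + 1) γ := by simpa using h.smooth
  exact this.deriv'

theorem smooth_deriv_tangent (h : FrenetCurve γ) : ContDiff ℝ ∞ (deriv (tangent γ)) := by
  have : ContDiff ℝ (∞ + 1) (tangent γ) := by simpa using h.smooth_tangent
  exact this.deriv'

theorem smooth_curvature (h : FrenetCurve γ) : ContDiff ℝ ∞ (curvature γ) := by
  refine h.smooth_deriv_tangent.norm ℝ fun s hs => h.curv s ?_
  rw [curvature, hs, norm_zero]

theorem smooth_normal (h : FrenetCurve γ) : ContDiff ℝ ∞ (normal γ) :=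
  (h.smooth_curvature.inv h.curv).smul h.smooth_deriv_tangent

theorem smooth_binormal (h : FrenetCurve γ) : ContDiff ℝ ∞ (binormal γ) :=
  h.smooth_tangent.cross h.smooth_normal

theorem smooth_deriv_normal (h : FrenetCurve γ) : ContDiff ℝ ∞ (deriv (normal γ)) := by
  have : ContDiff ℝ (∞ + 1) (normal γ) := by simpa using h.smooth_normal
  exact this.deriv'

theorem smooth_torsion (h : FrenetCurve γ) : ContDiff ℝ ∞ (torsion γ) :=
  h.smooth_deriv_normal.inner ℝ h.smooth_binormal

theorem curvature_pos (h : FrenetCurve γ) (s : ℝ) : 0 < curvature γ s :=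
  lt_of_le_of_ne (norm_nonneg _) (h.curv s).symm

theorem norm_tangent (h : FrenetCurve γ) (s : ℝ) : ‖tangent γ s‖ = 1 := h.unit s

theorem norm_normal (h : FrenetCurve γ) (s : ℝ) : ‖normal γ s‖ = 1 := by
  rw [normal, norm_smul, norm_inv, Real.norm_of_nonneg (h.curvature_pos s).le]
  exact inv_mul_cancel₀ (h.curv s)

theorem inner_TT (h : FrenetCurve γ) (s : ℝ) : inner ℝ (tangent γ s) (tangent γ s) = (1 : ℝ) := by
  rw [real_inner_self_eq_norm_sq, h.norm_tangent]; norm_num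

theorem inner_NN (h : FrenetCurve γ) (s : ℝ) : inner ℝ (normal γ s) (normal γ s) = (1 : ℝ) := by
  rw [real_inner_self_eq_norm_sq, h.norm_normal]; norm_num

theorem hasDerivAt_curve (h : FrenetCurve γ) (s : ℝ) : HasDerivAt γ (tangent γ s) s :=
  (h.smooth.differentiable (by simp) s).hasDerivAt

theorem hasDerivAt_tangent (h : FrenetCurve γ) (s : ℝ) :
    HasDerivAt (tangent γ) (curvature γ s • normal γ s) s := by
  rw [normal, smul_smul, mul_inv_cancel₀ (h.curv s), one_smul]
  exact (h.smooth_tangent.differentiable (by simp) s).hasDerivAt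

theorem inner_TN (h : FrenetCurve γ) (s : ℝ) : inner ℝ (tangent γ s) (normal γ s) = (0 : ℝ) := by
  have h1 := (h.hasDerivAt_tangent s).inner ℝ (h.hasDerivAt_tangent s)
  have h2 : (fun t => (inner ℝ (tangent γ t) (tangent γ t) : ℝ)) = fun _ => 1 :=
    funext h.inner_TT
  rw [h2] at h1
  have h3 := h1.unique (hasDerivAt_const s (1 : ℝ))
  rw [real_inner_comm (tangent γ s), inner_smul_right, ← two_mul] at h3
  simpa [h.curv s] using h3

theorem inner_NT (h : FrenetCurve γ) (s : ℝ) : inner ℝ (normal γ s) (tangent γ s) = (0 : ℝ) := by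
  rw [real_inner_comm, h.inner_TN]

theorem inner_TB (_h : FrenetCurve γ) (s : ℝ) : inner ℝ (tangent γ s) (binormal γ s) = (0 : ℝ) := by
  rw [real_inner_comm, binormal, inner_cross_left_self]

theorem inner_BT (_h : FrenetCurve γ) (s : ℝ) : inner ℝ (binormal γ s) (tangent γ s) = (0 : ℝ) := by
  rw [binormal, inner_cross_left_self]

theorem inner_BN (_h : FrenetCurve γ) (s : ℝ) : inner ℝ (binormal γ s) (normal γ s) = (0 : ℝ) := by
  rw [binormal, inner_cross_right_self]

theorem inner_NB (h : FrenetCurve γ) (s : ℝ) : inner ℝ (normal γ s) (binormal γ s) = (0 : ℝ) := by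
  rw [real_inner_comm, h.inner_BN]

theorem inner_BB (h : FrenetCurve γ) (s : ℝ) : inner ℝ (binormal γ s) (binormal γ s) = (1 : ℝ) := by
  rw [binormal, inner_cross_cross, h.inner_TT, h.inner_NN, h.inner_TN]; norm_num

theorem norm_binormal (h : FrenetCurve γ) (s : ℝ) : ‖binormal γ s‖ = 1 := by
  have := h.inner_BB s
  rw [real_inner_self_eq_norm_sq] at this
  nlinarith [norm_nonneg (binormal γ s)]

theorem cross_TN (_h : FrenetCurve γ) (s : ℝ) : cross (tangent γ s) (normal γ s) = binormal γ s := rfl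

theorem cross_TB (h : FrenetCurve γ) (s : ℝ) : cross (tangent γ s) (binormal γ s) = -normal γ s := by
  rw [binormal, cross_cross_left, h.inner_TN, h.inner_TT]; simp

theorem cross_NB (h : FrenetCurve γ) (s : ℝ) : cross (normal γ s) (binormal γ s) = tangent γ s := by
  rw [binormal, cross_cross_left, h.inner_NT, h.inner_NN]; simp

theorem cross_NT (h : FrenetCurve γ) (s : ℝ) : cross (normal γ s) (tangent γ s) = -binormal γ s := by
  rw [cross_anticomm, h.cross_TN]

theorem expansion (h : FrenetCurve γ) (s : ℝ) (v : E3) : v = (inner ℝ (tangent γ s) v : ℝ) • tangent γ s +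
    (inner ℝ (normal γ s) v : ℝ) • normal γ s + (inner ℝ (binormal γ s) v : ℝ) • binormal γ s :=
  frame_expansion (h.norm_tangent s) (h.norm_normal s) (h.inner_TN s) v

theorem hasDerivAt_normal (h : FrenetCurve γ) (s : ℝ) : HasDerivAt (normal γ)
    (-curvature γ s • tangent γ s + torsion γ s • binormal γ s) s := by
  have h0 : HasDerivAt (normal γ) (deriv (normal γ) s) s :=
    (h.smooth_normal.differentiable (by simp) s).hasDerivAt
  convert h0 using 1
  have hT := (h.hasDerivAt_tangent s).inner ℝ h0
  have hN := h0.inner ℝ h0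
  rw [funext h.inner_TN] at hT
  rw [funext h.inner_NN] at hN
  have h1 := hT.unique (hasDerivAt_const s (0 : ℝ))
  have h2 := hN.unique (hasDerivAt_const s (1 : ℝ))
  rw [inner_smul_left, h.inner_NN] at h1
  rw [real_inner_comm (normal γ s), ← two_mul] at h2
  have h3 : inner ℝ (normal γ s) (deriv (normal γ) s) = (0 : ℝ) := by linarith
  have h4 : inner ℝ (tangent γ s) (deriv (normal γ) s) = -curvature γ s := by
    simp only [conj_trivial, mul_one] at h1; linarith
  rw [h.expansion s (deriv (normal γ) s), h3, h4, torsion, real_inner_comm (deriv (normal γ) s)]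
  simp

theorem hasDerivAt_binormal (h : FrenetCurve γ) (s : ℝ) :
    HasDerivAt (binormal γ) (-torsion γ s • normal γ s) s := by
  have := (h.hasDerivAt_tangent s).cross (h.hasDerivAt_normal s)
  convert! this using 1
  rw [cross_smul_left, cross_self, smul_zero, zero_add, cross_add_right, cross_smul_right, cross_smul_right, cross_self,
    h.cross_TB]
  simp

end FrenetCurve

/-! ### Tame families of functions -/

section Tame

variable {E E₁ E₂ E₃ : Type} [NormedAddCommGroup E] [NormedSpace ℝ E]
  [NormedAddCommGroup E₁] [NormedSpace ℝ E₁] [NormedAddCommGroup E₂] [NormedSpace ℝ E₂]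
  [NormedAddCommGroup E₃] [NormedSpace ℝ E₃]

/-- The data relative to which families `F ε s` of functions are estimated: a weight `w ε s`
(the curvature of a family of curves, in applications) for the parameters `ε ∈ I`, rapidly
decreasing in `s` uniformly in `ε`, and an open set `J` of parameters at which families are to be
differentiable. With `J = ∅` nothing is asked about the dependence on `ε`. -/
structure Window where
  /-- the parameters for which estimates hold -/
  I : Set ℝ
  /-- the parameters at which families are differentiable -/
  J : Set ℝ
  /-- the weight -/
  w : ℝ → ℝ → ℝ
  isOpen_J : IsOpen J
  J_sub : J ⊆ I
  pos : ∀ ε ∈ I, ∀ s, 0 < w ε s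
  rapid : ∀ k : ℕ, ∃ C : ℝ, ∀ ε ∈ I, ∀ s, w ε s * (1 + |s|) ^ k ≤ C

namespace Window

variable (D : Window)

/-- `F` is bounded by the `n`-th power of the weight times a polynomial in `|s|`. -/
def PolyBdd (n : ℤ) (F : ℝ → ℝ → E) : Prop :=
  ∃ (C : ℝ) (N : ℕ), ∀ ε ∈ D.I, ∀ s, ‖F ε s‖ ≤ C * (1 + |s|) ^ N * D.w ε s ^ n

/-- `F` and `G` are bounded by the `n`-th power of the weight, up to polynomials in `s`, and `G` is
the derivative of `F` with respect to the parameter. -/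
structure Tame₀ (n : ℤ) (F G : ℝ → ℝ → E) : Prop where
  bdd : D.PolyBdd n F
  bdd' : D.PolyBdd n G
  cont : ∀ ε ∈ D.I, Continuous (F ε)
  cont' : ∀ ε ∈ D.I, Continuous (G ε)
  hasDerivAt : ∀ ε ∈ D.J, ∀ s, HasDerivAt (fun e => F e s) (G ε s) ε

/-- The derivatives of order at most `k` with respect to `s` of the pair `(F, G)` satisfy
`Window.Tame₀`. -/
def Tame : ℕ → ℤ → (F G : ℝ → ℝ → E) → Prop
  | 0, n, F, G => D.Tame₀ n F G
  | k + 1, n, F, G => D.Tame₀ n F G ∧ ∃ F' G' : ℝ → ℝ → E,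
      (∀ ε ∈ D.I, ∀ s, HasDerivAt (F ε) (F' ε s) s ∧ HasDerivAt (G ε) (G' ε s) s) ∧
      Tame k n F' G'

variable {D} {n m : ℤ} {k : ℕ} {F G F' G' : ℝ → ℝ → E}

theorem PolyBdd.exists_nonneg (h : D.PolyBdd n F) : ∃ (C : ℝ) (N : ℕ), 0 ≤ C ∧
    ∀ ε ∈ D.I, ∀ s, ‖F ε s‖ ≤ C * (1 + |s|) ^ N * D.w ε s ^ n := by
  obtain ⟨C, N, h⟩ := h
  refine ⟨|C|, N, abs_nonneg C, fun ε hε s => (h ε hε s).trans ?_⟩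
  have := zpow_pos (D.pos ε hε s) n
  gcongr
  exact le_abs_self C

theorem PolyBdd.add (h : D.PolyBdd n F) (h' : D.PolyBdd n G) :
    D.PolyBdd n (fun ε s => F ε s + G ε s) := by
  obtain ⟨C, N, hC, h⟩ := h.exists_nonneg
  obtain ⟨C', N', hC', h'⟩ := h'.exists_nonneg
  refine ⟨C + C', N + N', fun ε hε s => (norm_add_le _ _).trans ?_⟩
  have hw := zpow_pos (D.pos ε hε s) n
  have h1 : (1 + |s|) ^ N ≤ (1 + |s|) ^ (N + N') :=
    pow_le_pow_right₀ (by linarith [abs_nonneg s]) (by omega)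
  have h2 : (1 + |s|) ^ N' ≤ (1 + |s|) ^ (N + N') :=
    pow_le_pow_right₀ (by linarith [abs_nonneg s]) (by omega)
  calc ‖F ε s‖ + ‖G ε s‖ ≤ C * (1 + |s|) ^ N * D.w ε s ^ n + C' * (1 + |s|) ^ N' * D.w ε s ^ n :=
        add_le_add (h ε hε s) (h' ε hε s)
    _ ≤ C * (1 + |s|) ^ (N + N') * D.w ε s ^ n + C' * (1 + |s|) ^ (N + N') * D.w ε s ^ n := by
        gcongr
    _ = _ := by ring

theorem PolyBdd.bilin (B : E₁ →L[ℝ] E₂ →L[ℝ] E₃) {F : ℝ → ℝ → E₁} {G : ℝ → ℝ → E₂}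
    (h : D.PolyBdd n F) (h' : D.PolyBdd m G) :
    D.PolyBdd (n + m) (fun ε s => B (F ε s) (G ε s)) := by
  obtain ⟨C, N, hC, h⟩ := h.exists_nonneg
  obtain ⟨C', N', hC', h'⟩ := h'.exists_nonneg
  refine ⟨‖B‖ * C * C', N + N', fun ε hε s => (B.le_opNorm₂ _ _).trans ?_⟩
  have hw := zpow_pos (D.pos ε hε s) n
  have hw' := zpow_pos (D.pos ε hε s) m
  rw [zpow_add₀ (D.pos ε hε s).ne', pow_add]
  calc ‖B‖ * ‖F ε s‖ * ‖G ε s‖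
      ≤ ‖B‖ * (C * (1 + |s|) ^ N * D.w ε s ^ n) * (C' * (1 + |s|) ^ N' * D.w ε s ^ m) := by
        gcongr
        exacts [h ε hε s, h' ε hε s]
    _ = _ := by ring

theorem PolyBdd.lower (h : D.PolyBdd n F) : D.PolyBdd (n - 1) F := by
  obtain ⟨C, N, hC, h⟩ := h.exists_nonneg
  obtain ⟨C', h'⟩ := D.rapid 0
  refine ⟨C * C', N, fun ε hε s => (h ε hε s).trans ?_⟩
  have hw := zpow_pos (D.pos ε hε s) (n - 1)
  have h1 : D.w ε s ^ n = D.w ε s * D.w ε s ^ (n - 1) := by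
    rw [← zpow_one_add₀ (D.pos ε hε s).ne']; congr 1; ring
  have h2 := h' ε hε s
  rw [pow_zero, mul_one] at h2
  rw [h1]
  calc C * (1 + |s|) ^ N * (D.w ε s * D.w ε s ^ (n - 1))
      ≤ C * (1 + |s|) ^ N * (C' * D.w ε s ^ (n - 1)) := by gcongr
    _ = _ := by ring

theorem PolyBdd.congr (h : D.PolyBdd n F) (hF : ∀ ε ∈ D.I, F ε = F' ε) : D.PolyBdd n F' := by
  obtain ⟨C, N, h⟩ := h
  exact ⟨C, N, fun ε hε s => by rw [← hF ε hε]; exact h ε hε s⟩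

theorem Tame.tame₀ (h : D.Tame k n F G) : D.Tame₀ n F G := by
  cases k with
  | zero => exact h
  | succ k => exact h.1

theorem Tame.of_succ (h : D.Tame (k + 1) n F G) : D.Tame k n F G := by
  induction k generalizing F G with
  | zero => exact h.1
  | succ k ih =>
    obtain ⟨h0, F', G', hd, h1⟩ := h
    exact ⟨h0, F', G', hd, ih h1⟩

theorem Tame₀.congr (h : D.Tame₀ n F G) (hF : ∀ ε ∈ D.I, F ε = F' ε)
    (hG : ∀ ε ∈ D.I, G ε = G' ε) : D.Tame₀ n F' G' where
  bdd := h.bdd.congr hF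
  bdd' := h.bdd'.congr hG
  cont ε hε := hF ε hε ▸ h.cont ε hε
  cont' ε hε := hG ε hε ▸ h.cont' ε hε
  hasDerivAt ε hε s := by
    rw [← hG ε (D.J_sub hε)]
    refine (h.hasDerivAt ε hε s).congr_of_eventuallyEq ?_
    filter_upwards [D.isOpen_J.mem_nhds hε] with e he
    rw [hF e (D.J_sub he)]

theorem Tame.congr (h : D.Tame k n F G) (hF : ∀ ε ∈ D.I, F ε = F' ε)
    (hG : ∀ ε ∈ D.I, G ε = G' ε) : D.Tame k n F' G' := by
  cases k with
  | zero => exact Tame₀.congr h hF hG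
  | succ k =>
    obtain ⟨h0, f, g, hd, h1⟩ := h
    refine ⟨h0.congr hF hG, f, g, fun ε hε s => ?_, h1⟩
    rw [← hF ε hε, ← hG ε hε]
    exact hd ε hε s

theorem Tame.add {F₁ G₁ F₂ G₂ : ℝ → ℝ → E} (h₁ : D.Tame k n F₁ G₁) (h₂ : D.Tame k n F₂ G₂) :
    D.Tame k n (fun ε s => F₁ ε s + F₂ ε s) (fun ε s => G₁ ε s + G₂ ε s) := by
  induction k generalizing F₁ G₁ F₂ G₂ with
  | zero =>
    exact ⟨h₁.bdd.add h₂.bdd, h₁.bdd'.add h₂.bdd', fun ε hε => (h₁.cont ε hε).add (h₂.cont ε hε),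
      fun ε hε => (h₁.cont' ε hε).add (h₂.cont' ε hε),
      fun ε hε s => (h₁.hasDerivAt ε hε s).add (h₂.hasDerivAt ε hε s)⟩
  | succ k ih =>
    have h0 := ih h₁.of_succ h₂.of_succ
    obtain ⟨-, F₁', G₁', hd₁, h₁'⟩ := h₁
    obtain ⟨-, F₂', G₂', hd₂, h₂'⟩ := h₂
    exact ⟨h0.tame₀, _, _, fun ε hε s => ⟨(hd₁ ε hε s).1.add (hd₂ ε hε s).1,
      (hd₁ ε hε s).2.add (hd₂ ε hε s).2⟩, ih h₁' h₂'⟩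

theorem _root_.HasDerivAt.bilin (B : E₁ →L[ℝ] E₂ →L[ℝ] E₃) {f : ℝ → E₁} {g : ℝ → E₂} {f' : E₁}
    {g' : E₂} {s : ℝ} (hf : HasDerivAt f f' s) (hg : HasDerivAt g g' s) :
    HasDerivAt (fun t => B (f t) (g t)) (B f' (g s) + B (f s) g') s :=
  (B.hasDerivAt_of_bilinear (fun _ => hf) fun _ => hg).congr_deriv (add_comm _ _)

/-- Products of tame families are tame, and the degrees add up. -/
theorem Tame.bilin (B : E₁ →L[ℝ] E₂ →L[ℝ] E₃) {F₁ G₁ : ℝ → ℝ → E₁} {F₂ G₂ : ℝ → ℝ → E₂}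
    (h₁ : D.Tame k n F₁ G₁) (h₂ : D.Tame k m F₂ G₂) :
    D.Tame k (n + m) (fun ε s => B (F₁ ε s) (F₂ ε s))
      (fun ε s => B (G₁ ε s) (F₂ ε s) + B (F₁ ε s) (G₂ ε s)) := by
  induction k generalizing F₁ G₁ F₂ G₂ with
  | zero =>
    refine ⟨h₁.bdd.bilin B h₂.bdd, (h₁.bdd'.bilin B h₂.bdd).add (h₁.bdd.bilin B h₂.bdd'),
      fun ε hε => ?_, fun ε hε => ?_,
      fun ε hε s => (h₁.hasDerivAt ε hε s).bilin B (h₂.hasDerivAt ε hε s)⟩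
    · exact (B.continuous.comp (h₁.cont ε hε)).clm_apply (h₂.cont ε hε)
    · exact ((B.continuous.comp (h₁.cont' ε hε)).clm_apply (h₂.cont ε hε)).add
        ((B.continuous.comp (h₁.cont ε hε)).clm_apply (h₂.cont' ε hε))
  | succ k ih =>
    have h0 := ih h₁.of_succ h₂.of_succ
    have hs₁ := h₁.of_succ
    have hs₂ := h₂.of_succ
    obtain ⟨-, F₁', G₁', hd₁, h₁'⟩ := h₁
    obtain ⟨-, F₂', G₂', hd₂, h₂'⟩ := h₂
    refine ⟨h0.tame₀, _, _, fun ε hε s => ⟨(hd₁ ε hε s).1.bilin B (hd₂ ε hε s).1,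
      ((hd₁ ε hε s).2.bilin B (hd₂ ε hε s).1).add ((hd₁ ε hε s).1.bilin B (hd₂ ε hε s).2)⟩, ?_⟩
    refine ((ih h₁' hs₂).add (ih hs₁ h₂')).congr (fun ε _ => rfl) fun ε _ => ?_
    funext s
    abel

theorem Tame.lower (h : D.Tame k n F G) : D.Tame k (n - 1) F G := by
  induction k generalizing F G with
  | zero => exact ⟨h.bdd.lower, h.bdd'.lower, h.cont, h.cont', h.hasDerivAt⟩
  | succ k ih =>
    have h0 := ih h.of_succ
    obtain ⟨-, F', G', hd, h'⟩ := h
    exact ⟨h0.tame₀, F', G', hd, ih h'⟩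

theorem Tame.const (D : Window) (k : ℕ) (c : E) :
    D.Tame k 0 (fun _ _ => c) (fun _ _ => (0 : E)) := by
  have key : ∀ c : E, D.Tame₀ 0 (fun _ _ => c) (fun _ _ => (0 : E)) := fun c =>
    ⟨⟨‖c‖, 0, by simp⟩, ⟨0, 0, by simp⟩, fun _ _ => continuous_const, fun _ _ => continuous_const,
      fun _ _ _ => hasDerivAt_const _ _⟩
  induction k generalizing c with
  | zero => exact key c
  | succ k ih =>
    exact ⟨key c, _, _, fun ε _ s => ⟨hasDerivAt_const _ _, hasDerivAt_const _ _⟩, ih 0⟩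

theorem Tame.param (D : Window) (k : ℕ) : D.Tame k 0 (fun _ s => s) (fun _ _ => (0 : ℝ)) := by
  have h0 : D.Tame₀ 0 (fun _ s => s) (fun _ _ => (0 : ℝ)) :=
    ⟨⟨1, 1, by simp⟩, ⟨0, 0, by simp⟩, fun _ _ => continuous_id, fun _ _ => continuous_const,
      fun _ _ _ => hasDerivAt_const _ _⟩
  cases k with
  | zero => exact h0
  | succ k =>
    exact ⟨h0, _, _, fun ε _ s => ⟨hasDerivAt_id _, hasDerivAt_const _ _⟩, Tame.const D k 1⟩

theorem Tame.mul {F₁ G₁ F₂ G₂ : ℝ → ℝ → ℝ} (h₁ : D.Tame k n F₁ G₁) (h₂ : D.Tame k m F₂ G₂) :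
    D.Tame k (n + m) (fun ε s => F₁ ε s * F₂ ε s)
      (fun ε s => G₁ ε s * F₂ ε s + F₁ ε s * G₂ ε s) :=
  h₁.bilin (ContinuousLinearMap.mul ℝ ℝ) h₂

theorem Tame.smul {F₁ G₁ : ℝ → ℝ → ℝ} {F₂ G₂ : ℝ → ℝ → E} (h₁ : D.Tame k n F₁ G₁)
    (h₂ : D.Tame k m F₂ G₂) : D.Tame k (n + m) (fun ε s => F₁ ε s • F₂ ε s)
      (fun ε s => G₁ ε s • F₂ ε s + F₁ ε s • G₂ ε s) :=
  h₁.bilin (ContinuousLinearMap.lsmul ℝ ℝ) h₂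

theorem Tame.const_smul (c : ℝ) (h : D.Tame k n F G) :
    D.Tame k n (fun ε s => c • F ε s) (fun ε s => c • G ε s) := by
  have := (Tame.const D k c).smul h
  rw [zero_add] at this
  exact this.congr (fun _ _ => rfl) fun _ _ => by simp

theorem Tame.inner {F₁ G₁ F₂ G₂ : ℝ → ℝ → E3} (h₁ : D.Tame k n F₁ G₁) (h₂ : D.Tame k m F₂ G₂) :
    D.Tame k (n + m) (fun ε s => (inner ℝ (F₁ ε s) (F₂ ε s) : ℝ))
      (fun ε s => (inner ℝ (G₁ ε s) (F₂ ε s) + inner ℝ (F₁ ε s) (G₂ ε s) : ℝ)) :=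
  h₁.bilin (innerSL ℝ) h₂

theorem Tame.cross {F₁ G₁ F₂ G₂ : ℝ → ℝ → E3} (h₁ : D.Tame k n F₁ G₁)
    (h₂ : D.Tame k m F₂ G₂) : D.Tame k (n + m) (fun ε s => cross (F₁ ε s) (F₂ ε s))
      (fun ε s => VortexFilament.cross (G₁ ε s) (F₂ ε s) +
        VortexFilament.cross (F₁ ε s) (G₂ ε s)) :=
  h₁.bilin crossL h₂

theorem Tame.contDiff (h : D.Tame k n F G) {ε : ℝ} (hε : ε ∈ D.I) :
    ContDiff ℝ k (F ε) ∧ ContDiff ℝ k (G ε) := by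
  induction k generalizing F G with
  | zero => exact ⟨contDiff_zero.2 (h.cont ε hε), contDiff_zero.2 (h.cont' ε hε)⟩
  | succ k ih =>
    obtain ⟨h0, F', G', hd, h'⟩ := h
    have h1 : deriv (F ε) = F' ε := funext fun s => (hd ε hε s).1.deriv
    have h2 : deriv (G ε) = G' ε := funext fun s => (hd ε hε s).2.deriv
    rw [Nat.cast_succ, contDiff_succ_iff_deriv, contDiff_succ_iff_deriv, h1, h2]
    exact ⟨⟨fun s => (hd ε hε s).1.differentiableAt, by simp, (ih h').1⟩,
      ⟨fun s => (hd ε hε s).2.differentiableAt, by simp, (ih h').2⟩⟩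

/-- Families all of whose derivatives are tame. -/
def TameSmooth (D : Window) (n : ℤ) (F G : ℝ → ℝ → E) : Prop := ∀ k, D.Tame k n F G

theorem TameSmooth.hasDerivAt (h : D.TameSmooth n F G) {ε : ℝ} (hε : ε ∈ D.I) (s : ℝ) :
    HasDerivAt (F ε) (deriv (F ε) s) s ∧ HasDerivAt (G ε) (deriv (G ε) s) s :=
  ⟨((h 1).contDiff hε).1.differentiable (by simp) s |>.hasDerivAt,
    ((h 1).contDiff hε).2.differentiable (by simp) s |>.hasDerivAt⟩

theorem TameSmooth.deriv (h : D.TameSmooth n F G) :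
    D.TameSmooth n (fun ε => deriv (F ε)) (fun ε => deriv (G ε)) := by
  intro k
  obtain ⟨-, F', G', hd, h'⟩ := h (k + 1)
  exact h'.congr (fun ε hε => funext fun s => ((hd ε hε s).1.deriv).symm)
    fun ε hε => funext fun s => ((hd ε hε s).2.deriv).symm

theorem TameSmooth.contDiff (h : D.TameSmooth n F G) {ε : ℝ} (hε : ε ∈ D.I) :
    ContDiff ℝ ∞ (F ε) :=
  contDiff_infty.2 fun k => ((h k).contDiff hε).1

theorem TameSmooth.congr (h : D.TameSmooth n F G) (hF : ∀ ε ∈ D.I, F ε = F' ε)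
    (hG : ∀ ε ∈ D.I, G ε = G' ε) : D.TameSmooth n F' G' :=
  fun k => (h k).congr hF hG

end Window
end Tame

/-! ### Integrals over the line -/

/-- The anti-derivative of `f` whose limits at the two ends are opposite. -/
def halfInt (f : ℝ → ℝ) (s : ℝ) : ℝ :=
  (1 / 2 : ℝ) * ((∫ t in Set.Iic s, f t) - ∫ t in Set.Ioi s, f t)

theorem dsInv_apply (f : ScalarField γ₀) (γ : BAL γ₀) : dsInv f γ = halfInt (f γ) := rfl

theorem halfInt_eq {f : ℝ → ℝ} (hf : Integrable f) (s : ℝ) :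
    halfInt f s = (∫ t in Set.Iic s, f t) - (1 / 2 : ℝ) * ∫ t, f t := by
  rw [halfInt, ← intervalIntegral.integral_Iic_add_Ioi (b := s) hf.integrableOn hf.integrableOn]
  ring

theorem hasDerivAt_halfInt {f : ℝ → ℝ} (hf : Integrable f) (hc : Continuous f) (s : ℝ) :
    HasDerivAt (halfInt f) (f s) s := by
  have h : halfInt f = fun s => (∫ t in (0 : ℝ)..s, f t) + halfInt f 0 := by
    funext s
    rw [halfInt_eq hf, halfInt_eq hf,
      ← intervalIntegral.integral_Iic_sub_Iic hf.integrableOn hf.integrableOn]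
    ring
  rw [h]
  exact (intervalIntegral.integral_hasDerivAt_right (hc.intervalIntegrable _ _)
    hc.aestronglyMeasurable.stronglyMeasurableAtFilter hc.continuousAt).add_const _

theorem tendsto_halfInt_atTop {f : ℝ → ℝ} (hf : Integrable f) :
    Tendsto (halfInt f) atTop (𝓝 ((1 / 2 : ℝ) * ∫ t, f t)) := by
  have h : Tendsto (fun s => ∫ t in Set.Iic s, f t) atTop (𝓝 (∫ t, f t)) :=
    (aecover_Iic (μ := volume) tendsto_id).integral_tendsto_of_countably_generated hf
  rw [funext (halfInt_eq hf)]
  convert h.sub_const ((1 / 2 : ℝ) * ∫ t, f t) using 2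
  ring

theorem tendsto_halfInt_atBot {f : ℝ → ℝ} (hf : Integrable f) :
    Tendsto (halfInt f) atBot (𝓝 (-((1 / 2 : ℝ) * ∫ t, f t))) := by
  have h : Tendsto (fun s => ∫ t in Set.Iic s, f t) atBot (𝓝 0) :=
    tendsto_integral_Iic_zero tendsto_id
  rw [funext (halfInt_eq hf)]
  convert h.sub_const ((1 / 2 : ℝ) * ∫ t, f t) using 2
  ring

theorem abs_halfInt_le {f b : ℝ → ℝ} (hb : Integrable b) (hfb : ∀ s, |f s| ≤ b s) (s : ℝ) :
    |halfInt f s| ≤ ∫ t, b t := by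
  have h1 : |∫ t in Set.Iic s, f t| ≤ ∫ t in Set.Iic s, b t :=
    by
    rw [← Real.norm_eq_abs]
    exact norm_integral_le_of_norm_le hb.integrableOn (Eventually.of_forall hfb)
  have h2 : |∫ t in Set.Ioi s, f t| ≤ ∫ t in Set.Ioi s, b t :=
    by
    rw [← Real.norm_eq_abs]
    exact norm_integral_le_of_norm_le hb.integrableOn (Eventually.of_forall hfb)
  have h3 := intervalIntegral.integral_Iic_add_Ioi (b := s) hb.integrableOn hb.integrableOn
  have h4 : (0 : ℝ) ≤ ∫ t, b t := integral_nonneg fun t => (abs_nonneg _).trans (hfb t)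
  rw [halfInt, abs_mul, abs_of_pos (by norm_num : (0 : ℝ) < 1 / 2)]
  have h5 := abs_sub (∫ t in Set.Iic s, f t) (∫ t in Set.Ioi s, f t)
  linarith

/-- A function with an integrable derivative and opposite limits at the two ends is recovered from
its derivative by `halfInt`. -/
theorem halfInt_deriv_eq {f f' : ℝ → ℝ} {a : ℝ} (hd : ∀ s, HasDerivAt f (f' s) s)
    (hi : Integrable f') (htop : Tendsto f atTop (𝓝 a)) (hbot : Tendsto f atBot (𝓝 (-a))) :
    halfInt f' = f := by
  funext s
  have h1 := integral_Iic_of_hasDerivAt_of_tendsto' (fun x _ => hd x)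
    (hi.integrableOn (s := Set.Iic s)) hbot
  have h2 := integral_Ioi_of_hasDerivAt_of_tendsto' (fun x _ => hd x)
    (hi.integrableOn (s := Set.Ioi s)) htop
  rw [halfInt, h1, h2]
  ring

namespace Window

variable {E : Type} [NormedAddCommGroup E] [NormedSpace ℝ E]
variable {D : Window} {n m : ℤ} {k : ℕ}

theorem PolyBdd.rapid {F : ℝ → ℝ → E} (h : D.PolyBdd 1 F) (k : ℕ) :
    ∃ C : ℝ, ∀ ε ∈ D.I, ∀ s, ‖F ε s‖ * (1 + |s|) ^ k ≤ C := by
  obtain ⟨C, N, hC, h⟩ := h.exists_nonneg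
  obtain ⟨C', h'⟩ := D.rapid (N + k)
  refine ⟨C * C', fun ε hε s => ?_⟩
  have h1 := h ε hε s
  rw [zpow_one] at h1
  calc ‖F ε s‖ * (1 + |s|) ^ k ≤ C * (1 + |s|) ^ N * D.w ε s * (1 + |s|) ^ k := by gcongr
    _ = C * (D.w ε s * (1 + |s|) ^ (N + k)) := by rw [pow_add]; ring
    _ ≤ C * C' := by gcongr; exact h' ε hε s

theorem PolyBdd.le_inv_one_add_sq {F : ℝ → ℝ → E} (h : D.PolyBdd 1 F) :
    ∃ C : ℝ, ∀ ε ∈ D.I, ∀ s, ‖F ε s‖ ≤ C * (1 + s ^ 2)⁻¹ := by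
  obtain ⟨C, h⟩ := h.rapid 2
  refine ⟨C, fun ε hε s => ?_⟩
  rw [← div_eq_mul_inv, le_div_iff₀ (by positivity)]
  refine le_trans ?_ (h ε hε s)
  gcongr
  nlinarith [abs_nonneg s, sq_abs s]

theorem PolyBdd.tendsto_zero {F : ℝ → ℝ → E} (h : D.PolyBdd 1 F) {ε : ℝ} (hε : ε ∈ D.I) :
    Tendsto (F ε) (cocompact ℝ) (𝓝 0) := by
  obtain ⟨C, h⟩ := h.rapid 1
  have h1 : Tendsto (fun s : ℝ => C * ‖s‖⁻¹) (cocompact ℝ) (𝓝 (C * 0)) :=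
    (tendsto_inv_atTop_zero.comp tendsto_norm_cocompact_atTop).const_mul C
  rw [mul_zero] at h1
  refine squeeze_zero_norm' ?_ h1
  have h0 : ∀ᶠ s : ℝ in cocompact ℝ, 0 < ‖s‖ :=
    tendsto_norm_cocompact_atTop.eventually_gt_atTop 0
  filter_upwards [h0] with s hs
  rw [← div_eq_mul_inv, le_div_iff₀ hs]
  refine le_trans ?_ (h ε hε s)
  rw [pow_one, Real.norm_eq_abs]
  gcongr
  linarith

theorem Tame₀.integrable {F G : ℝ → ℝ → ℝ} (h : D.Tame₀ 1 F G) {ε : ℝ} (hε : ε ∈ D.I) :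
    Integrable (F ε) ∧ Integrable (G ε) := by
  obtain ⟨C, hC⟩ := h.bdd.le_inv_one_add_sq
  obtain ⟨C', hC'⟩ := h.bdd'.le_inv_one_add_sq
  exact ⟨(integrable_inv_one_add_sq.const_mul C).mono' (h.cont ε hε).aestronglyMeasurable
      (Eventually.of_forall (hC ε hε)),
    (integrable_inv_one_add_sq.const_mul C').mono' (h.cont' ε hε).aestronglyMeasurable
      (Eventually.of_forall (hC' ε hε))⟩

theorem Tame₀.hasDerivAt_setIntegral {F G : ℝ → ℝ → ℝ} (h : D.Tame₀ 1 F G) {ε : ℝ}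
    (hε : ε ∈ D.J) (S : Set ℝ) :
    HasDerivAt (fun e => ∫ s in S, F e s) (∫ s in S, G ε s) ε := by
  obtain ⟨C, hC⟩ := h.bdd'.le_inv_one_add_sq
  have hJ := D.isOpen_J.mem_nhds hε
  refine (hasDerivAt_integral_of_dominated_loc_of_deriv_le (F := F) (F' := G)
    (bound := fun s => C * (1 + s ^ 2)⁻¹) hJ ?_ (h.integrable (D.J_sub hε)).1.integrableOn
    (h.cont' ε (D.J_sub hε)).aestronglyMeasurable ?_
    (integrable_inv_one_add_sq.const_mul C).integrableOn ?_).2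
  · filter_upwards [hJ] with e he using (h.cont e (D.J_sub he)).aestronglyMeasurable
  · exact Eventually.of_forall fun s e he => hC e (D.J_sub he) s
  · exact Eventually.of_forall fun s e he => h.hasDerivAt e he s

theorem Tame.integ {F G : ℝ → ℝ → ℝ} (h : D.Tame₀ 1 F G) :
    D.Tame k 0 (fun ε _ => ∫ t, F ε t) (fun ε _ => ∫ t, G ε t) := by
  have h0 : D.Tame₀ 0 (fun ε _ => ∫ t, F ε t) (fun ε _ => ∫ t, G ε t) := by
    obtain ⟨C, hC⟩ := h.bdd.le_inv_one_add_sq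
    obtain ⟨C', hC'⟩ := h.bdd'.le_inv_one_add_sq
    refine ⟨⟨∫ t, C * (1 + t ^ 2)⁻¹, 0, fun ε hε s => ?_⟩,
      ⟨∫ t, C' * (1 + t ^ 2)⁻¹, 0, fun ε hε s => ?_⟩, fun _ _ => continuous_const,
      fun _ _ => continuous_const, fun ε hε s => ?_⟩
    · simpa using norm_integral_le_of_norm_le (integrable_inv_one_add_sq.const_mul C)
        (Eventually.of_forall (hC ε hε))
    · simpa using norm_integral_le_of_norm_le (integrable_inv_one_add_sq.const_mul C')
        (Eventually.of_forall (hC' ε hε))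
    · simpa using h.hasDerivAt_setIntegral hε Set.univ
  cases k with
  | zero => exact h0
  | succ k =>
    exact ⟨h0, fun _ _ => 0, fun _ _ => 0,
      fun ε _ s => ⟨hasDerivAt_const _ _, hasDerivAt_const _ _⟩, Tame.const D k 0⟩

/-- The anti-derivative of a tame family of degree `1` is bounded, but need not decay at the ends. -/
theorem Tame.halfInt {F G : ℝ → ℝ → ℝ} (h : D.Tame k 1 F G) :
    D.Tame k 0 (fun ε => halfInt (F ε)) (fun ε => halfInt (G ε)) := by
  have hi := fun ε hε => h.tame₀.integrable (ε := ε) hε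
  have hF := fun ε hε => hasDerivAt_halfInt (hi ε hε).1 (h.tame₀.cont ε hε)
  have hG := fun ε hε => hasDerivAt_halfInt (hi ε hε).2 (h.tame₀.cont' ε hε)
  have h0 : D.Tame₀ 0 (fun ε => VortexFilament.halfInt (F ε))
      (fun ε => VortexFilament.halfInt (G ε)) := by
    obtain ⟨C, hC⟩ := h.tame₀.bdd.le_inv_one_add_sq
    obtain ⟨C', hC'⟩ := h.tame₀.bdd'.le_inv_one_add_sq
    refine ⟨⟨∫ t, C * (1 + t ^ 2)⁻¹, 0, fun ε hε s => ?_⟩,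
      ⟨∫ t, C' * (1 + t ^ 2)⁻¹, 0, fun ε hε s => ?_⟩,
      fun ε hε => continuous_iff_continuousAt.2 fun s => (hF ε hε s).continuousAt,
      fun ε hε => continuous_iff_continuousAt.2 fun s => (hG ε hε s).continuousAt,
      fun ε hε s => ?_⟩
    · simpa using abs_halfInt_le (integrable_inv_one_add_sq.const_mul C) (hC ε hε) s
    · simpa using abs_halfInt_le (integrable_inv_one_add_sq.const_mul C') (hC' ε hε) s
    · exact ((h.tame₀.hasDerivAt_setIntegral hε _).sub
        (h.tame₀.hasDerivAt_setIntegral hε _)).const_mul _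
  cases k with
  | zero => exact h0
  | succ k =>
    have := h.of_succ.lower
    rw [sub_self] at this
    exact ⟨h0, F, G, fun ε hε s => ⟨hF ε hε s, hG ε hε s⟩, this⟩

/-- If `q` is tame of degree `2` then so is, in degree `-1`, the function `h` with `h² q = 1`. -/
theorem Tame.inv_sqrt {q q' h : ℝ → ℝ → ℝ} (hq : D.Tame k 2 q q')
    (hpos : ∀ ε ∈ D.I, ∀ s, 0 < h ε s) (hqh : ∀ ε ∈ D.I, ∀ s, h ε s ^ 2 * q ε s = 1)
    (hb : D.PolyBdd (-1) h) :
    D.Tame k (-1) h (fun ε s => (-1 / 2 : ℝ) * (h ε s ^ 3 * q' ε s)) := by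
  have hsqrt : ∀ ε ∈ D.I, ∀ s, h ε s = (Real.sqrt (q ε s))⁻¹ := fun ε hε s => by
    have h1 : q ε s = ((h ε s)⁻¹) ^ 2 := by
      have := hqh ε hε s
      have := (hpos ε hε s).ne'
      field_simp
      linarith
    rw [h1, Real.sqrt_sq (inv_nonneg.2 (hpos ε hε s).le), inv_inv]
  have hqpos : ∀ ε ∈ D.I, ∀ s, 0 < q ε s := fun ε hε s => by
    have := hqh ε hε s
    by_contra hcon
    nlinarith [pow_pos (hpos ε hε s) 2]
  -- the derivative of `q ^ (-1/2)` along a curve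
  have key : ∀ {f : ℝ → ℝ} {f' x : ℝ} {g : ℝ → ℝ}, HasDerivAt f f' x → 0 < f x →
      (∀ᶠ y in 𝓝 x, g y = (Real.sqrt (f y))⁻¹) →
      HasDerivAt g ((-1 / 2 : ℝ) * (g x ^ 3 * f')) x := by
    intro f f' x g hf hfx hg
    have hs := Real.sqrt_pos.2 hfx
    refine (((hf.sqrt hfx.ne').inv hs.ne').congr_of_eventuallyEq hg).congr_deriv ?_
    rw [hg.self_of_nhds]
    field_simp
  have h0 : D.Tame₀ (-1) h (fun ε s => (-1 / 2 : ℝ) * (h ε s ^ 3 * q' ε s)) := by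
    have h3 : D.PolyBdd (-1) (fun ε s => (-1 / 2 : ℝ) * (h ε s ^ 3 * q' ε s)) := by
      obtain ⟨C, N, hC, hb⟩ := hb.exists_nonneg
      obtain ⟨C', N', hC', hb'⟩ := hq.tame₀.bdd'.exists_nonneg
      refine ⟨C ^ 3 * C', 3 * N + N', fun ε hε s => ?_⟩
      have hw := D.pos ε hε s
      have e1 := hb ε hε s
      have e2 := hb' ε hε s
      rw [norm_mul, norm_mul, norm_pow]
      calc ‖(-1 / 2 : ℝ)‖ * (‖h ε s‖ ^ 3 * ‖q' ε s‖)
          ≤ 1 * ((C * (1 + |s|) ^ N * D.w ε s ^ (-1 : ℤ)) ^ 3 *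
              (C' * (1 + |s|) ^ N' * D.w ε s ^ (2 : ℤ))) := by
            gcongr
            norm_num
        _ = _ := by
            rw [pow_add, pow_mul', zpow_neg_one, zpow_ofNat]
            generalize (1 + |s|) ^ N = x
            field_simp
    have hcq := hq.tame₀.cont
    have hch : ∀ ε ∈ D.I, Continuous (h ε) := fun ε hε => by
      rw [funext (hsqrt ε hε)]
      exact ((hcq ε hε).sqrt).inv₀ fun s => (Real.sqrt_pos.2 (hqpos ε hε s)).ne'
    refine ⟨hb, h3, hch, fun ε hε => ?_, fun ε hε s => ?_⟩
    · exact continuous_const.mul (((hch ε hε).pow 3).mul (hq.tame₀.cont' ε hε))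
    · refine key (f := fun e => q e s) (hq.tame₀.hasDerivAt ε hε s) (hqpos ε (D.J_sub hε) s) ?_
      filter_upwards [D.isOpen_J.mem_nhds hε] with e he using hsqrt e (D.J_sub he) s
  induction k with
  | zero => exact h0
  | succ k ih =>
    have hk := ih hq.of_succ
    obtain ⟨-, f, f', hd, hf⟩ := hq
    have hder : ∀ ε ∈ D.I, ∀ s, HasDerivAt (h ε) ((-1 / 2 : ℝ) * (h ε s ^ 3 * f ε s)) s :=
      fun ε hε s => key (hd ε hε s).1 (hqpos ε hε s) (Eventually.of_forall (hsqrt ε hε))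
    have hcube := ((hk.mul (hk.mul hk)).mul hf).const_smul (-1 / 2 : ℝ)
    refine ⟨h0, fun ε s => (-1 / 2 : ℝ) * (h ε s ^ 3 * f ε s),
      fun ε s => (-1 / 2 : ℝ) * ((3 * h ε s ^ 2 * ((-1 / 2 : ℝ) * (h ε s ^ 3 * f ε s))) *
        q' ε s + h ε s ^ 3 * f' ε s), fun ε hε s => ⟨hder ε hε s, ?_⟩,
      hcube.congr (fun ε _ => ?_) fun ε _ => ?_⟩
    · exact ((((hder ε hε s).pow 3).mul (hd ε hε s).2).const_mul (-1 / 2 : ℝ)).congr_deriv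
        (by simp)
    · funext s; simp only [smul_eq_mul]; ring
    · funext s; simp only [smul_eq_mul]; ring

end Window

/-! ### Regular families of curves -/

/-- The regularity and the locally uniform asymptotic conditions that `IsVariation` imposes on a
one-parameter family of curves. -/
structure RegularFamily (c : ℝ → BAL γ₀) (r : ℝ) : Prop where
  pos : 0 < r
  smooth : ContDiffOn ℝ ∞ (fun p : ℝ × ℝ => (c p.1).1 p.2) (Set.Ioo (-r) r ×ˢ Set.univ)
  rapid : ∀ k : ℕ, ∃ C : ℝ, ∀ ε ∈ Set.Ioo (-r) r, ∀ s, curvature (c ε).1 s * (1 + |s|) ^ k ≤ C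
  curv : ∀ k : ℕ, ∃ (C : ℝ) (N : ℕ), ∀ ε ∈ Set.Ioo (-r) r, ∀ s,
      |iteratedDeriv k (curvature (c ε).1) s| ≤ C * (1 + |s|) ^ N * curvature (c ε).1 s
  tors : ∀ k : ℕ, ∃ (C : ℝ) (N : ℕ), ∀ ε ∈ Set.Ioo (-r) r, ∀ s,
      |iteratedDeriv k (torsion (c ε).1) s| ≤ C * (1 + |s|) ^ N
  speed : ∀ k : ℕ, 1 ≤ k → ∃ (C : ℝ) (N : ℕ), ∀ ε ∈ Set.Ioo (-r) r, ∀ s,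
      ‖deriv (fun ε' => iteratedDeriv k (c ε').1 s) ε‖
        ≤ C * (1 + |s|) ^ N * curvature (c ε).1 s

theorem IsVariation.regular {γ : BAL γ₀} {X : ℝ → E3} {c : ℝ → BAL γ₀} (h : IsVariation γ X c) :
    ∃ r, RegularFamily c r := by
  obtain ⟨-, -, r, hr, h1, h2, h3, h4, h5⟩ := h
  exact ⟨r, hr, h1, h2, h3, h4, h5⟩

theorem natCast_lt_infty (n : ℕ) : (n : WithTop ℕ∞) < ∞ := by
  exact_mod_cast ENat.natCast_lt_top n

section Joint

variable {E : Type} [NormedAddCommGroup E] [NormedSpace ℝ E] {I : Set ℝ} {f : ℝ × ℝ → E}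

/-- The derivative of a function of `(ε, s)` with respect to `s`. -/
def partialS (f : ℝ × ℝ → E) (p : ℝ × ℝ) : E := fderiv ℝ f p (0, 1)

/-- The derivative of a function of `(ε, s)` with respect to `ε`. -/
def partialE (f : ℝ × ℝ → E) (p : ℝ × ℝ) : E := fderiv ℝ f p (1, 0)

theorem contDiffOn_partialS (hI : IsOpen I) (hf : ContDiffOn ℝ ∞ f (I ×ˢ Set.univ)) :
    ContDiffOn ℝ ∞ (partialS f) (I ×ˢ Set.univ) :=
  (hf.fderiv_of_isOpen (hI.prod isOpen_univ) (m := ∞) (by simp)).clm_apply contDiffOn_const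

variable {ε s : ℝ}

theorem hasDerivAt_partialS (hI : IsOpen I) (hf : ContDiffOn ℝ ∞ f (I ×ˢ Set.univ)) (hε : ε ∈ I) :
    HasDerivAt (fun t => f (ε, t)) (partialS f (ε, s)) s := by
  have h1 : HasFDerivAt f (fderiv ℝ f (ε, s)) (ε, s) :=
    ((hf.contDiffAt ((hI.prod isOpen_univ).mem_nhds ⟨hε, trivial⟩)).differentiableAt
      (by simp)).hasFDerivAt
  exact h1.comp_hasDerivAt s ((hasDerivAt_const s ε).prodMk (hasDerivAt_id s))

theorem hasDerivAt_partialE (hI : IsOpen I) (hf : ContDiffOn ℝ ∞ f (I ×ˢ Set.univ)) (hε : ε ∈ I) :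
    HasDerivAt (fun e => f (e, s)) (partialE f (ε, s)) ε := by
  have h1 : HasFDerivAt f (fderiv ℝ f (ε, s)) (ε, s) :=
    ((hf.contDiffAt ((hI.prod isOpen_univ).mem_nhds ⟨hε, trivial⟩)).differentiableAt
      (by simp)).hasFDerivAt
  exact h1.comp_hasDerivAt ε ((hasDerivAt_id ε).prodMk (hasDerivAt_const ε s))

theorem hasDerivAt_partialE_partialS (hI : IsOpen I) (hf : ContDiffOn ℝ ∞ f (I ×ˢ Set.univ))
    (hε : ε ∈ I) :
    HasDerivAt (fun t => partialE f (ε, t)) (partialE (partialS f) (ε, s)) s := by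
  have hat : ContDiffAt ℝ ∞ f (ε, s) :=
    hf.contDiffAt ((hI.prod isOpen_univ).mem_nhds ⟨hε, trivial⟩)
  have hd : HasFDerivAt (fderiv ℝ f) (fderiv ℝ (fderiv ℝ f) (ε, s)) (ε, s) :=
    ((hat.fderiv_right (m := 1) (natCast_lt_infty 2).le).differentiableAt (by simp)).hasFDerivAt
  have h1 : partialE (partialS f) (ε, s) = fderiv ℝ (fderiv ℝ f) (ε, s) (1, 0) (0, 1) := by
    have := (hd.clm_apply (hasFDerivAt_const ((0, 1) : ℝ × ℝ) (ε, s))).fderiv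
    rw [partialE]
    change fderiv ℝ (fun p => fderiv ℝ f p (0, 1)) (ε, s) (1, 0) = _
    rw [this]
    simp
  have hsymm : IsSymmSndFDerivAt ℝ f (ε, s) := hat.isSymmSndFDerivAt (by simpa using (natCast_lt_infty 2).le)
  rw [h1, hsymm.eq]
  have h2 := hd.comp_hasDerivAt s ((hasDerivAt_const s ε).prodMk (hasDerivAt_id s))
  exact (h2.clm_apply (hasDerivAt_const s ((1, 0) : ℝ × ℝ))).congr_deriv (by simp)

theorem contDiffOn_partialS_iterate (hI : IsOpen I) (hf : ContDiffOn ℝ ∞ f (I ×ˢ Set.univ))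
    (j : ℕ) : ContDiffOn ℝ ∞ (partialS^[j] f) (I ×ˢ Set.univ) := by
  induction j with
  | zero => exact hf
  | succ j ih =>
    rw [Function.iterate_succ_apply']
    exact contDiffOn_partialS hI ih

theorem iteratedDeriv_eq_partialS (hI : IsOpen I) (hf : ContDiffOn ℝ ∞ f (I ×ˢ Set.univ))
    (hε : ε ∈ I) (j : ℕ) :
    iteratedDeriv j (fun t => f (ε, t)) = fun t => partialS^[j] f (ε, t) := by
  induction j with
  | zero => simp
  | succ j ih =>
    rw [iteratedDeriv_succ, ih, Function.iterate_succ_apply']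
    funext s
    exact (hasDerivAt_partialS hI (contDiffOn_partialS_iterate hI hf j) hε).deriv

/-- Mixed derivatives of a jointly smooth family commute. -/
theorem hasDerivAt_iteratedDeriv_param (hI : IsOpen I)
    (hf : ContDiffOn ℝ ∞ f (I ×ˢ Set.univ)) (hε : ε ∈ I) (j : ℕ) :
    HasDerivAt (fun e => iteratedDeriv j (fun t => f (e, t)) s)
      (deriv (fun e => iteratedDeriv j (fun t => f (e, t)) s) ε) ε ∧
    HasDerivAt (fun t => deriv (fun e => iteratedDeriv j (fun t => f (e, t)) t) ε)
      (deriv (fun e => iteratedDeriv (j + 1) (fun t => f (e, t)) s) ε) s := by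
  have key : ∀ (j : ℕ) (s : ℝ), HasDerivAt (fun e => iteratedDeriv j (fun t => f (e, t)) s)
      (partialE (partialS^[j] f) (ε, s)) ε := fun j s => by
    refine (hasDerivAt_partialE hI (contDiffOn_partialS_iterate hI hf j) hε).congr_of_eventuallyEq
      ?_
    filter_upwards [hI.mem_nhds hε] with e he
    rw [iteratedDeriv_eq_partialS hI hf he]
  refine ⟨(key j s).differentiableAt.hasDerivAt, ?_⟩
  rw [(key (j + 1) s).deriv, funext fun t => (key j t).deriv, Function.iterate_succ_apply']
  exact hasDerivAt_partialE_partialS hI (contDiffOn_partialS_iterate hI hf j) hε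

end Joint

namespace Window

variable {E : Type} [NormedAddCommGroup E] [NormedSpace ℝ E] {D : Window} {n : ℤ}
  {F G : ℝ → ℝ → E}

theorem TameSmooth.polyBdd_iteratedDeriv (h : D.TameSmooth n F G) (j : ℕ) :
    D.PolyBdd n (fun ε => iteratedDeriv j (F ε)) := by
  induction j generalizing F G with
  | zero => simpa using (h 0).tame₀.bdd
  | succ j ih =>
    simp_rw [iteratedDeriv_succ']
    exact ih h.deriv

/-- Without a condition on the parameter, being tame amounts to estimates for the derivatives. -/
theorem tameSmooth_of_iteratedDeriv (hJ : D.J = ∅) (hF : ∀ ε ∈ D.I, ContDiff ℝ ∞ (F ε))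
    (hb : ∀ j, D.PolyBdd n (fun ε => iteratedDeriv j (F ε))) :
    D.TameSmooth n F (fun _ _ => 0) := by
  have key : ∀ k j, D.Tame k n (fun ε => iteratedDeriv j (F ε)) (fun _ _ => 0) := by
    intro k
    induction k with
    | zero =>
      intro j
      refine ⟨hb j, ⟨0, 0, by simp⟩, fun ε hε => ?_, fun _ _ => continuous_const, by simp [hJ]⟩
      exact (hF ε hε).continuous_iteratedDeriv j (natCast_lt_infty j).le
    | succ k ih =>
      intro j
      refine ⟨(ih j).tame₀, fun ε => iteratedDeriv (j + 1) (F ε), fun _ _ => 0,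
        fun ε hε s => ⟨?_, hasDerivAt_const _ _⟩, ih (j + 1)⟩
      simp only [iteratedDeriv_succ]
      exact ((hF ε hε).differentiable_iteratedDeriv j (natCast_lt_infty j) s).hasDerivAt
  intro k
  simpa using key k 0

end Window

namespace RegularFamily

variable {c : ℝ → BAL γ₀} {r : ℝ}

/-- The window of a regular family: its weight is the curvature. -/
def window (h : RegularFamily c r) : Window where
  I := Set.Ioo (-r) r
  J := Set.Ioo (-r) r
  w ε s := curvature (c ε).1 s
  isOpen_J := isOpen_Ioo
  J_sub := subset_rfl
  pos ε _ s := (BAL.frenet (c ε)).curvature_pos s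
  rapid := h.rapid

/-- The window of a regular family, the dependence on the parameter being disregarded. -/
def staticWindow (h : RegularFamily c r) : Window where
  __ := h.window
  J := ∅
  isOpen_J := isOpen_empty
  J_sub := Set.empty_subset _

theorem zero_mem (h : RegularFamily c r) : (0 : ℝ) ∈ h.window.J := ⟨by linarith [h.pos], h.pos⟩

theorem static_curvature (h : RegularFamily c r) :
    h.staticWindow.TameSmooth 1 (fun ε => curvature (c ε).1) (fun _ _ => 0) := by
  refine Window.tameSmooth_of_iteratedDeriv rfl
    (fun ε _ => (BAL.frenet (c ε)).smooth_curvature) fun j => ?_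
  obtain ⟨C, N, hC⟩ := h.curv j
  exact ⟨C, N, fun ε hε s => by rw [zpow_one]; exact hC ε hε s⟩

theorem static_torsion (h : RegularFamily c r) :
    h.staticWindow.TameSmooth 0 (fun ε => torsion (c ε).1) (fun _ _ => 0) := by
  refine Window.tameSmooth_of_iteratedDeriv rfl
    (fun ε _ => (BAL.frenet (c ε)).smooth_torsion) fun j => ?_
  obtain ⟨C, N, hC⟩ := h.tors j
  exact ⟨C, N, fun ε hε s => by rw [zpow_zero, mul_one]; exact hC ε hε s⟩

/-- The derivatives of the frame in `s` are estimated by means of the Frenet equations. -/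
theorem static_frame (h : RegularFamily c r) :
    h.staticWindow.TameSmooth 0 (fun ε => tangent (c ε).1) (fun _ _ => 0) ∧
    h.staticWindow.TameSmooth 0 (fun ε => normal (c ε).1) (fun _ _ => 0) ∧
    h.staticWindow.TameSmooth 0 (fun ε => binormal (c ε).1) (fun _ _ => 0) := by
  have key0 : ∀ f : ℝ → ℝ → E3, (∀ ε s, ‖f ε s‖ = 1) → (∀ ε, Continuous (f ε)) →
      h.staticWindow.Tame₀ 0 f (fun _ _ => 0) := fun f hf hc =>
    ⟨⟨1, 0, by simp [hf]⟩, ⟨0, 0, by simp⟩, fun ε _ => hc ε, fun _ _ => continuous_const,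
      fun ε hε => (Set.notMem_empty ε hε).elim⟩
  have hT := key0 (fun ε => tangent (c ε).1) (fun ε => (BAL.frenet (c ε)).norm_tangent)
    fun ε => (BAL.frenet (c ε)).smooth_tangent.continuous
  have hN := key0 (fun ε => normal (c ε).1) (fun ε => (BAL.frenet (c ε)).norm_normal)
    fun ε => (BAL.frenet (c ε)).smooth_normal.continuous
  have hB := key0 (fun ε => binormal (c ε).1) (fun ε => (BAL.frenet (c ε)).norm_binormal)
    fun ε => (BAL.frenet (c ε)).smooth_binormal.continuous
  suffices hk : ∀ k, h.staticWindow.Tame k 0 (fun ε => tangent (c ε).1) (fun _ _ => 0) ∧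
      h.staticWindow.Tame k 0 (fun ε => normal (c ε).1) (fun _ _ => 0) ∧
      h.staticWindow.Tame k 0 (fun ε => binormal (c ε).1) (fun _ _ => 0) from
    ⟨fun k => (hk k).1, fun k => (hk k).2.1, fun k => (hk k).2.2⟩
  intro k
  induction k with
  | zero => exact ⟨hT, hN, hB⟩
  | succ k ih =>
    obtain ⟨iT, iN, iB⟩ := ih
    have hκ : h.staticWindow.Tame k 0 (fun ε => curvature (c ε).1) (fun _ _ => 0) := by
      simpa using (h.static_curvature k).lower
    have hτ := h.static_torsion k
    refine ⟨⟨hT, fun ε s => curvature (c ε).1 s • normal (c ε).1 s, fun _ _ => 0,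
        fun ε _ s => ⟨(BAL.frenet (c ε)).hasDerivAt_tangent s, hasDerivAt_const _ _⟩, ?_⟩,
      ⟨hN, fun ε s => -curvature (c ε).1 s • tangent (c ε).1 s +
          torsion (c ε).1 s • binormal (c ε).1 s, fun _ _ => 0,
        fun ε _ s => ⟨(BAL.frenet (c ε)).hasDerivAt_normal s, hasDerivAt_const _ _⟩, ?_⟩,
      ⟨hB, fun ε s => -torsion (c ε).1 s • normal (c ε).1 s, fun _ _ => 0,
        fun ε _ s => ⟨(BAL.frenet (c ε)).hasDerivAt_binormal s, hasDerivAt_const _ _⟩, ?_⟩⟩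
    · simpa using hκ.smul iN
    · simpa [neg_smul] using (((hκ.const_smul (-1)).smul iT).add (hτ.smul iB))
    · simpa [neg_smul] using ((hτ.const_smul (-1)).smul iN)

theorem hasDerivAt_curve_param (h : RegularFamily c r) {ε : ℝ} (hε : ε ∈ h.window.J) (s : ℝ) (j : ℕ) :
    HasDerivAt (fun e => iteratedDeriv j (c e).1 s)
      (deriv (fun e => iteratedDeriv j (c e).1 s) ε) ε ∧
    HasDerivAt (fun t => deriv (fun e => iteratedDeriv j (c e).1 t) ε)
      (deriv (fun e => iteratedDeriv (j + 1) (c e).1 s) ε) s :=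
  hasDerivAt_iteratedDeriv_param isOpen_Ioo h.smooth hε j

/-- The derivatives of the curve of order at least `2` are bounded by the curvature, as are the
derivatives of these with respect to the parameter. -/
theorem tame_iteratedDeriv (h : RegularFamily c r) (j : ℕ) : h.window.TameSmooth 1
    (fun ε => iteratedDeriv (j + 2) (c ε).1)
    (fun ε s => deriv (fun e => iteratedDeriv (j + 2) (c e).1 s) ε) := by
  intro k
  induction k generalizing j with
  | zero =>
    refine ⟨?_, ?_, fun ε _ => ?_, fun ε hε => ?_,
      fun ε hε s => (h.hasDerivAt_curve_param hε s (j + 2)).1⟩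
    · have h1 : h.staticWindow.TameSmooth 1 (fun ε => deriv (tangent (c ε).1))
          (fun _ _ => 0) := fun k => by
        have := (h.static_curvature k).smul (h.static_frame.2.1 k)
        rw [add_zero] at this
        refine this.congr (fun ε _ => ?_) fun ε _ => by simp
        funext s
        exact ((BAL.frenet (c ε)).hasDerivAt_tangent s).deriv.symm
      have h2 := h1.polyBdd_iteratedDeriv j
      simp_rw [iteratedDeriv_succ']
      exact h2
    · exact h.speed (j + 2) (by omega) |>.imp fun C => Exists.imp fun N hN ε hε s => by
        rw [zpow_one]; exact hN ε hε s
    · exact (BAL.frenet (c ε)).smooth.continuous_iteratedDeriv _ (natCast_lt_infty _).le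
    · exact continuous_iff_continuousAt.2 fun s =>
        (h.hasDerivAt_curve_param hε s (j + 2)).2.continuousAt
  | succ k ih =>
    refine ⟨(ih j).tame₀, _, _, fun ε hε s => ⟨?_, (h.hasDerivAt_curve_param hε s (j + 2)).2⟩,
      ih (j + 1)⟩
    have := ((BAL.frenet (c ε)).smooth.differentiable_iteratedDeriv (j + 2) (natCast_lt_infty (j + 2))
      s).hasDerivAt
    rwa [← iteratedDeriv_succ] at this

theorem polyBdd_tangent_param (h : RegularFamily c r) :
    h.window.PolyBdd 1 (fun ε s => deriv (fun e => tangent (c e).1 s) ε) := by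
  obtain ⟨C, N, hC⟩ := h.speed 1 le_rfl
  refine ⟨C, N, fun ε hε s => ?_⟩
  rw [zpow_one]
  simp only [iteratedDeriv_one] at hC
  exact hC ε hε s

/-- The tangent is of degree `0` although its derivative with respect to the parameter is bounded by
the curvature; see `polyBdd_tangent_param`. -/
theorem tame_tangent (h : RegularFamily c r) : h.window.TameSmooth 0 (fun ε => tangent (c ε).1)
    (fun ε s => deriv (fun e => tangent (c e).1 s) ε) := by
  have hd : ∀ ε ∈ h.window.J, ∀ s, HasDerivAt (fun e => tangent (c e).1 s)
      (deriv (fun e => tangent (c e).1 s) ε) ε ∧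
      HasDerivAt (fun t => deriv (fun e => tangent (c e).1 t) ε)
        (deriv (fun e => iteratedDeriv 2 (c e).1 s) ε) s := fun ε hε s => by
    have := h.hasDerivAt_curve_param hε s 1
    simp only [iteratedDeriv_one] at this
    exact this
  have h0 : h.window.Tame₀ 0 (fun ε => tangent (c ε).1)
      (fun ε s => deriv (fun e => tangent (c e).1 s) ε) := by
    refine ⟨⟨1, 0, fun ε _ s => by simp [(BAL.frenet (c ε)).norm_tangent]⟩, ?_,
      fun ε _ => (BAL.frenet (c ε)).smooth_tangent.continuous,
      fun ε hε => continuous_iff_continuousAt.2 fun s => (hd ε hε s).2.continuousAt,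
      fun ε hε s => (hd ε hε s).1⟩
    simpa using h.polyBdd_tangent_param.lower
  intro k
  cases k with
  | zero => exact h0
  | succ k =>
    refine ⟨h0, _, _, fun ε hε s => ⟨?_, (hd ε hε s).2⟩,
      by simpa using (h.tame_iteratedDeriv 0 k).lower⟩
    have := ((BAL.frenet (c ε)).smooth_tangent.differentiable (by simp) s).hasDerivAt
    rw [iteratedDeriv_succ, iteratedDeriv_one]
    exact this

theorem tame_deriv_tangent (h : RegularFamily c r) : ∃ G, h.window.TameSmooth 1 (fun ε => deriv (tangent (c ε).1)) G :=
  ⟨_, (h.tame_iteratedDeriv 0).congr (fun ε _ => by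
    rw [iteratedDeriv_succ, iteratedDeriv_one]; rfl) fun _ _ => rfl⟩

theorem tame_kappaInv (h : RegularFamily c r) : ∃ G, h.window.TameSmooth (-1) (fun ε s => (curvature (c ε).1 s)⁻¹) G := by
  obtain ⟨G, hG⟩ := h.tame_deriv_tangent
  refine ⟨_, fun k => Window.Tame.inv_sqrt ((hG k).inner (hG k))
    (fun ε _ s => inv_pos.2 ((BAL.frenet (c ε)).curvature_pos s)) (fun ε _ s => ?_) ?_⟩
  · rw [real_inner_self_eq_norm_sq, ← mul_pow, ← curvature,
      inv_mul_cancel₀ ((BAL.frenet (c ε)).curv s), one_pow]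
  · refine ⟨1, 0, fun ε _ s => ?_⟩
    rw [zpow_neg_one, norm_inv, Real.norm_of_nonneg ((BAL.frenet (c ε)).curvature_pos s).le]
    simp [window]

theorem tame_kappa (h : RegularFamily c r) : ∃ G, h.window.TameSmooth 1 (fun ε s => curvature (c ε).1 s) G := by
  obtain ⟨G, hG⟩ := h.tame_deriv_tangent
  obtain ⟨G', hG'⟩ := h.tame_kappaInv
  refine ⟨_, fun k => (((hG k).inner (hG k)).mul (hG' k)).congr (fun ε _ => ?_) fun _ _ => rfl⟩
  funext s
  rw [real_inner_self_eq_norm_sq, ← curvature, sq, mul_assoc,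
    mul_inv_cancel₀ ((BAL.frenet (c ε)).curv s), mul_one]

theorem tame_normal (h : RegularFamily c r) : ∃ G, h.window.TameSmooth 0 (fun ε => normal (c ε).1) G := by
  obtain ⟨G, hG⟩ := h.tame_deriv_tangent
  obtain ⟨G', hG'⟩ := h.tame_kappaInv
  exact ⟨_, fun k => (hG' k).smul (hG k)⟩

theorem tame_binormal (h : RegularFamily c r) : ∃ G, h.window.TameSmooth 0 (fun ε => binormal (c ε).1) G := by
  obtain ⟨G, hG⟩ := h.tame_normal
  exact ⟨_, fun k => (h.tame_tangent k).cross (hG k)⟩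

theorem tame_torsion (h : RegularFamily c r) : ∃ G, h.window.TameSmooth 0 (fun ε => torsion (c ε).1) G := by
  obtain ⟨G, hG⟩ := h.tame_normal
  obtain ⟨G', hG'⟩ := h.tame_binormal
  exact ⟨_, fun k => (hG.deriv k).inner (hG' k)⟩

end RegularFamily

/-! ### Constant families -/

theorem exists_bound_of_tendsto_cocompact {f : ℝ → ℝ} {a : ℝ} (hc : Continuous f)
    (hf : Tendsto f (cocompact ℝ) (𝓝 a)) : ∃ C, ∀ s, |f s| ≤ C := by
  have h1 : ∀ᶠ s in cocompact ℝ, |f s| ≤ |a| + 1 :=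
    (hf.abs.eventually_lt_const (by linarith : |a| < |a| + 1)).mono fun s hs => hs.le
  obtain ⟨K, hK, hKs⟩ := mem_cocompact.1 h1
  obtain ⟨C, hC⟩ := hK.exists_bound_of_continuousOn hc.continuousOn
  refine ⟨max (|a| + 1) C, fun s => ?_⟩
  by_cases hs : s ∈ K
  · exact (hC s hs).trans (le_max_right _ _)
  · exact (hKs hs : |f s| ≤ |a| + 1).trans (le_max_left _ _)

theorem abs_eval_le (P : ℝ[X]) : ∃ C, 0 ≤ C ∧ ∀ s, |P.eval s| ≤ C * (1 + |s|) ^ P.natDegree := by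
  refine ⟨∑ i ∈ Finset.range (P.natDegree + 1), |P.coeff i|,
    Finset.sum_nonneg fun _ _ => abs_nonneg _, fun s => ?_⟩
  rw [Polynomial.eval_eq_sum_range, Finset.sum_mul]
  refine (Finset.abs_sum_le_sum_abs _ _).trans (Finset.sum_le_sum fun i hi => ?_)
  rw [abs_mul, abs_pow]
  gcongr
  calc |s| ^ i ≤ (1 + |s|) ^ i := by gcongr; linarith
    _ ≤ (1 + |s|) ^ P.natDegree :=
      pow_le_pow_right₀ (by linarith [abs_nonneg s]) (by simpa [Nat.lt_succ_iff] using hi)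

theorem AsympPolynomialLike.exists_bound {f : ℝ → ℝ} (hf : AsympPolynomialLike f)
    (hc : Continuous f) : ∃ (C : ℝ) (N : ℕ), ∀ s, |f s| ≤ C * (1 + |s|) ^ N := by
  obtain ⟨P, hP, h⟩ := hf
  obtain ⟨C, hC0, hC⟩ := abs_eval_le P
  have h1 : ∀ᶠ s in cocompact ℝ, |f s / P.eval s| < 1 := by
    simpa using h.abs.eventually_lt_const (by simp : |(0 : ℝ)| < 1)
  have h2 : ∀ᶠ s in cocompact ℝ, P.eval s ≠ 0 := by
    have hfin : {s | P.IsRoot s}.Finite := Polynomial.finite_setOfPred_isRoot hP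
    exact hfin.isCompact.compl_mem_cocompact
  obtain ⟨K, hK, hKs⟩ := mem_cocompact.1 (h1.and h2)
  obtain ⟨C', hC'⟩ := hK.exists_bound_of_continuousOn hc.continuousOn
  refine ⟨max C C', P.natDegree, fun s => ?_⟩
  have hs1 : 1 ≤ (1 + |s|) ^ P.natDegree := one_le_pow₀ (by linarith [abs_nonneg s])
  by_cases hs : s ∈ K
  · have h3 := hC' s hs
    rw [Real.norm_eq_abs] at h3
    have h4 : |f s| ≤ max C C' := h3.trans (le_max_right _ _)
    nlinarith [abs_nonneg (f s)]
  · obtain ⟨h3, h4⟩ := hKs hs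
    rw [abs_div, div_lt_one (abs_pos.2 h4)] at h3
    refine (h3.le.trans (hC s)).trans ?_
    gcongr
    exact le_max_left _ _

theorem RapidlyDecreasing.exists_bound {f : ℝ → ℝ} (hf : RapidlyDecreasing f) (hc : Continuous f)
    (k : ℕ) : ∃ C : ℝ, ∀ s, |f s| * (1 + |s|) ^ k ≤ C := by
  obtain ⟨C, hC⟩ := exists_bound_of_tendsto_cocompact (f := fun s =>
    f s * ((Polynomial.C 2 * (1 + Polynomial.X ^ 2)) ^ k : ℝ[X]).eval s)
    (hc.mul (Polynomial.continuous _)) (hf _)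
  refine ⟨C, fun s => le_trans ?_ (hC s)⟩
  rw [abs_mul]
  gcongr
  rw [Polynomial.eval_pow, abs_pow]
  gcongr
  simp only [Polynomial.eval_mul, Polynomial.eval_C, Polynomial.eval_add, Polynomial.eval_one,
    Polynomial.eval_pow, Polynomial.eval_X]
  rw [abs_of_pos (by positivity : (0 : ℝ) < 2 * (1 + s ^ 2))]
  nlinarith [sq_nonneg (|s| - 1), sq_abs s]

theorem RegularFamily.const (γ : BAL γ₀) : RegularFamily (fun _ => γ) 1 where
  pos := one_pos
  smooth := ((BAL.frenet γ).smooth.comp contDiff_snd).contDiffOn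
  rapid k := by
    obtain ⟨C, hC⟩ := RapidlyDecreasing.exists_bound γ.2.2.2.2.1
      (BAL.frenet γ).smooth_curvature.continuous k
    refine ⟨C, fun _ _ s => ?_⟩
    simpa [abs_of_pos ((BAL.frenet γ).curvature_pos s)] using hC s
  curv k := by
    obtain ⟨C, N, hC⟩ := (γ.2.2.2.2.2.1 k).exists_bound
      (((BAL.frenet γ).smooth_curvature.continuous.inv₀ γ.2.2.1).mul
        ((BAL.frenet γ).smooth_curvature.continuous_iteratedDeriv k (natCast_lt_infty k).le))
    refine ⟨C, N, fun _ _ s => ?_⟩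
    have h1 := hC s
    have hp := (BAL.frenet γ).curvature_pos s
    rw [abs_mul, abs_inv, abs_of_pos hp, inv_mul_le_iff₀ hp] at h1
    linarith
  tors k := by
    obtain ⟨C, N, hC⟩ := (γ.2.2.2.2.2.2 k).exists_bound
      ((BAL.frenet γ).smooth_torsion.continuous_iteratedDeriv k (natCast_lt_infty k).le)
    exact ⟨C, N, fun _ _ s => hC s⟩
  speed k _ := ⟨0, 0, fun _ _ s => by simp⟩

/-! ### The algebra of expressions -/

theorem AlgVar.le {W : Type} {vars : Set (W → ScalarField γ₀)} {m n : ℤ} {f : W → ScalarField γ₀}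
    (hf : AlgVar vars n f) (h : m ≤ n) : AlgVar vars m f := by
  obtain ⟨k, rfl⟩ := Int.le.dest h
  clear h
  induction k generalizing m with
  | zero => simpa using hf
  | succ k ih =>
    have : AlgVar vars (m + 1) f := ih (by convert hf using 1; push_cast; ring)
    simpa using this.lower

theorem AlgVar.zero {W : Type} {vars : Set (W → ScalarField γ₀)} (n : ℤ) :
    AlgVar vars n (fun _ => 0) := by
  have h : ∀ k : ℕ, ∃ f, AlgVar vars (k : ℤ) f := by
    intro k
    induction k with
    | zero => exact ⟨_, AlgVar.one⟩
    | succ k ih =>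
      obtain ⟨f, hf⟩ := ih
      exact ⟨_, by simpa using hf.mul AlgVar.kappa⟩
  obtain ⟨f, hf⟩ := h n.toNat
  have := (hf.le (Int.self_le_toNat n)).smul 0
  simpa using this

/-- Substituting elements of `𝒜₁` for the variables of an expression. -/
theorem AlgVar.subst {W : Type} {vars : Set (W → ScalarField γ₀)} {w₀ : W}
    (hv : ∀ v ∈ vars, v w₀ ∈ algSpace γ₀ 1) {n : ℤ} {f : W → ScalarField γ₀}
    (hf : AlgVar vars n f) : f w₀ ∈ algSpace γ₀ n := by
  induction hf with
  | var hf => exact hv _ hf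
  | kappa => exact AlgVar.kappa
  | kappaInv => exact AlgVar.kappaInv
  | tau => exact AlgVar.tau
  | param => exact AlgVar.param
  | renLength => exact AlgVar.renLength
  | one => exact AlgVar.one
  | add _ _ h₁ h₂ => exact AlgVar.add h₁ h₂
  | smul c _ h => exact AlgVar.smul c h
  | lower _ h => exact AlgVar.lower h
  | mul _ _ h₁ h₂ => exact AlgVar.mul h₁ h₂
  | ds _ h => exact AlgVar.ds h
  | dsInv _ h => exact AlgVar.dsInv h
  | integ _ h => exact AlgVar.integ h

/-- Elements of `𝒜ₙ` are expressions of degree `n` in which no variable occurs. -/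
theorem AlgVar.of_mem {W : Type} {vars : Set (W → ScalarField γ₀)} {n : ℤ} {a : ScalarField γ₀}
    (ha : a ∈ algSpace γ₀ n) : AlgVar vars n (fun _ : W => a) := by
  have key : ∀ {n : ℤ} {f : Unit → ScalarField γ₀}, AlgVar ∅ n f →
      AlgVar vars n (fun _ : W => f ()) := by
    intro n f hf
    induction hf with
    | var hf => exact hf.elim
    | kappa => exact AlgVar.kappa
    | kappaInv => exact AlgVar.kappaInv
    | tau => exact AlgVar.tau
    | param => exact AlgVar.param
    | renLength => exact AlgVar.renLength
    | one => exact AlgVar.one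
    | add _ _ h₁ h₂ => exact AlgVar.add h₁ h₂
    | smul c _ h => exact AlgVar.smul c h
    | lower _ h => exact AlgVar.lower h
    | mul _ _ h₁ h₂ => exact AlgVar.mul h₁ h₂
    | ds _ h => exact AlgVar.ds h
    | dsInv _ h => exact AlgVar.dsInv h
    | integ _ h => exact AlgVar.integ h
  exact key ha

namespace Alg

variable {m n i j : ℤ} {f g : ScalarField γ₀}

theorem kappa : kappa ∈ algSpace γ₀ 1 := AlgVar.kappa
theorem kappaInv : kappaInv ∈ algSpace γ₀ (-1) := AlgVar.kappaInv
theorem tau : tau ∈ algSpace γ₀ 0 := AlgVar.tau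
theorem one : (1 : ScalarField γ₀) ∈ algSpace γ₀ 0 := AlgVar.one
theorem zero (n : ℤ) : (0 : ScalarField γ₀) ∈ algSpace γ₀ n := AlgVar.zero n

theorem add (hf : f ∈ algSpace γ₀ n) (hg : g ∈ algSpace γ₀ n) : f + g ∈ algSpace γ₀ n :=
  AlgVar.add hf hg

theorem smul (c : ℝ) (hf : f ∈ algSpace γ₀ n) : c • f ∈ algSpace γ₀ n := AlgVar.smul c hf

theorem neg (hf : f ∈ algSpace γ₀ n) : -f ∈ algSpace γ₀ n := by
  simpa using smul (-1) hf

theorem sub (hf : f ∈ algSpace γ₀ n) (hg : g ∈ algSpace γ₀ n) : f - g ∈ algSpace γ₀ n := by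
  rw [sub_eq_add_neg]
  exact add hf (neg hg)

theorem le (hf : f ∈ algSpace γ₀ n) (h : m ≤ n) : f ∈ algSpace γ₀ m := AlgVar.le hf h

theorem mul' (hf : f ∈ algSpace γ₀ i) (hg : g ∈ algSpace γ₀ j) : f * g ∈ algSpace γ₀ (i + j) :=
  AlgVar.mul hf hg

theorem mul (hf : f ∈ algSpace γ₀ i) (hg : g ∈ algSpace γ₀ j) (h : n ≤ i + j) :
    f * g ∈ algSpace γ₀ n := le (mul' hf hg) h

theorem ds (hf : f ∈ algSpace γ₀ n) : ds f ∈ algSpace γ₀ n := AlgVar.ds hf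

theorem dsInv (hf : f ∈ algSpace γ₀ 2) : dsInv f ∈ algSpace γ₀ 0 := AlgVar.dsInv hf

theorem integ (hf : f ∈ algSpace γ₀ 2) : integ f ∈ algSpace γ₀ 0 := AlgVar.integ hf

end Alg

/-- Functionals belong to `𝒜₀` and do not depend on `s`. -/
theorem functionals_le {F : ScalarField γ₀} (hF : F ∈ functionals γ₀) :
    F ∈ algSpace γ₀ 0 ∧ ∀ γ s t, F γ s = F γ t := by
  induction hF using Algebra.adjoin_induction with
  | mem x hx =>
    rcases hx with hx | ⟨f, hf, rfl⟩
    · rw [Set.mem_singleton_iff.1 hx]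
      exact ⟨AlgVar.renLength, fun _ _ _ => rfl⟩
    · exact ⟨Alg.integ hf, fun _ _ _ => rfl⟩
  | algebraMap r =>
    refine ⟨?_, fun _ _ _ => rfl⟩
    have := Alg.smul r (Alg.one (γ₀ := γ₀))
    rwa [Algebra.algebraMap_eq_smul_one]
  | add f g _ _ hf hg =>
    exact ⟨Alg.add hf.1 hg.1, fun γ s t => by
      simp only [Pi.add_apply]; rw [hf.2 γ s t, hg.2 γ s t]⟩
  | mul f g _ _ hf hg =>
    exact ⟨Alg.mul hf.1 hg.1 (by norm_num), fun γ s t => by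
      simp only [Pi.mul_apply]; rw [hf.2 γ s t, hg.2 γ s t]⟩

/-! ### Linear expressions -/

/-- `LinExpr n L`: the operator `L` on pairs `(g, h)` is given by an expression of degree `n` that
is linear in the variables `g, h` of degree `1`. -/
inductive LinExpr : ℤ → (NB γ₀ → ScalarField γ₀) → Prop
  | fst : LinExpr 1 Prod.fst
  | snd : LinExpr 1 Prod.snd
  | add {n : ℤ} {L M : NB γ₀ → ScalarField γ₀} (hL : LinExpr n L) (hM : LinExpr n M) :
      LinExpr n (fun X => L X + M X)
  | mul {i j : ℤ} {a : ScalarField γ₀} {L : NB γ₀ → ScalarField γ₀} (ha : a ∈ algSpace γ₀ i)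
      (hL : LinExpr j L) : LinExpr (i + j) (fun X => a * L X)
  | ds {n : ℤ} {L : NB γ₀ → ScalarField γ₀} (hL : LinExpr n L) : LinExpr n (fun X => ds (L X))
  | dsInv {L : NB γ₀ → ScalarField γ₀} (hL : LinExpr 2 L) : LinExpr 0 (fun X => dsInv (L X))
  | integ {L : NB γ₀ → ScalarField γ₀} (hL : LinExpr 2 L) : LinExpr 0 (fun X => integ (L X))

namespace LinExpr

variable {i j m n : ℤ} {L M : NB γ₀ → ScalarField γ₀}

theorem mul_le {a : ScalarField γ₀} (ha : a ∈ algSpace γ₀ i) (hL : LinExpr j L) (h : n ≤ i + j) :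
    LinExpr n (fun X => a * L X) := by
  have := LinExpr.mul (Alg.le ha (by omega : n - j ≤ i)) hL
  simpa using this

theorem le (hL : LinExpr n L) (h : m ≤ n) : LinExpr m L := by
  simpa using mul_le Alg.one hL (by omega : m ≤ 0 + n)

theorem smul (c : ℝ) (hL : LinExpr n L) : LinExpr n (fun X => c • L X) := by
  simpa using mul_le (Alg.smul c Alg.one) hL (by omega : n ≤ 0 + n)

theorem neg (hL : LinExpr n L) : LinExpr n (fun X => -L X) := by
  simpa using smul (-1) hL

theorem sub (hL : LinExpr n L) (hM : LinExpr n M) : LinExpr n (fun X => L X - M X) := by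
  simpa [sub_eq_add_neg] using hL.add hM.neg

theorem zero (n : ℤ) : LinExpr n (fun _ : NB γ₀ => 0) := by
  simpa using mul_le (Alg.zero (n - 1)) LinExpr.fst (by omega : n ≤ n - 1 + 1)

theorem mem_algSpace (hL : LinExpr n L) {X : NB γ₀} (hX : X ∈ vectorFields γ₀) :
    L X ∈ algSpace γ₀ n := by
  induction hL with
  | fst => exact hX.1
  | snd => exact hX.2
  | add _ _ h₁ h₂ => exact Alg.add h₁ h₂
  | mul ha _ h => exact Alg.mul' ha h
  | ds _ h => exact Alg.ds h
  | dsInv _ h => exact Alg.dsInv h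
  | integ _ h => exact Alg.integ h

end LinExpr

/-! ### Deformations of expressions -/

section Deform

variable {W : Type}

/-- Let `Rel X c r y` be a class of families `c` of curves and `y` of values of the variables,
each with a direction `X`. The expression `f` is deformable along this class if it is tame along
each of these families, its derivative at `ε = 0` being a linear expression in the direction. -/
def Deformable (Rel : NB γ₀ → (ℝ → BAL γ₀) → ℝ → (ℝ → W) → Prop) (n : ℤ)
    (f : W → ScalarField γ₀) : Prop :=
  ∃ L : NB γ₀ → ScalarField γ₀, LinExpr n L ∧ ∀ X c r y, Rel X c r y → ∀ h : RegularFamily c r,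
    ∃ G, h.window.TameSmooth n (fun ε => f (y ε) (c ε)) G ∧ G 0 = L X (c 0)

variable {Rel : NB γ₀ → (ℝ → BAL γ₀) → ℝ → (ℝ → W) → Prop}

/-- All expressions are deformable as soon as the symbols and the variables are. -/
theorem AlgVar.deformable {vars : Set (W → ScalarField γ₀)} {w₀ : W}
    (hv : ∀ v ∈ vars, v w₀ ∈ algSpace γ₀ 1) (hw : ∀ X c r y, Rel X c r y → y 0 = w₀)
    (hvars : ∀ v ∈ vars, Deformable Rel 1 v)
    (hkappa : Deformable Rel 1 (fun _ => VortexFilament.kappa))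
    (hkappaInv : Deformable Rel (-1) (fun _ => VortexFilament.kappaInv))
    (htau : Deformable Rel 0 (fun _ => VortexFilament.tau))
    (hlen : Deformable Rel 0 (fun _ => VortexFilament.renLength))
    {n : ℤ} {f : W → ScalarField γ₀} (hf : AlgVar vars n f) : Deformable Rel n f := by
  induction hf with
  | var hf => exact hvars _ hf
  | kappa => exact hkappa
  | kappaInv => exact hkappaInv
  | tau => exact htau
  | param =>
    exact ⟨_, LinExpr.zero 0, fun X c r y _ h => ⟨_, Window.Tame.param h.window, rfl⟩⟩
  | renLength => exact hlen
  | one =>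
    exact ⟨_, LinExpr.zero 0, fun X c r y _ h => ⟨_, fun k => Window.Tame.const h.window k 1, rfl⟩⟩
  | add _ _ h₁ h₂ =>
    obtain ⟨L, hL, h₁⟩ := h₁
    obtain ⟨M, hM, h₂⟩ := h₂
    refine ⟨_, hL.add hM, fun X c r y hR h => ?_⟩
    obtain ⟨G, hG, e⟩ := h₁ X c r y hR h
    obtain ⟨G', hG', e'⟩ := h₂ X c r y hR h
    exact ⟨_, fun k => (hG k).add (hG' k), by rw [e, e']; rfl⟩
  | smul a _ h₁ =>
    obtain ⟨L, hL, h₁⟩ := h₁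
    refine ⟨_, hL.smul a, fun X c r y hR h => ?_⟩
    obtain ⟨G, hG, e⟩ := h₁ X c r y hR h
    exact ⟨_, fun k => (hG k).const_smul a, by rw [e]; rfl⟩
  | lower _ h₁ =>
    obtain ⟨L, hL, h₁⟩ := h₁
    refine ⟨_, hL.le (by omega), fun X c r y hR h => ?_⟩
    obtain ⟨G, hG, e⟩ := h₁ X c r y hR h
    exact ⟨_, fun k => (hG k).lower, e⟩
  | mul hf hg h₁ h₂ =>
    obtain ⟨L, hL, h₁⟩ := h₁
    obtain ⟨M, hM, h₂⟩ := h₂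
    refine ⟨_, (LinExpr.mul_le (hg.subst hv) hL (by omega)).add (LinExpr.mul (hf.subst hv) hM),
      fun X c r y hR h => ?_⟩
    obtain ⟨G, hG, e⟩ := h₁ X c r y hR h
    obtain ⟨G', hG', e'⟩ := h₂ X c r y hR h
    refine ⟨_, fun k => (hG k).mul (hG' k), ?_⟩
    rw [e, e', hw X c r y hR]
    funext s
    simp only [Pi.add_apply, Pi.mul_apply]
    ring
  | ds _ h₁ =>
    obtain ⟨L, hL, h₁⟩ := h₁
    refine ⟨_, hL.ds, fun X c r y hR h => ?_⟩
    obtain ⟨G, hG, e⟩ := h₁ X c r y hR h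
    exact ⟨_, hG.deriv, by rw [e]; rfl⟩
  | dsInv _ h₁ =>
    obtain ⟨L, hL, h₁⟩ := h₁
    refine ⟨_, hL.dsInv, fun X c r y hR h => ?_⟩
    obtain ⟨G, hG, e⟩ := h₁ X c r y hR h
    exact ⟨_, fun k => Window.Tame.halfInt (by simpa using (hG k).lower), by rw [e]; rfl⟩
  | integ _ h₁ =>
    obtain ⟨L, hL, h₁⟩ := h₁
    refine ⟨_, hL.integ, fun X c r y hR h => ?_⟩
    obtain ⟨G, hG, e⟩ := h₁ X c r y hR h
    exact ⟨_, fun k => Window.Tame.integ (by simpa using (hG 0).lower.tame₀), by rw [e]; rfl⟩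

end Deform

/-! ### Regularity of scalar fields -/

/-- The window of a single curve. -/
def curveWindow (γ : BAL γ₀) : Window := (RegularFamily.const γ).window

theorem zero_mem_curveWindow (γ : BAL γ₀) : (0 : ℝ) ∈ (curveWindow γ).I :=
  (RegularFamily.const γ).zero_mem

theorem Window.TameSmooth.const_congr {γ : BAL γ₀} {n : ℤ} {f : ℝ → ℝ} {G : ℝ → ℝ → ℝ}
    (h : (curveWindow γ).TameSmooth n (fun _ => f) G) :
    (curveWindow γ).TameSmooth n (fun _ => f) (fun _ _ => 0) :=
  h.congr (fun _ _ => rfl) fun ε hε => funext fun s =>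
    ((h 0).tame₀.hasDerivAt ε hε s).unique (hasDerivAt_const ε (f s))

/-- The relation for constant families of curves, with `y t` depending on the direction. -/
def constRel (y : NB γ₀ → ℝ → W) (S : Set (NB γ₀)) :
    NB γ₀ → (ℝ → BAL γ₀) → ℝ → (ℝ → W) → Prop :=
  fun X c r y' => X ∈ S ∧ (∃ γ, c = fun _ => γ) ∧ r = 1 ∧ y' = y X

theorem deformable_const {W : Type} (y : NB γ₀ → ℝ → W) (S : Set (NB γ₀)) {n : ℤ}
    {f : ScalarField γ₀}
    (h : ∀ γ, ∃ G, (curveWindow γ).TameSmooth n (fun _ => f γ) G) :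
    Deformable (constRel y S) n (fun _ => f) := by
  refine ⟨_, LinExpr.zero n, ?_⟩
  rintro X c r y' ⟨-, ⟨γ, rfl⟩, rfl, -⟩ h'
  obtain ⟨G, hG⟩ := h γ
  exact ⟨_, hG.const_congr, rfl⟩

theorem AlgVar.deformable_const {W : Type} {vars : Set (W → ScalarField γ₀)} {w₀ : W}
    (hv : ∀ v ∈ vars, v w₀ ∈ algSpace γ₀ 1) (y : NB γ₀ → ℝ → W) (S : Set (NB γ₀))
    (hy : ∀ X ∈ S, y X 0 = w₀) (hvars : ∀ v ∈ vars, Deformable (constRel y S) 1 v)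
    {n : ℤ} {f : W → ScalarField γ₀} (hf : AlgVar vars n f) :
    Deformable (constRel y S) n f := by
  refine AlgVar.deformable hv ?_ hvars
    (VortexFilament.deformable_const y S fun γ => (RegularFamily.const γ).tame_kappa)
    (VortexFilament.deformable_const y S fun γ => (RegularFamily.const γ).tame_kappaInv)
    (VortexFilament.deformable_const y S fun γ => (RegularFamily.const γ).tame_torsion)
    (VortexFilament.deformable_const y S fun γ => ⟨_, fun k => Window.Tame.const _ k _⟩) hf
  rintro X c r y' ⟨hX, -, -, rfl⟩
  exact hy X hX

/-- Elements of `𝒜ₙ` are smooth along each curve and, together with all their derivatives, bounded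
by the `n`-th power of the curvature up to a polynomial factor. -/
theorem tameSmooth_of_mem {n : ℤ} {f : ScalarField γ₀} (hf : f ∈ algSpace γ₀ n) (γ : BAL γ₀) :
    (curveWindow γ).TameSmooth n (fun _ => f γ) (fun _ _ => 0) := by
  obtain ⟨L, -, h⟩ := AlgVar.deformable_const (w₀ := ()) (by simp) (fun _ _ => ())
    (Set.univ : Set (NB γ₀)) (by simp) (by simp) hf
  obtain ⟨G, hG, -⟩ := h 0 (fun _ => γ) 1 _ ⟨trivial, ⟨γ, rfl⟩, rfl, rfl⟩ (RegularFamily.const γ)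
  exact hG.const_congr

namespace Alg

variable {m n i j : ℤ} {f g : ScalarField γ₀}

theorem contDiff (hf : f ∈ algSpace γ₀ n) (γ : BAL γ₀) : ContDiff ℝ ∞ (f γ) :=
  (tameSmooth_of_mem hf γ).contDiff (zero_mem_curveWindow γ)

theorem hasDerivAt (hf : f ∈ algSpace γ₀ n) (γ : BAL γ₀) (s : ℝ) :
    HasDerivAt (f γ) (VortexFilament.ds f γ s) s :=
  ((contDiff hf γ).differentiable (by simp) s).hasDerivAt

theorem integrable (hf : f ∈ algSpace γ₀ n) (hn : 1 ≤ n) (γ : BAL γ₀) : Integrable (f γ) :=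
  ((tameSmooth_of_mem (le hf hn) γ 0).tame₀.integrable (zero_mem_curveWindow γ)).1

theorem tendsto (hf : f ∈ algSpace γ₀ n) (hn : 1 ≤ n) (γ : BAL γ₀) :
    Tendsto (f γ) (cocompact ℝ) (𝓝 0) :=
  (tameSmooth_of_mem (le hf hn) γ 0).tame₀.bdd.tendsto_zero (zero_mem_curveWindow γ)

theorem hasDerivAt_dsInv (hf : f ∈ algSpace γ₀ n) (hn : 1 ≤ n) (γ : BAL γ₀) (s : ℝ) :
    HasDerivAt (VortexFilament.dsInv f γ) (f γ s) s :=
  hasDerivAt_halfInt (integrable hf hn γ) (contDiff hf γ).continuous s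

end Alg

/-! ### The asymptotic direction and the renormalized length -/

/-- `V` approaches opposite multiples of `v` at the two ends. -/
def OddLimits (v : E3) (V : ℝ → E3) : Prop :=
  ∃ α : ℝ, Tendsto V atTop (𝓝 (α • v)) ∧ Tendsto V atBot (𝓝 (-(α • v)))

/-- As the curvature decays, the tangent of a curve has the same limit as the unit step
`γ (s + 1) - γ s`. -/
theorem tendsto_tangent {γ : ℝ → E3} (h : FrenetCurve γ) (hr : RapidlyDecreasing (curvature γ))
    {l : Filter ℝ} (hl : l ≤ cocompact ℝ) {v : E3}
    (hv : Tendsto (fun s => γ (s + 1) - γ s) l (𝓝 v)) : Tendsto (tangent γ) l (𝓝 v) := by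
  obtain ⟨C, hC⟩ := hr.exists_bound h.smooth_curvature.continuous 1
  have key : ∀ s : ℝ, 0 < |s| → ‖γ (s + 1) - γ s - tangent γ s‖ ≤ C * |s|⁻¹ := by
    intro s hs
    have h1 : ∀ t ∈ Set.Icc s (s + 1), curvature γ t ≤ C * |s|⁻¹ := by
      intro t ht
      have h2 := hC t
      rw [abs_of_pos (h.curvature_pos t), pow_one] at h2
      rw [← div_eq_mul_inv, le_div_iff₀ hs]
      refine le_trans ?_ h2
      have h3 : |s| ≤ 1 + |t| := by
        have h4 := abs_sub_abs_le_abs_sub s t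
        have h5 : |s - t| ≤ 1 := by rw [abs_le]; constructor <;> linarith [ht.1, ht.2]
        linarith
      exact mul_le_mul_of_nonneg_left h3 (h.curvature_pos t).le
    have h0 : 0 ≤ C * |s|⁻¹ := (h.curvature_pos s).le.trans (h1 s ⟨le_rfl, by linarith⟩)
    have hT : ∀ t ∈ Set.Icc s (s + 1), ‖tangent γ t - tangent γ s‖ ≤ C * |s|⁻¹ := by
      intro t ht
      have := Convex.norm_image_sub_le_of_norm_hasDerivWithin_le (f := tangent γ)
        (C := C * |s|⁻¹) (s := Set.Icc s (s + 1)) (x := s) (y := t)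
        (fun x _ => (h.hasDerivAt_tangent x).hasDerivWithinAt)
        (fun x hx => by
          rw [norm_smul, h.norm_normal, mul_one, Real.norm_of_nonneg (h.curvature_pos x).le]
          exact h1 x hx) (convex_Icc _ _) ⟨le_rfl, by linarith⟩ ht
      refine this.trans (mul_le_of_le_one_right h0 ?_)
      rw [Real.norm_eq_abs, abs_le]
      constructor <;> linarith [ht.1, ht.2]
    have := Convex.norm_image_sub_le_of_norm_hasDerivWithin_le
      (f := fun t => γ t - (t - s) • tangent γ s) (C := C * |s|⁻¹) (s := Set.Icc s (s + 1))
      (x := s) (y := s + 1) (f' := fun t => tangent γ t - tangent γ s)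
      (fun x _ => by
        have h1 := ((hasDerivAt_id x).sub_const s).smul_const (tangent γ s)
        exact ((h.hasDerivAt_curve x).sub (by simpa using h1)).hasDerivWithinAt)
      hT (convex_Icc _ _) ⟨le_rfl, by linarith⟩ ⟨by linarith, le_rfl⟩
    simp only [add_sub_cancel_left, one_smul, sub_self, zero_smul, sub_zero, norm_one,
      mul_one] at this
    rwa [sub_right_comm]
  have h1 : Tendsto (fun s : ℝ => C * |s|⁻¹) (cocompact ℝ) (𝓝 (C * 0)) :=
    (tendsto_inv_atTop_zero.comp tendsto_norm_cocompact_atTop).const_mul C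
  rw [mul_zero] at h1
  have h2 : Tendsto (fun s => γ (s + 1) - γ s - tangent γ s) (cocompact ℝ) (𝓝 0) := by
    refine squeeze_zero_norm' ?_ h1
    filter_upwards [tendsto_norm_cocompact_atTop.eventually_gt_atTop (0 : ℝ)] with s hs
    exact key s hs
  have := hv.sub (h2.mono_left hl)
  simpa using this

/-- A unit vector along the line to which the reference curve is asymptotic, with the asymptotic
behaviour of the curves in `BAL` and the resulting integral formula for the renormalized length. -/
structure AsympDirection (γ₀ : ℝ → E3) (v : E3) : Prop where
  unit : ‖v‖ = 1
  tendsto_tangent : ∀ γ : BAL γ₀, Tendsto (tangent γ.1) (cocompact ℝ) (𝓝 v)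
  renLength_eq : ∃ a : ℝ, ∀ (γ : BAL γ₀) (s : ℝ), Integrable (fun t => 1 - inner ℝ (tangent γ.1 t) v) ∧
    renLength γ s = a + ∫ t, (1 - inner ℝ (tangent γ.1 t) v)

/-- The function `s - ⟨γ s, v⟩` is nondecreasing, and its limits at the two ends differ by the
renormalized length of `γ`, up to a constant that depends on `γ₀` only. Hence that length is a
constant plus `∫ (1 - ⟨T, v⟩)`, and can be differentiated along families of curves. -/
theorem IsReferenceCurve.exists_direction (hγ₀ : IsReferenceCurve γ₀) :
    ∃ v, AsympDirection γ₀ v := by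
  obtain ⟨-, p, v, hv, ⟨a, ha⟩, ⟨b, hb⟩⟩ := hγ₀
  -- the ends of a curve in `BAL`
  have htop : ∀ {γ : BAL γ₀} {L : ℝ}, IsBalancedWith γ₀ γ.1 L →
      Tendsto (fun s => γ.1 s - (p + (s - L + a) • v)) atTop (𝓝 0) := fun {γ L} h => by
    have h1 := (h.1.add ha).comp (tendsto_atTop_add_const_right atTop (-L) tendsto_id)
    simpa [Function.comp_def, sub_eq_add_neg, add_assoc] using h1
  have hbot : ∀ {γ : BAL γ₀} {L : ℝ}, IsBalancedWith γ₀ γ.1 L →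
      Tendsto (fun s => γ.1 s - (p + (s + L + b) • v)) atBot (𝓝 0) := fun {γ L} h => by
    have h1 := (h.2.add hb).comp (tendsto_atBot_add_const_right atBot L tendsto_id)
    simpa [Function.comp_def] using h1
  have hstep : ∀ {γ : BAL γ₀} {l : Filter ℝ} {d : ℝ}, Tendsto (fun s : ℝ => s + 1) l l →
      Tendsto (fun s => γ.1 s - (p + (s + d) • v)) l (𝓝 0) →
      Tendsto (fun s => γ.1 (s + 1) - γ.1 s) l (𝓝 v) := fun {γ l d} hl h => by
    have h1 := ((h.comp hl).sub h).add_const v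
    simp only [sub_zero, zero_add] at h1
    refine h1.congr fun s => ?_
    simp only [Function.comp]
    have : (s + 1 + d) • v = (s + d) • v + v := by
      rw [show s + 1 + d = (s + d) + 1 by ring, add_smul, one_smul]
    rw [this]
    abel
  have hT : ∀ γ : BAL γ₀, Tendsto (tangent γ.1) (cocompact ℝ) (𝓝 v) := by
    intro γ
    obtain ⟨L, hL⟩ := γ.2.2.2.1
    rw [cocompact_eq_atBot_atTop, tendsto_sup]
    constructor
    · refine tendsto_tangent (BAL.frenet γ) γ.2.2.2.2.1 (by
        rw [cocompact_eq_atBot_atTop]; exact le_sup_left) ?_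
      exact hstep (d := L + b) (tendsto_atBot_add_const_right atBot 1 tendsto_id)
        (by simpa [add_assoc] using hbot hL)
    · refine tendsto_tangent (BAL.frenet γ) γ.2.2.2.2.1 (by
        rw [cocompact_eq_atBot_atTop]; exact le_sup_right) ?_
      exact hstep (d := -L + a) (tendsto_atTop_add_const_right atTop 1 tendsto_id)
        (by simpa [add_assoc, sub_eq_add_neg] using htop hL)
  refine ⟨v, hv, hT, a - b, fun γ s => ?_⟩
  set L := Classical.choose γ.2.2.2.1 with hLdef
  have hL : IsBalancedWith γ₀ γ.1 L := Classical.choose_spec γ.2.2.2.1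
  have hvv : inner ℝ v v = (1 : ℝ) := by rw [real_inner_self_eq_norm_sq, hv]; norm_num
  -- the function `s - ⟨γ s, v⟩` is nondecreasing, with finite limits
  have hd : ∀ t, HasDerivAt (fun t => t - inner ℝ (γ.1 t) v) (1 - inner ℝ (tangent γ.1 t) v) t :=
    fun t => (hasDerivAt_id t).sub
      (by simpa using ((BAL.frenet γ).hasDerivAt_curve t).inner ℝ (hasDerivAt_const t v))
  have hnn : ∀ t, 0 ≤ 1 - inner ℝ (tangent γ.1 t) v := fun t => by
    have := real_inner_le_norm (tangent γ.1 t) v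
    rw [(BAL.frenet γ).norm_tangent, hv, one_mul] at this
    linarith
  have hlim : ∀ {l : Filter ℝ} {d : ℝ}, Tendsto (fun s => γ.1 s - (p + (s + d) • v)) l (𝓝 0) →
      Tendsto (fun t => t - inner ℝ (γ.1 t) v) l (𝓝 (-(inner ℝ p v + d))) := fun {l d} h => by
    have h1 := ((h.inner (𝕜 := ℝ) (tendsto_const_nhds (x := v))).neg).sub_const (inner ℝ p v + d)
    simp only [inner_zero_left, neg_zero, zero_sub] at h1
    refine h1.congr fun t => ?_
    rw [inner_sub_left, inner_add_left, inner_smul_left, hvv]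
    simp only [conj_trivial, mul_one]
    ring
  have h1 := hlim (d := -L + a) (l := atTop) (by simpa [add_assoc, sub_eq_add_neg] using htop hL)
  have h2 := hlim (d := L + b) (l := atBot) (by simpa [add_assoc] using hbot hL)
  have hI : Integrable (fun t => 1 - inner ℝ (tangent γ.1 t) v) := by
    rw [← integrableOn_univ, ← Set.Iic_union_Ioi (a := 0), integrableOn_union]
    constructor
    · have hd' : ∀ t, HasDerivAt (fun t => -t - inner ℝ (γ.1 (-t)) v)
          (-(1 - inner ℝ (tangent γ.1 (-t)) v)) t := fun t => by
        exact ((hd (-t)).scomp t (hasDerivAt_neg t)).congr_deriv (by simp)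
      have h3 := integrableOn_Ioi_deriv_of_nonpos' (a := 0) (fun x _ => hd' x)
        (fun x _ => neg_nonpos.2 (hnn (-x))) (h2.comp tendsto_neg_atTop_atBot)
      have h4 : IntegrableOn (fun t => 1 - inner ℝ (tangent γ.1 (-t)) v) (Set.Ici (0 : ℝ)) := by
        rw [integrableOn_Ici_iff_integrableOn_Ioi]
        have h5 := h3.neg
        simp only [Pi.neg_def, neg_neg] at h5
        exact h5
      rw [← (Measure.measurePreserving_neg (volume : Measure ℝ)).integrableOn_comp_preimage
        (Homeomorph.neg ℝ).measurableEmbedding]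
      simpa [Function.comp_def, Set.preimage, Set.Ici] using h4
    · exact integrableOn_Ioi_deriv_of_nonneg' (fun x _ => hd x) (fun x _ => hnn x) h1
  refine ⟨hI, ?_⟩
  rw [integral_of_hasDerivAt_of_tendsto hd hI h2 h1]
  change 2 * L = _
  ring

/-! ### First variation of the Frenet apparatus -/

/-- The `N`-component of `∇ₛ ℘ X`. -/
def strainN (X : NB γ₀) : ScalarField γ₀ :=
  kappa * dsInv (kappa * X.1) + ds X.1 - tau * X.2

/-- The `B`-component of `∇ₛ ℘ X`. -/
def strainB (X : NB γ₀) : ScalarField γ₀ := ds X.2 + tau * X.1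

/-- The rate at which the variation `X` turns the normal plane: `⟨δN, B⟩`. -/
def spin (X : NB γ₀) : ScalarField γ₀ :=
  kappaInv * (ds (strainB X) + tau * strainN X)

theorem linExpr_strainN : LinExpr 1 (strainN (γ₀ := γ₀)) :=
  ((LinExpr.mul_le Alg.kappa (LinExpr.dsInv (LinExpr.mul_le Alg.kappa LinExpr.fst (by omega)))
    (by omega)).add LinExpr.fst.ds).sub (LinExpr.mul_le Alg.tau LinExpr.snd (by omega))

theorem linExpr_strainB : LinExpr 1 (strainB (γ₀ := γ₀)) :=
  LinExpr.snd.ds.add (LinExpr.mul_le Alg.tau LinExpr.fst (by omega))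

theorem linExpr_spin : LinExpr 0 (spin (γ₀ := γ₀)) :=
  LinExpr.mul_le Alg.kappaInv
    (linExpr_strainB.ds.add (LinExpr.mul_le Alg.tau linExpr_strainN (by omega))) (by omega)

theorem linExpr_kappa_fst : LinExpr 2 (fun X : NB γ₀ => kappa * X.1) :=
  LinExpr.mul_le Alg.kappa LinExpr.fst (by omega)

theorem strainN_mem {X : NB γ₀} (hX : X ∈ vectorFields γ₀) : strainN X ∈ algSpace γ₀ 1 := linExpr_strainN.mem_algSpace hX

theorem strainB_mem {X : NB γ₀} (hX : X ∈ vectorFields γ₀) : strainB X ∈ algSpace γ₀ 1 := linExpr_strainB.mem_algSpace hX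

theorem spin_mem {X : NB γ₀} (hX : X ∈ vectorFields γ₀) : spin X ∈ algSpace γ₀ 0 := linExpr_spin.mem_algSpace hX

theorem kappa_fst_mem {X : NB γ₀} (hX : X ∈ vectorFields γ₀) : kappa * X.1 ∈ algSpace γ₀ 2 := linExpr_kappa_fst.mem_algSpace hX

/-- `℘ X` is locally arclength preserving, with normal components `strainN` and `strainB`. -/
theorem hasDerivAt_lift {X : NB γ₀} (hX : X ∈ vectorFields γ₀) (γ : BAL γ₀) (s : ℝ) : HasDerivAt (lift X γ)
    (strainN X γ s • normal γ.1 s + strainB X γ s • binormal γ.1 s) s := by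
  have hF := BAL.frenet γ
  have h1 := (Alg.hasDerivAt_dsInv (kappa_fst_mem hX) (by norm_num) γ s).smul
    (hF.hasDerivAt_tangent s)
  have h2 := (Alg.hasDerivAt hX.1 γ s).smul (hF.hasDerivAt_normal s)
  have h3 := (Alg.hasDerivAt hX.2 γ s).smul (hF.hasDerivAt_binormal s)
  refine ((h1.add h2).add h3).congr_deriv ?_
  simp only [strainN, strainB, kappa, tau, Pi.add_apply, Pi.sub_apply, Pi.mul_apply]
  module

theorem hasDerivAt_strain {X : NB γ₀} (hX : X ∈ vectorFields γ₀) (γ : BAL γ₀) (s : ℝ) : HasDerivAt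
    (fun s => strainN X γ s • normal γ.1 s + strainB X γ s • binormal γ.1 s)
    (-(curvature γ.1 s * strainN X γ s) • tangent γ.1 s +
      (ds (strainN X) γ s - torsion γ.1 s * strainB X γ s) • normal γ.1 s +
      (ds (strainB X) γ s + torsion γ.1 s * strainN X γ s) • binormal γ.1 s) s := by
  have hF := BAL.frenet γ
  have h2 := (Alg.hasDerivAt (strainN_mem hX) γ s).smul (hF.hasDerivAt_normal s)
  have h3 := (Alg.hasDerivAt (strainB_mem hX) γ s).smul (hF.hasDerivAt_binormal s)
  refine (h2.add h3).congr_deriv ?_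
  module

theorem tendsto_dsInv_kappa_fst {X : NB γ₀} (hX : X ∈ vectorFields γ₀) (γ : BAL γ₀) :
    Tendsto (dsInv (kappa * X.1) γ) atTop (𝓝 ((1 / 2 : ℝ) * ∫ t, (kappa * X.1 : ScalarField γ₀) γ t)) ∧
    Tendsto (dsInv (kappa * X.1) γ) atBot (𝓝 (-((1 / 2 : ℝ) * ∫ t, (kappa * X.1 : ScalarField γ₀) γ t))) :=
  ⟨tendsto_halfInt_atTop (Alg.integrable (kappa_fst_mem hX) (by norm_num) γ),
    tendsto_halfInt_atBot (Alg.integrable (kappa_fst_mem hX) (by norm_num) γ)⟩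

theorem tendsto_smul_unit {l : Filter ℝ} {f : ℝ → ℝ} {V : ℝ → E3} (hf : Tendsto f l (𝓝 0))
    (hV : ∀ s, ‖V s‖ = 1) : Tendsto (fun s => f s • V s) l (𝓝 0) := by
  rw [tendsto_zero_iff_norm_tendsto_zero]
  simpa [norm_smul, hV] using hf.abs

theorem tendsto_normal_part {f g : ScalarField γ₀} (hf : f ∈ algSpace γ₀ 1)
    (hg : g ∈ algSpace γ₀ 1) (γ : BAL γ₀) :
    Tendsto (fun s => f γ s • normal γ.1 s + g γ s • binormal γ.1 s) (cocompact ℝ) (𝓝 0) := by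
  simpa using (tendsto_smul_unit (Alg.tendsto hf le_rfl γ) (BAL.frenet γ).norm_normal).add
    (tendsto_smul_unit (Alg.tendsto hg le_rfl γ) (BAL.frenet γ).norm_binormal)

/-- At the ends the normal part of `℘ X` vanishes and the tangential part tends to `± (1/2) ∫ κ g`,
by the choice of the constant in the anti-derivative. -/
theorem oddLimits_lift {v : E3} (hv : AsympDirection γ₀ v) {X : NB γ₀} (hX : X ∈ vectorFields γ₀)
    (γ : BAL γ₀) :
    Tendsto (lift X γ) atTop (𝓝 (((1 / 2 : ℝ) * ∫ t, (kappa * X.1 : ScalarField γ₀) γ t) • v)) ∧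
    Tendsto (lift X γ) atBot (𝓝 (-(((1 / 2 : ℝ) * ∫ t, (kappa * X.1 : ScalarField γ₀) γ t) • v))) := by
  have h0 := tendsto_normal_part hX.1 hX.2 γ
  have hT := hv.tendsto_tangent γ
  obtain ⟨h1, h2⟩ := tendsto_dsInv_kappa_fst hX γ
  rw [cocompact_eq_atBot_atTop, tendsto_sup] at h0 hT
  constructor
  · have := (h1.smul hT.2).add h0.2
    rw [add_zero] at this
    exact this.congr fun s => (add_assoc _ _ _).symm
  · have := (h2.smul hT.1).add h0.1
    rw [add_zero, neg_smul] at this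
    exact this.congr fun s => (add_assoc _ _ _).symm

/-- Variations of the curve `c 0` in the direction of the vector field `X`. -/
def variationRel {W : Type} (w₀ : W) : NB γ₀ → (ℝ → BAL γ₀) → ℝ → (ℝ → W) → Prop :=
  fun X c _ y => X ∈ vectorFields γ₀ ∧ IsVariation (c 0) (lift X (c 0)) c ∧ y = fun _ => w₀

section Frame

variable {X : NB γ₀} {c : ℝ → BAL γ₀} {r : ℝ}

theorem RegularFamily.tangent_variation (h : RegularFamily c r) (hX : X ∈ vectorFields γ₀)
    (hv : IsVariation (c 0) (lift X (c 0)) c) (s : ℝ) :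
    deriv (fun e => tangent (c e).1 s) 0 =
      strainN X (c 0) s • normal (c 0).1 s + strainB X (c 0) s • binormal (c 0).1 s := by
  have h1 := (h.hasDerivAt_curve_param h.zero_mem s 0).2
  have h2 : (fun t => deriv (fun e => iteratedDeriv 0 (c e).1 t) 0) = lift X (c 0) :=
    funext fun t => by simpa using (hv.2.1 t).deriv
  simp only [h2, zero_add, iteratedDeriv_one] at h1
  have h3 := h1.unique (hasDerivAt_lift hX (c 0) s)
  exact h3

/-- The first variation of the Frenet apparatus along a family with initial velocity `℘ X`. -/
theorem RegularFamily.frame_variation (h : RegularFamily c r) (hX : X ∈ vectorFields γ₀)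
    (hv : IsVariation (c 0) (lift X (c 0)) c) :
    ∃ (GT GN GB : ℝ → ℝ → E3) (Gκ Gι Gτ : ℝ → ℝ → ℝ),
      h.window.TameSmooth 0 (fun ε => tangent (c ε).1) GT ∧
      h.window.TameSmooth 0 (fun ε => normal (c ε).1) GN ∧
      h.window.TameSmooth 0 (fun ε => binormal (c ε).1) GB ∧
      h.window.TameSmooth 1 (fun ε => kappa (c ε)) Gκ ∧
      h.window.TameSmooth (-1) (fun ε => kappaInv (c ε)) Gι ∧
      h.window.TameSmooth 0 (fun ε => tau (c ε)) Gτ ∧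
      (∀ s, GT 0 s = strainN X (c 0) s • normal (c 0).1 s +
        strainB X (c 0) s • binormal (c 0).1 s) ∧
      (∀ s, GN 0 s = -strainN X (c 0) s • tangent (c 0).1 s +
        spin X (c 0) s • binormal (c 0).1 s) ∧
      (∀ s, GB 0 s = -strainB X (c 0) s • tangent (c 0).1 s -
        spin X (c 0) s • normal (c 0).1 s) ∧
      (Gκ 0 = (ds (strainN X) - tau * strainB X : ScalarField γ₀) (c 0)) ∧
      (Gι 0 = (-(kappaInv * kappaInv * (ds (strainN X) - tau * strainB X)) : ScalarField γ₀) (c 0)) ∧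
      (Gτ 0 = (ds (spin X) + kappa * strainB X : ScalarField γ₀) (c 0)) := by
  obtain ⟨GN, hN⟩ := h.tame_normal
  obtain ⟨GB, hB⟩ := h.tame_binormal
  obtain ⟨Gκ, hκ⟩ := h.tame_kappa
  obtain ⟨Gι, hι⟩ := h.tame_kappaInv
  obtain ⟨Gτ, hτ⟩ := h.tame_torsion
  have hT := h.tame_tangent
  have h0 := h.zero_mem
  have h0I := h.window.J_sub h0
  set γ := c 0 with hγ
  have hF := BAL.frenet γ
  set p := strainN X γ with hp
  set q := strainB X γ with hq
  have eT : ∀ s, deriv (fun e => tangent (c e).1 s) 0 = p s • normal γ.1 s + q s • binormal γ.1 s :=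
    fun s => h.tangent_variation hX hv s
  -- differentiate `T' = κ N`, `⟨N, N⟩ = 1`, `⟨T, N⟩ = 0` along the family
  have e1 : ∀ s, Gκ 0 s • normal γ.1 s + curvature γ.1 s • GN 0 s =
      -(curvature γ.1 s * p s) • tangent γ.1 s +
      (ds (strainN X) γ s - torsion γ.1 s * q s) • normal γ.1 s +
      (ds (strainB X) γ s + torsion γ.1 s * p s) • binormal γ.1 s := by
    intro s
    have a1 := (hT.deriv 0).tame₀.hasDerivAt 0 h0 s
    have a2 := ((hκ 0).smul (hN 0)).tame₀.hasDerivAt 0 h0 s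
    have a3 : (fun e => deriv (tangent (c e).1) s) =
        fun e => curvature (c e).1 s • normal (c e).1 s :=
      funext fun e => ((BAL.frenet (c e)).hasDerivAt_tangent s).deriv
    rw [a3] at a1
    rw [← a1.unique a2, funext eT]
    exact (hasDerivAt_strain hX γ s).deriv
  have e2 : ∀ s, inner ℝ (normal γ.1 s) (GN 0 s) = (0 : ℝ) := by
    intro s
    have a1 := ((hN 0).inner (hN 0)).tame₀.hasDerivAt 0 h0 s
    simp only [(BAL.frenet (c _)).inner_NN] at a1
    have a2 := a1.unique (hasDerivAt_const _ _)
    rw [real_inner_comm] at a2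
    change inner ℝ (normal γ.1 s) (GN 0 s) + inner ℝ (normal γ.1 s) (GN 0 s) = (0 : ℝ) at a2
    linarith
  have e3 : ∀ s, inner ℝ (tangent γ.1 s) (GN 0 s) = -p s := by
    intro s
    have a1 := ((hT 0).inner (hN 0)).tame₀.hasDerivAt 0 h0 s
    simp only [(BAL.frenet (c _)).inner_TN] at a1
    have a2 := a1.unique (hasDerivAt_const _ _)
    rw [eT s, inner_add_left, inner_smul_left, inner_smul_left] at a2
    change _ * inner ℝ (normal γ.1 s) (normal γ.1 s) + _ * inner ℝ (binormal γ.1 s) (normal γ.1 s) +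
      inner ℝ (tangent γ.1 s) (GN 0 s) = (0 : ℝ) at a2
    rw [hF.inner_NN, hF.inner_BN] at a2
    simp only [conj_trivial] at a2
    linarith
  have eκ : ∀ s, Gκ 0 s = ds (strainN X) γ s - torsion γ.1 s * q s := by
    intro s
    have a1 := congrArg (fun V => (inner ℝ (normal γ.1 s) V : ℝ)) (e1 s)
    simp only [inner_add_right, inner_smul_right, hF.inner_NN, hF.inner_NT, hF.inner_NB, e2] at a1
    linarith
  have eN : ∀ s, GN 0 s = -p s • tangent γ.1 s + spin X γ s • binormal γ.1 s := by
    intro s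
    have a1 := congrArg (fun V => (inner ℝ (binormal γ.1 s) V : ℝ)) (e1 s)
    simp only [inner_add_right, inner_smul_right, hF.inner_BB, hF.inner_BT, hF.inner_BN, mul_zero,
      zero_add, mul_one] at a1
    have a2 : inner ℝ (binormal γ.1 s) (GN 0 s) = spin X γ s := by
      have := hF.curv s
      simp only [spin, kappaInv, tau, Pi.mul_apply, Pi.add_apply]
      field_simp
      rw [mul_comm, a1]
    rw [hF.expansion s (GN 0 s), e3, e2, a2, zero_smul, add_zero]
  have eB : ∀ s, GB 0 s = -q s • tangent γ.1 s - spin X γ s • normal γ.1 s := by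
    intro s
    have a1 := ((hT 0).cross (hN 0)).tame₀.hasDerivAt 0 h0 s
    rw [((hB 0).tame₀.hasDerivAt 0 h0 s).unique a1, eT s, eN s]
    change cross _ (normal γ.1 s) + cross (tangent γ.1 s) _ = _
    rw [cross_add_left, cross_add_right, cross_smul_left, cross_smul_left, cross_smul_right,
      cross_smul_right, cross_self, cross_self, hF.cross_TB, cross_anticomm (binormal γ.1 s),
      hF.cross_NB]
    module
  refine ⟨_, GN, GB, Gκ, Gι, Gτ, hT, hN, hB, hκ, hι, hτ, eT, eN, eB, funext eκ, ?_, ?_⟩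
  · funext s
    have a1 := ((hι 0).mul (hκ 0)).tame₀.hasDerivAt 0 h0 s
    have a2 : (fun e => (curvature (c e).1 s)⁻¹ * curvature (c e).1 s) = fun _ => (1 : ℝ) :=
      funext fun e => inv_mul_cancel₀ ((BAL.frenet (c e)).curv s)
    rw [a2] at a1
    have a3 := a1.unique (hasDerivAt_const _ _)
    rw [eκ s] at a3
    change Gι 0 s * curvature γ.1 s + (curvature γ.1 s)⁻¹ * _ = 0 at a3
    have := hF.curv s
    simp only [kappaInv, tau, Pi.mul_apply, Pi.sub_apply, Pi.neg_apply]
    field_simp at a3 ⊢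
    linarith
  · funext s
    have a1 := ((hN.deriv 0).inner (hB 0)).tame₀.hasDerivAt 0 h0 s
    rw [((hτ 0).tame₀.hasDerivAt 0 h0 s).unique a1]
    have a4 := ((Alg.hasDerivAt (strainN_mem hX) γ s).neg.smul (hF.hasDerivAt_tangent s)).add
      ((Alg.hasDerivAt (spin_mem hX) γ s).smul (hF.hasDerivAt_binormal s))
    have a5 : GN 0 = (fun t => -p t • tangent γ.1 t) + fun t => spin X γ t • binormal γ.1 t :=
      funext eN
    replace a4 := a4.congr_of_eventuallyEq (Filter.Eventually.of_forall fun t => congrFun a5 t)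
    rw [a4.deriv, eB s]
    change inner ℝ _ (binormal γ.1 s) + inner ℝ (deriv (normal γ.1) s) _ = _
    rw [(hF.hasDerivAt_normal s).deriv]
    simp only [inner_add_left, inner_sub_right, inner_smul_left, inner_smul_right, hF.inner_TB,
      hF.inner_NB, hF.inner_BB, hF.inner_TT, hF.inner_TN, hF.inner_BT, hF.inner_BN, conj_trivial,
      Pi.add_apply, Pi.mul_apply, kappa]
    simp
    ring

end Frame

/-! ### First variation of the renormalized length, and of all expressions -/

/-- The renormalized length is differentiated under the integral sign in `renLength_eq`; the
derivative of the tangent with respect to the parameter is rapidly decreasing. -/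
theorem RegularFamily.tame_renLength {c : ℝ → BAL γ₀} {r : ℝ} {v : E3} (hv : AsympDirection γ₀ v)
    (h : RegularFamily c r) : h.window.TameSmooth 0 (fun ε => renLength (c ε))
      (fun ε _ => ∫ t, -inner ℝ (deriv (fun e => tangent (c e).1 t) ε) v) := by
  set G : ℝ → ℝ → ℝ := fun ε t => -inner ℝ (deriv (fun e => tangent (c e).1 t) ε) v with hG
  have hT := (h.tame_tangent 0).tame₀
  have hTd := hT.hasDerivAt
  obtain ⟨C, hC⟩ := h.polyBdd_tangent_param.le_inv_one_add_sq
  obtain ⟨a, ha⟩ := hv.renLength_eq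
  have hGb : ∀ ε ∈ h.window.I, ∀ t, ‖G ε t‖ ≤ C * (1 + t ^ 2)⁻¹ := fun ε hε t => by
    rw [hG, norm_neg]
    refine (norm_inner_le_norm _ _).trans ?_
    rw [hv.unit, mul_one]
    exact hC ε hε t
  have hd : ∀ ε ∈ h.window.J, ∀ s, HasDerivAt (fun e => renLength (c e) s) (∫ t, G ε t) ε := by
    intro ε hε s
    have hJ := h.window.isOpen_J.mem_nhds hε
    have key := (hasDerivAt_integral_of_dominated_loc_of_deriv_le (μ := volume)
      (F := fun e t => 1 - inner ℝ (tangent (c e).1 t) v) (F' := G)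
      (bound := fun t => C * (1 + t ^ 2)⁻¹) hJ
      (Eventually.of_forall fun e => (ha (c e) 0).1.aestronglyMeasurable) (ha (c ε) 0).1
      (((hT.cont' ε (h.window.J_sub hε)).inner continuous_const).neg.aestronglyMeasurable)
      (Eventually.of_forall fun t e he => hGb e (h.window.J_sub he) t)
      (integrable_inv_one_add_sq.const_mul C)
      (Eventually.of_forall fun t e he => ?_)).2
    · exact (key.const_add a).congr_of_eventuallyEq
        (Eventually.of_forall fun e => (ha (c e) s).2)
    · have := ((hTd e he t).inner ℝ (hasDerivAt_const e v)).const_sub 1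
      simpa [hG] using this
  have hGi : ∀ ε ∈ h.window.I, ‖∫ t, G ε t‖ ≤ ∫ t, C * (1 + t ^ 2)⁻¹ := fun ε hε =>
    norm_integral_le_of_norm_le (integrable_inv_one_add_sq.const_mul C)
      (Eventually.of_forall (hGb ε hε))
  have h0 : h.window.Tame₀ 0 (fun ε => renLength (c ε)) (fun ε _ => ∫ t, G ε t) := by
    refine ⟨?_, ⟨∫ t, C * (1 + t ^ 2)⁻¹, 0, fun ε hε s => by simpa using hGi ε hε⟩,
      fun _ _ => continuous_const, fun _ _ => continuous_const, hd⟩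
    set D : ℝ := ∫ t, C * (1 + t ^ 2)⁻¹
    have hD : 0 ≤ D := (norm_nonneg _).trans (hGi 0 h.zero_mem)
    refine ⟨|renLength (c 0) 0| + D * r, 0, fun ε hε s => ?_⟩
    have hε' : |ε| ≤ r := (abs_lt.2 hε).le
    have := (convex_Ioo (-r) r).norm_image_sub_le_of_norm_hasDerivWithin_le
      (f := fun e => renLength (c e) s) (fun x hx => (hd x hx s).hasDerivWithinAt)
      (fun x hx => hGi x hx) h.zero_mem hε
    rw [sub_zero, Real.norm_eq_abs, Real.norm_eq_abs] at this
    have h3 : |renLength (c ε) s| ≤ |renLength (c ε) s - renLength (c 0) s| + |renLength (c 0) s| := by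
      simpa using abs_add_le (renLength (c ε) s - renLength (c 0) s) (renLength (c 0) s)
    have h4 : D * |ε| ≤ D * r := by gcongr
    rw [pow_zero, zpow_zero, mul_one, mul_one, Real.norm_eq_abs]
    change _ ≤ |renLength (c 0) s| + _
    linarith
  intro k
  cases k with
  | zero => exact h0
  | succ k =>
    exact ⟨h0, fun _ _ => 0, fun _ _ => 0,
      fun ε _ s => ⟨hasDerivAt_const _ _, hasDerivAt_const _ _⟩, Window.Tame.const _ k 0⟩

/-- The first variation of the renormalized length is `-∫ κ g`, as for the length of a closed curve:
`⟨(℘ X)', v⟩` is integrated using the limits of `℘ X` at the two ends. -/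
theorem integral_inner_strain {v : E3} (hv : AsympDirection γ₀ v) {X : NB γ₀}
    (hX : X ∈ vectorFields γ₀) (γ : BAL γ₀) :
    ∫ t, (inner ℝ (strainN X γ t • normal γ.1 t + strainB X γ t • binormal γ.1 t) v : ℝ) =
      ∫ t, (kappa * X.1 : ScalarField γ₀) γ t := by
  have hF := BAL.frenet γ
  obtain ⟨h1, h2⟩ := oddLimits_lift hv hX γ
  have hvv : inner ℝ v v = (1 : ℝ) := by rw [real_inner_self_eq_norm_sq, hv.unit]; norm_num
  have hd : ∀ t, HasDerivAt (fun t => (inner ℝ (lift X γ t) v : ℝ))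
      (inner ℝ (strainN X γ t • normal γ.1 t + strainB X γ t • binormal γ.1 t) v) t := fun t => by
    simpa using (hasDerivAt_lift hX γ t).inner ℝ (hasDerivAt_const t v)
  have hi : Integrable
      (fun t => (inner ℝ (strainN X γ t • normal γ.1 t + strainB X γ t • binormal γ.1 t) v : ℝ)) := by
    have hp := Alg.integrable (strainN_mem hX) le_rfl γ
    have hq := Alg.integrable (strainB_mem hX) le_rfl γ
    refine (hp.norm.add hq.norm).mono' ?_ (Eventually.of_forall fun t => ?_)
    · exact (((((Alg.contDiff (strainN_mem hX) γ).continuous.smul hF.smooth_normal.continuous).add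
        ((Alg.contDiff (strainB_mem hX) γ).continuous.smul hF.smooth_binormal.continuous)).inner
        continuous_const)).aestronglyMeasurable
    · refine (norm_inner_le_norm _ _).trans ?_
      rw [hv.unit, mul_one]
      refine (norm_add_le _ _).trans ?_
      rw [norm_smul, norm_smul, hF.norm_normal, hF.norm_binormal, mul_one, mul_one]
      rfl
  rw [integral_of_hasDerivAt_of_tendsto hd hi (h2.inner tendsto_const_nhds)
    (h1.inner tendsto_const_nhds), inner_neg_left, inner_smul_left, hvv]
  simp only [conj_trivial]
  ring

/-- Along a variation in the direction of a vector field `X ∈ 𝒳`, every expression is differentiable,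
its derivative being a linear expression in `X`. -/
theorem AlgVar.deformable_variation {v : E3} (hv : AsympDirection γ₀ v) {W : Type}
    {vars : Set (W → ScalarField γ₀)} {w₀ : W} (hvars : ∀ f ∈ vars, f w₀ ∈ algSpace γ₀ 1)
    (hvars' : ∀ f ∈ vars, Deformable (variationRel w₀) 1 f)
    {n : ℤ} {f : W → ScalarField γ₀} (hf : AlgVar vars n f) :
    Deformable (variationRel w₀) n f := by
  refine AlgVar.deformable hvars (fun X c r y h => by rw [h.2.2]) hvars' ?_ ?_ ?_ ?_ hf
  · refine ⟨_, linExpr_strainN.ds.sub (LinExpr.mul_le Alg.tau linExpr_strainB (by omega)), ?_⟩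
    rintro X c r y ⟨hX, hc, -⟩ h
    obtain ⟨GT, GN, GB, Gκ, Gι, Gτ, hT, hN, hB, hκ, hι, hτ, eT, eN, eB, eκ, eι, eτ⟩ :=
      h.frame_variation hX hc
    exact ⟨Gκ, hκ, eκ⟩
  · refine ⟨fun X => -(VortexFilament.kappaInv * VortexFilament.kappaInv *
      (VortexFilament.ds (strainN X) - VortexFilament.tau * strainB X)),
      (LinExpr.mul_le (Alg.mul' Alg.kappaInv Alg.kappaInv)
      (linExpr_strainN.ds.sub (LinExpr.mul_le Alg.tau linExpr_strainB (by omega)))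
      (by omega)).neg, ?_⟩
    rintro X c r y ⟨hX, hc, -⟩ h
    obtain ⟨GT, GN, GB, Gκ, Gι, Gτ, hT, hN, hB, hκ, hι, hτ, eT, eN, eB, eκ, eι, eτ⟩ :=
      h.frame_variation hX hc
    exact ⟨Gι, hι, eι⟩
  · refine ⟨_, linExpr_spin.ds.add (LinExpr.mul_le Alg.kappa linExpr_strainB (by omega)), ?_⟩
    rintro X c r y ⟨hX, hc, -⟩ h
    obtain ⟨GT, GN, GB, Gκ, Gι, Gτ, hT, hN, hB, hκ, hι, hτ, eT, eN, eB, eκ, eι, eτ⟩ :=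
      h.frame_variation hX hc
    exact ⟨Gτ, hτ, eτ⟩
  · refine ⟨_, (LinExpr.integ linExpr_kappa_fst).neg, ?_⟩
    rintro X c r y ⟨hX, hc, -⟩ h
    refine ⟨_, h.tame_renLength hv, funext fun s => ?_⟩
    simp_rw [h.tangent_variation hX hc]
    rw [integral_neg, integral_inner_strain hv hX]
    rfl

/-- The first variation of a scalar field in `𝒜ₙ`. -/
theorem exists_linearization {v : E3} (hv : AsympDirection γ₀ v) {n : ℤ} {f : ScalarField γ₀}
    (hf : f ∈ algSpace γ₀ n) : ∃ L : NB γ₀ → ScalarField γ₀, LinExpr n L ∧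
    ∀ X ∈ vectorFields γ₀, ∀ c : ℝ → BAL γ₀, IsVariation (c 0) (lift X (c 0)) c →
      ∀ r, ∀ h : RegularFamily c r,
        ∃ G, h.window.TameSmooth n (fun ε => f (c ε)) G ∧ G 0 = L X (c 0) := by
  obtain ⟨L, hL, h⟩ := AlgVar.deformable_variation hv (w₀ := ()) (by simp) (by simp) hf
  exact ⟨L, hL, fun X hX c hc r hr => h X c r _ ⟨hX, hc, rfl⟩ hr⟩

/-! ### Jointly smooth families -/

/-- The derivative of `q ^ (-1/2)`. -/
theorem hasDerivAt_of_sq_mul_eq_one {f g : ℝ → ℝ} {f' x : ℝ} (hf : HasDerivAt f f' x)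
    (hg : ∀ y, 0 < g y) (hfg : ∀ y, g y ^ 2 * f y = 1) :
    HasDerivAt g ((-1 / 2 : ℝ) * (g x ^ 3 * f')) x := by
  have h1 : ∀ y, f y = ((g y)⁻¹) ^ 2 := fun y => by
    have := hfg y
    have := (hg y).ne'
    field_simp
    linarith
  have h2 : g = fun y => (Real.sqrt (f y))⁻¹ := funext fun y => by
    rw [h1, Real.sqrt_sq (inv_nonneg.2 (hg y).le), inv_inv]
  have hfx : 0 < f x := by rw [h1]; exact pow_pos (inv_pos.2 (hg x)) 2
  have hs := Real.sqrt_pos.2 hfx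
  have h3 := (hf.sqrt hfx.ne').inv hs.ne'
  rw [h2]
  refine h3.congr_deriv ?_
  field_simp

namespace Window

variable {E E₁ E₂ E₃ : Type} [NormedAddCommGroup E] [NormedSpace ℝ E]
  [NormedAddCommGroup E₁] [NormedSpace ℝ E₁] [NormedAddCommGroup E₂] [NormedSpace ℝ E₂]
  [NormedAddCommGroup E₃] [NormedSpace ℝ E₃]

/-- All partial derivatives of `F ε s` of order at most `k` are continuous and bounded by the `n`-th
power of the weight, up to polynomials in `s`. -/
def Joint (D : Window) : ℕ → ℤ → (ℝ → ℝ → E) → Prop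
  | 0, n, F => D.PolyBdd n F ∧ Continuous fun p : ℝ × ℝ => F p.1 p.2
  | k + 1, n, F => (D.PolyBdd n F ∧ Continuous fun p : ℝ × ℝ => F p.1 p.2) ∧
      ∃ F₁ F₂ : ℝ → ℝ → E, (∀ ε s, HasDerivAt (fun e => F e s) (F₁ ε s) ε) ∧
        (∀ ε s, HasDerivAt (F ε) (F₂ ε s) s) ∧ Joint D k n F₁ ∧ Joint D k n F₂

/-- All partial derivatives of `F ε s` are bounded by the `n`-th power of the weight, up to
polynomials in `s`. -/
def JointSmooth (D : Window) (n : ℤ) (F : ℝ → ℝ → E) : Prop := ∀ k, D.Joint k n F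

variable {D : Window} {n m : ℤ} {k : ℕ} {F F₁ F₂ : ℝ → ℝ → E}

theorem Joint.base (h : D.Joint k n F) :
    D.PolyBdd n F ∧ Continuous fun p : ℝ × ℝ => F p.1 p.2 := by
  cases k with
  | zero => exact h
  | succ k => exact h.1

theorem Joint.of_succ (h : D.Joint (k + 1) n F) : D.Joint k n F := by
  induction k generalizing F with
  | zero => exact h.1
  | succ k ih =>
    obtain ⟨h0, F₁, F₂, d₁, d₂, h₁, h₂⟩ := h
    exact ⟨h0, F₁, F₂, d₁, d₂, ih h₁, ih h₂⟩

theorem Joint.add {G : ℝ → ℝ → E} (hF : D.Joint k n F) (hG : D.Joint k n G) :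
    D.Joint k n (fun ε s => F ε s + G ε s) := by
  have h0 := And.intro (hF.base.1.add hG.base.1) (hF.base.2.add hG.base.2)
  induction k generalizing F G with
  | zero => exact h0
  | succ k ih =>
    obtain ⟨-, F₁, F₂, d₁, d₂, h₁, h₂⟩ := hF
    obtain ⟨-, G₁, G₂, d₁', d₂', h₁', h₂'⟩ := hG
    exact ⟨h0, _, _, fun ε s => (d₁ ε s).add (d₁' ε s), fun ε s => (d₂ ε s).add (d₂' ε s),
      ih h₁ h₁' ⟨h₁.base.1.add h₁'.base.1, h₁.base.2.add h₁'.base.2⟩,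
      ih h₂ h₂' ⟨h₂.base.1.add h₂'.base.1, h₂.base.2.add h₂'.base.2⟩⟩

theorem Joint.bilin (B : E₁ →L[ℝ] E₂ →L[ℝ] E₃) {F : ℝ → ℝ → E₁} {G : ℝ → ℝ → E₂}
    (hF : D.Joint k n F) (hG : D.Joint k m G) :
    D.Joint k (n + m) (fun ε s => B (F ε s) (G ε s)) := by
  have h0 := And.intro (hF.base.1.bilin B hG.base.1)
    ((B.continuous.comp hF.base.2).clm_apply hG.base.2)
  induction k generalizing F G with
  | zero => exact h0
  | succ k ih =>
    have hF' := hF.of_succ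
    have hG' := hG.of_succ
    obtain ⟨-, F₁, F₂, d₁, d₂, h₁, h₂⟩ := hF
    obtain ⟨-, G₁, G₂, d₁', d₂', h₁', h₂'⟩ := hG
    have key : ∀ {F : ℝ → ℝ → E₁} {G : ℝ → ℝ → E₂}, D.Joint k n F → D.Joint k m G →
        D.Joint k (n + m) (fun ε s => B (F ε s) (G ε s)) := fun hF hG =>
      ih hF hG ⟨hF.base.1.bilin B hG.base.1, (B.continuous.comp hF.base.2).clm_apply hG.base.2⟩
    exact ⟨h0, _, _, fun ε s => (d₁ ε s).bilin B (d₁' ε s), fun ε s => (d₂ ε s).bilin B (d₂' ε s),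
      (key h₁ hG').add (key hF' h₁'), (key h₂ hG').add (key hF' h₂')⟩

theorem Joint.lower (h : D.Joint k n F) : D.Joint k (n - 1) F := by
  induction k generalizing F with
  | zero => exact ⟨h.1.lower, h.2⟩
  | succ k ih =>
    obtain ⟨h0, F₁, F₂, d₁, d₂, h₁, h₂⟩ := h
    exact ⟨⟨h0.1.lower, h0.2⟩, F₁, F₂, d₁, d₂, ih h₁, ih h₂⟩

theorem Joint.const (D : Window) (k : ℕ) (c : E) : D.Joint k 0 (fun _ _ => c) := by
  have h0 : ∀ c : E, D.PolyBdd 0 (fun _ _ => c) ∧ Continuous fun _ : ℝ × ℝ => c := fun c =>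
    ⟨⟨‖c‖, 0, by simp⟩, continuous_const⟩
  induction k generalizing c with
  | zero => exact h0 c
  | succ k ih =>
    exact ⟨h0 c, _, _, fun _ _ => hasDerivAt_const _ _, fun _ _ => hasDerivAt_const _ _, ih 0, ih 0⟩

theorem Joint.mul {F G : ℝ → ℝ → ℝ} (hF : D.Joint k n F) (hG : D.Joint k m G) :
    D.Joint k (n + m) (fun ε s => F ε s * G ε s) :=
  hF.bilin (ContinuousLinearMap.mul ℝ ℝ) hG

theorem Joint.smul {F : ℝ → ℝ → ℝ} {G : ℝ → ℝ → E} (hF : D.Joint k n F) (hG : D.Joint k m G) :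
    D.Joint k (n + m) (fun ε s => F ε s • G ε s) :=
  hF.bilin (ContinuousLinearMap.lsmul ℝ ℝ) hG

theorem Joint.inner {F G : ℝ → ℝ → E3} (hF : D.Joint k n F) (hG : D.Joint k m G) :
    D.Joint k (n + m) (fun ε s => (inner ℝ (F ε s) (G ε s) : ℝ)) :=
  hF.bilin (innerSL ℝ) hG

theorem Joint.cross {F G : ℝ → ℝ → E3} (hF : D.Joint k n F) (hG : D.Joint k m G) :
    D.Joint k (n + m) (fun ε s => cross (F ε s) (G ε s)) :=
  hF.bilin crossL hG

theorem Joint.const_smul (c : ℝ) (h : D.Joint k n F) : D.Joint k n (fun ε s => c • F ε s) := by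
  simpa using (Joint.const D k c).smul h

theorem continuous_slice {A : Type} [TopologicalSpace A] {F : ℝ → ℝ → A}
    (h : Continuous fun p : ℝ × ℝ => F p.1 p.2) (ε : ℝ) :
    Continuous (F ε) := by
  have h1 := h.comp (continuous_const.prodMk continuous_id : Continuous fun s : ℝ => (ε, s))
  exact h1

/-- Joint differentiability, from the continuity of the partial derivatives. -/
theorem Joint.hasFDerivAt (d₁ : ∀ ε s, HasDerivAt (fun e => F e s) (F₁ ε s) ε)
    (d₂ : ∀ ε s, HasDerivAt (F ε) (F₂ ε s) s) (h₁ : Continuous fun p : ℝ × ℝ => F₁ p.1 p.2)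
    (h₂ : Continuous fun p : ℝ × ℝ => F₂ p.1 p.2) (p : ℝ × ℝ) :
    HasFDerivAt (fun p : ℝ × ℝ => F p.1 p.2)
      ((ContinuousLinearMap.toSpanSingleton ℝ (F₁ p.1 p.2)).coprod
        (ContinuousLinearMap.toSpanSingleton ℝ (F₂ p.1 p.2))) p := by
  have hc := (ContinuousLinearMap.toSpanSingletonCLE (𝕜 := ℝ) (E := E)).continuous
  exact (hasStrictFDerivAt_uncurry_coprod (𝕜 := ℝ) (f := F)
    (f₁ := fun ε s => ContinuousLinearMap.toSpanSingleton ℝ (F₁ ε s))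
    (f₂ := fun ε s => ContinuousLinearMap.toSpanSingleton ℝ (F₂ ε s))
    (Eventually.of_forall fun v => d₁ v.1 v.2) (Eventually.of_forall fun v => d₂ v.1 v.2)
    (hc.comp h₁).continuousAt (hc.comp h₂).continuousAt).hasFDerivAt

theorem Joint.contDiff (h : D.Joint k n F) : ContDiff ℝ k fun p : ℝ × ℝ => F p.1 p.2 := by
  induction k generalizing F with
  | zero => exact contDiff_zero.2 h.2
  | succ k ih =>
    obtain ⟨h0, F₁, F₂, d₁, d₂, h₁, h₂⟩ := h
    have hd := Joint.hasFDerivAt d₁ d₂ h₁.base.2 h₂.base.2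
    rw [Nat.cast_succ, contDiff_succ_iff_fderiv_apply]
    refine ⟨fun p => (hd p).differentiableAt, by simp, fun y => ?_⟩
    simp only [fun p => (hd p).fderiv, ContinuousLinearMap.coprod_apply,
      ContinuousLinearMap.toSpanSingleton_apply]
    exact (contDiff_const.smul (ih h₁)).add (contDiff_const.smul (ih h₂))

/-- The derivative of `F` along a curve in the plane. -/
theorem Joint.hasDerivAt_comp (d₁ : ∀ ε s, HasDerivAt (fun e => F e s) (F₁ ε s) ε)
    (d₂ : ∀ ε s, HasDerivAt (F ε) (F₂ ε s) s) (h₁ : Continuous fun p : ℝ × ℝ => F₁ p.1 p.2)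
    (h₂ : Continuous fun p : ℝ × ℝ => F₂ p.1 p.2) {a b : ℝ → ℝ} {a' b' x : ℝ}
    (ha : HasDerivAt a a' x) (hb : HasDerivAt b b' x) :
    HasDerivAt (fun t => F (a t) (b t)) (a' • F₁ (a x) (b x) + b' • F₂ (a x) (b x)) x := by
  have h := (Joint.hasFDerivAt d₁ d₂ h₁ h₂ (a x, b x)).comp_hasDerivAt x (ha.prodMk hb)
  simp only [ContinuousLinearMap.coprod_apply, ContinuousLinearMap.toSpanSingleton_apply] at h
  exact h

theorem JointSmooth.exists_partials (h : D.JointSmooth n F) : ∃ F₁ F₂ : ℝ → ℝ → E,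
    (∀ ε s, HasDerivAt (fun e => F e s) (F₁ ε s) ε) ∧ (∀ ε s, HasDerivAt (F ε) (F₂ ε s) s) ∧
    D.JointSmooth n F₁ ∧ D.JointSmooth n F₂ := by
  obtain ⟨-, F₁, F₂, d₁, d₂, -, -⟩ := h 1
  refine ⟨F₁, F₂, d₁, d₂, fun k => ?_, fun k => ?_⟩
  all_goals
    obtain ⟨-, G₁, G₂, d₁', d₂', h₁, h₂⟩ := h (k + 1)
  · rwa [show F₁ = G₁ from funext fun ε => funext fun s => (d₁ ε s).unique (d₁' ε s)]
  · rwa [show F₂ = G₂ from funext fun ε => funext fun s => (d₂ ε s).unique (d₂' ε s)]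

theorem JointSmooth.deriv (h : D.JointSmooth n F) :
    D.JointSmooth n (fun ε => deriv (F ε)) := by
  obtain ⟨F₁, F₂, d₁, d₂, h₁, h₂⟩ := h.exists_partials
  rwa [show (fun ε => _root_.deriv (F ε)) = F₂ from
    funext fun ε => funext fun s => (d₂ ε s).deriv]

theorem JointSmooth.iteratedDeriv (h : D.JointSmooth n F) (j : ℕ) :
    D.JointSmooth n (fun ε => iteratedDeriv j (F ε)) := by
  induction j with
  | zero => simpa only [iteratedDeriv_zero] using h
  | succ j ih => simpa only [iteratedDeriv_succ] using ih.deriv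

theorem JointSmooth.derivParam (h : D.JointSmooth n F) :
    D.JointSmooth n (fun ε s => _root_.deriv (fun e => F e s) ε) := by
  obtain ⟨F₁, F₂, d₁, d₂, h₁, h₂⟩ := h.exists_partials
  rwa [show (fun ε s => _root_.deriv (fun e => F e s) ε) = F₁ from
    funext fun ε => funext fun s => (d₁ ε s).deriv]

theorem JointSmooth.contDiff (h : D.JointSmooth n F) : ContDiff ℝ ∞ fun p : ℝ × ℝ => F p.1 p.2 :=
  contDiff_infty.2 fun k => (h k).contDiff

/-- If `q` is jointly smooth of degree `2 n`, then so is in degree `-n` the positive function `h` with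
`h² q = 1`, provided `h` itself has that degree: its derivatives are `-h³ q' / 2`. -/
theorem Joint.inv_sqrt {q h : ℝ → ℝ → ℝ} (hq : D.Joint k (2 * n) q)
    (hpos : ∀ ε s, 0 < h ε s) (hqh : ∀ ε s, h ε s ^ 2 * q ε s = 1)
    (hb : D.PolyBdd (-n) h) : D.Joint k (-n) h := by
  have hc : Continuous fun p : ℝ × ℝ => h p.1 p.2 := by
    have h1 : ∀ p : ℝ × ℝ, q p.1 p.2 = ((h p.1 p.2)⁻¹) ^ 2 := fun p => by
      have := hqh p.1 p.2
      have := (hpos p.1 p.2).ne'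
      field_simp
      linarith
    have h2 : (fun p : ℝ × ℝ => h p.1 p.2) = fun p => (Real.sqrt (q p.1 p.2))⁻¹ := funext fun p => by
      rw [h1, Real.sqrt_sq (inv_nonneg.2 (hpos _ _).le), inv_inv]
    rw [h2]
    exact hq.base.2.sqrt.inv₀ fun p => by
      rw [h1, Real.sqrt_sq (inv_nonneg.2 (hpos _ _).le)]
      exact inv_ne_zero (hpos _ _).ne'
  induction k with
  | zero => exact ⟨hb, hc⟩
  | succ k ih =>
    have hk := ih hq.of_succ
    obtain ⟨-, q₁, q₂, d₁, d₂, h₁, h₂⟩ := hq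
    have key : ∀ {q' : ℝ → ℝ → ℝ}, D.Joint k (2 * n) q' →
        D.Joint k (-n) fun ε s => (-1 / 2 : ℝ) * (h ε s ^ 3 * q' ε s) := fun {q'} hq' => by
      have := ((hk.mul (hk.mul hk)).mul hq').const_smul (-1 / 2 : ℝ)
      rw [show -n + (-n + -n) + 2 * n = -n by ring] at this
      convert this using 3 with ε s
      simp only [smul_eq_mul]
      ring
    exact ⟨⟨hb, hc⟩, _, _, fun ε s => hasDerivAt_of_sq_mul_eq_one (d₁ ε s) (fun e => hpos e s)
      (fun e => hqh e s), fun ε s => hasDerivAt_of_sq_mul_eq_one (d₂ ε s) (hpos ε) (hqh ε),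
      key h₁, key h₂⟩

theorem JointSmooth.inv_sqrt {q h : ℝ → ℝ → ℝ} (hq : D.JointSmooth (2 * n) q)
    (hpos : ∀ ε s, 0 < h ε s) (hqh : ∀ ε s, h ε s ^ 2 * q ε s = 1)
    (hb : D.PolyBdd (-n) h) : D.JointSmooth (-n) h := fun k => (hq k).inv_sqrt hpos hqh hb

/-- The reciprocal of a function bounded below is jointly smooth. -/
theorem JointSmooth.inv {q : ℝ → ℝ → ℝ} {a : ℝ} (hq : D.JointSmooth 0 q)
    (ha : 0 < a) (hqa : ∀ ε s, a ≤ q ε s) : D.JointSmooth 0 (fun ε s => (q ε s)⁻¹) := by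
  have hpos : ∀ ε s, 0 < q ε s := fun ε s => ha.trans_le (hqa ε s)
  have h2 : D.JointSmooth (2 * 0) (fun ε s => q ε s * q ε s) := fun k => by
    simpa using (hq k).mul (hq k)
  have := h2.inv_sqrt (h := fun ε s => (q ε s)⁻¹) (fun ε s => inv_pos.2 (hpos ε s))
    (fun ε s => by have := (hpos ε s).ne'; field_simp) ⟨a⁻¹, 0, fun ε _ s => by
      rw [Real.norm_of_nonneg (inv_pos.2 (hpos ε s)).le, neg_zero, zpow_zero, pow_zero, mul_one,
        mul_one]
      exact inv_anti₀ ha (hqa ε s)⟩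
  simpa using this

/-- One order of differentiability is lost, as continuity in the parameter is derived from
differentiability. -/
theorem Joint.halfInt {F : ℝ → ℝ → ℝ} (hD : D.J = Set.univ) (h : D.Joint (k + 1) 1 F) :
    D.Joint k 0 (fun ε => halfInt (F ε)) := by
  have hI : ∀ ε, ε ∈ D.I := fun ε => D.J_sub (hD ▸ Set.mem_univ ε)
  -- one derivative with respect to the parameter
  have step : ∀ {F F₁ : ℝ → ℝ → ℝ}, D.Joint 0 1 F → D.Joint 0 1 F₁ →
      (∀ ε s, HasDerivAt (fun e => F e s) (F₁ ε s) ε) →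
      D.Tame₀ 0 (fun ε => VortexFilament.halfInt (F ε))
        (fun ε => VortexFilament.halfInt (F₁ ε)) := fun hF hF₁ hd => by
    have h1 : D.Tame 0 1 _ _ := ⟨hF.1, hF₁.1, fun ε _ => continuous_slice hF.2 ε,
      fun ε _ => continuous_slice hF₁.2 ε, fun ε _ s => hd ε s⟩
    have h2 := h1.halfInt
    exact h2
  have hcont : ∀ {F F₁ : ℝ → ℝ → ℝ}, D.Joint 0 1 F → D.Joint 0 1 F₁ →
      (∀ ε s, HasDerivAt (fun e => F e s) (F₁ ε s) ε) →
      Continuous fun p : ℝ × ℝ => VortexFilament.halfInt (F p.1) p.2 := fun {F F₁} hF hF₁ hd => by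
    have h1 := step hF hF₁ hd
    have h2 : Continuous fun e => VortexFilament.halfInt (F e) 0 :=
      continuous_iff_continuousAt.2 fun e =>
        (h1.hasDerivAt e (hD ▸ Set.mem_univ e) 0).continuousAt
    have hi : ∀ e, Integrable (F e) ∧ Continuous (F e) := fun e => by
      have h1 : D.Tame₀ 1 _ _ := ⟨hF.1, hF₁.1, fun ε _ => continuous_slice hF.2 ε,
        fun ε _ => continuous_slice hF₁.2 ε, fun ε _ s => hd ε s⟩
      exact ⟨(h1.integrable (hI e)).1, h1.cont e (hI e)⟩
    have h3 : ∀ e s, VortexFilament.halfInt (F e) s =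
        VortexFilament.halfInt (F e) 0 + ∫ t in (0 : ℝ)..s, F e t := fun e s => by
      have := intervalIntegral.integral_eq_sub_of_hasDerivAt (a := 0) (b := s)
        (fun t _ => hasDerivAt_halfInt (hi e).1 (hi e).2 t) (hi e).1.intervalIntegrable
      rw [this]
      ring
    rw [show (fun p : ℝ × ℝ => VortexFilament.halfInt (F p.1) p.2) = fun p =>
      VortexFilament.halfInt (F p.1) 0 + ∫ t in (0 : ℝ)..p.2, F p.1 t from
      funext fun p => h3 p.1 p.2]
    exact (h2.comp continuous_fst).add
      (intervalIntegral.continuous_parametric_primitive_of_continuous (f := F) hF.2)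
  induction k generalizing F with
  | zero =>
    obtain ⟨h0, F₁, F₂, d₁, d₂, h₁, h₂⟩ := h
    exact ⟨(step h0 h₁ d₁).bdd, hcont h0 h₁ d₁⟩
  | succ k ih =>
    have h' := h.of_succ.of_succ
    obtain ⟨h0, F₁, F₂, d₁, d₂, h₁, h₂⟩ := h
    have hs := step h0 h₁.base d₁
    refine ⟨⟨hs.bdd, hcont h0 h₁.base d₁⟩, _, F,
      fun ε s => hs.hasDerivAt ε (hD ▸ Set.mem_univ ε) s, fun ε s => ?_, ih h₁, ?_⟩
    · have h1 : D.Tame₀ 1 _ _ := ⟨h0.1, h₁.base.1, fun ε _ => continuous_slice h0.2 ε,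
        fun ε _ => continuous_slice h₁.base.2 ε, fun ε _ s => d₁ ε s⟩
      exact hasDerivAt_halfInt (h1.integrable (hI ε)).1 (h1.cont ε (hI ε)) s
    · have := h'.lower
      rwa [sub_self] at this

theorem JointSmooth.halfInt {F : ℝ → ℝ → ℝ} (hD : D.J = Set.univ) (h : D.JointSmooth 1 F) :
    D.JointSmooth 0 (fun ε => halfInt (F ε)) := fun k => (h (k + 1)).halfInt hD

/-- Change of the variable `s`: the weight is transported along. -/
theorem Joint.comp {D' : Window} {u : ℝ → ℝ → ℝ} (hD : D.J = Set.univ)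
    (hw : ∀ ε s, D'.w ε s = D.w ε (u ε s)) (hF : D.Joint k n F) (hu : D'.Joint k 0 u) :
    D'.Joint k n (fun ε s => F ε (u ε s)) := by
  have hI : ∀ ε, ε ∈ D.I := fun ε => D.J_sub (hD ▸ Set.mem_univ ε)
  have base : ∀ {F : ℝ → ℝ → E}, (D.PolyBdd n F ∧ Continuous fun p : ℝ × ℝ => F p.1 p.2) →
      D'.PolyBdd n (fun ε s => F ε (u ε s)) ∧ Continuous fun p : ℝ × ℝ => F p.1 (u p.1 p.2) := by
    rintro F ⟨hb, hc⟩
    refine ⟨?_, hc.comp (continuous_fst.prodMk hu.base.2)⟩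
    obtain ⟨C, N, hC, hb⟩ := hb.exists_nonneg
    obtain ⟨C', N', hC', hb'⟩ := hu.base.1.exists_nonneg
    refine ⟨C * (1 + C') ^ N, N' * N, fun ε hε s => (hb ε (hI ε) _).trans ?_⟩
    have h1 := hb' ε hε s
    rw [zpow_zero, mul_one, Real.norm_eq_abs] at h1
    have h2 : (1 : ℝ) ≤ (1 + |s|) ^ N' := one_le_pow₀ (by linarith [abs_nonneg s])
    have h3 : 1 + |u ε s| ≤ (1 + C') * (1 + |s|) ^ N' := by linarith
    rw [← hw, pow_mul, mul_assoc C ((1 + C') ^ N), ← mul_pow]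
    have := zpow_pos (D'.pos ε hε s) n
    gcongr
  induction k generalizing F with
  | zero => exact base hF
  | succ k ih =>
    have h0 := base hF.base
    have hu' := hu.of_succ
    obtain ⟨-, F₁, F₂, d₁, d₂, h₁, h₂⟩ := hF
    obtain ⟨-, u₁, u₂, e₁, e₂, k₁, k₂⟩ := hu
    have hc₁ := h₁.base.2
    have hc₂ := h₂.base.2
    refine ⟨h0, fun ε s => F₁ ε (u ε s) + u₁ ε s • F₂ ε (u ε s), fun ε s => u₂ ε s • F₂ ε (u ε s),
      fun ε s => ?_, fun ε s => ?_, ?_, ?_⟩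
    · simpa using Joint.hasDerivAt_comp d₁ d₂ hc₁ hc₂ (hasDerivAt_id ε) (e₁ ε s)
    · simpa using Joint.hasDerivAt_comp d₁ d₂ hc₁ hc₂ (hasDerivAt_const s ε) (e₂ ε s)
    · exact (ih h₁ hu').add (by simpa using k₁.smul (ih h₂ hu'))
    · simpa using k₂.smul (ih h₂ hu')

theorem JointSmooth.comp {D' : Window} {u : ℝ → ℝ → ℝ} (hD : D.J = Set.univ)
    (hw : ∀ ε s, D'.w ε s = D.w ε (u ε s)) (hF : D.JointSmooth n F) (hu : D'.JointSmooth 0 u) :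
    D'.JointSmooth n (fun ε s => F ε (u ε s)) := fun k => (hF k).comp hD hw (hu k)

/-- Functions of `s` alone. -/
theorem JointSmooth.of_static {D' : Window} {f : ℝ → E} {G : ℝ → ℝ → E} {e₀ : ℝ} (he₀ : e₀ ∈ D'.I)
    (hw : ∀ ε s, D.w ε s = D'.w e₀ s) (h : D'.TameSmooth n (fun _ => f) G) :
    D.JointSmooth n (fun _ => f) := by
  have base : ∀ {f : ℝ → E} {G : ℝ → ℝ → E}, D'.TameSmooth n (fun _ => f) G →
      D.PolyBdd n (fun _ => f) ∧ Continuous fun p : ℝ × ℝ => f p.2 := fun h => by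
    obtain ⟨C, N, hC⟩ := (h 0).tame₀.bdd
    exact ⟨⟨C, N, fun ε _ s => by rw [hw]; exact hC e₀ he₀ s⟩,
      (h.contDiff he₀).continuous.comp continuous_snd⟩
  intro k
  induction k generalizing f G with
  | zero => exact base h
  | succ k ih =>
    refine ⟨base h, fun _ _ => 0, fun _ => _root_.deriv f, fun _ _ => hasDerivAt_const _ _,
      fun _ s => (h.hasDerivAt he₀ s).1, ?_, ih h.deriv⟩
    have := (Joint.const D k (0 : ℝ)).smul (ih h)
    simpa using this

end Window

/-! ### Reparametrization -/

namespace Window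

variable {D : Window}

/-- The window whose weight is transported by a bounded change of the variable. -/
def pullback (D : Window) (u : ℝ → ℝ → ℝ) (C : ℝ) (hu : ∀ ε s, |u ε s - s| ≤ C) : Window where
  I := D.I
  J := D.J
  w ε s := D.w ε (u ε s)
  isOpen_J := D.isOpen_J
  J_sub := D.J_sub
  pos ε hε s := D.pos ε hε (u ε s)
  rapid k := by
    obtain ⟨A, hA⟩ := D.rapid k
    refine ⟨A * (1 + C) ^ k, fun ε hε s => ?_⟩
    have hC : 0 ≤ C := (abs_nonneg _).trans (hu ε s)
    have h1 : 1 + |s| ≤ (1 + C) * (1 + |u ε s|) := by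
      have h2 : |s| ≤ |u ε s| + |u ε s - s| := by
        have := abs_sub_abs_le_abs_sub s (u ε s)
        rw [abs_sub_comm s] at this
        linarith
      nlinarith [hu ε s, abs_nonneg (u ε s)]
    have h3 := hA ε hε (u ε s)
    have h4 := D.pos ε hε (u ε s)
    calc D.w ε (u ε s) * (1 + |s|) ^ k ≤ D.w ε (u ε s) * ((1 + C) * (1 + |u ε s|)) ^ k := by gcongr
      _ = D.w ε (u ε s) * (1 + |u ε s|) ^ k * (1 + C) ^ k := by rw [mul_pow]; ring
      _ ≤ _ := by gcongr

/-- The inverse of a family `S ε` of diffeomorphisms of the line is differentiable. -/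
theorem hasDerivAt_inverse {S S₁ S₂ u : ℝ → ℝ → ℝ} {a : ℝ} (ha : 0 < a)
    (d₁ : ∀ ε s, HasDerivAt (fun e => S e s) (S₁ ε s) ε)
    (d₂ : ∀ ε s, HasDerivAt (S ε) (S₂ ε s) s) (h₁ : Continuous fun p : ℝ × ℝ => S₁ p.1 p.2)
    (h₂ : Continuous fun p : ℝ × ℝ => S₂ p.1 p.2) (hS₂ : ∀ ε s, a ≤ S₂ ε s)
    (hu : ∀ ε s, S ε (u ε s) = s) :
    (Continuous fun p : ℝ × ℝ => u p.1 p.2) ∧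
    (∀ ε s, HasDerivAt (fun e => u e s) (-(S₁ ε (u ε s) * (S₂ ε (u ε s))⁻¹)) ε) ∧
    (∀ ε s, HasDerivAt (u ε) (S₂ ε (u ε s))⁻¹ s) := by
  -- `S ε` expands distances at least by the factor `a`, which makes `u` continuous
  have hexp : ∀ ε x y, a * |x - y| ≤ |S ε x - S ε y| := by
    have key : ∀ ε x y, x ≤ y → a * (y - x) ≤ S ε y - S ε x := fun ε x y hxy => by
      have := Convex.mul_sub_le_image_sub_of_le_deriv (D := Set.univ) (f := S ε) (C := a)
        convex_univ (fun t _ => (d₂ ε t).continuousAt.continuousWithinAt)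
        (fun t _ => (d₂ ε t).differentiableAt.differentiableWithinAt)
        (fun t _ => by rw [(d₂ ε t).deriv]; exact hS₂ ε t) x trivial y trivial hxy
      exact this
    intro ε x y
    rcases le_total x y with h | h
    · rw [abs_sub_comm, abs_of_nonneg (sub_nonneg.2 h), abs_sub_comm (S ε x)]
      exact (key ε x y h).trans (le_abs_self _)
    · rw [abs_of_nonneg (sub_nonneg.2 h)]
      exact (key ε y x h).trans (le_abs_self _)
  have hcont : Continuous fun p : ℝ × ℝ => u p.1 p.2 := by
    refine continuous_iff_continuousAt.2 fun p => ?_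
    have hb : ∀ q : ℝ × ℝ, ‖u q.1 q.2 - u p.1 p.2‖ ≤ a⁻¹ * |q.2 - S q.1 (u p.1 p.2)| := fun q => by
      have := hexp q.1 (u q.1 q.2) (u p.1 p.2)
      rw [hu] at this
      rw [Real.norm_eq_abs, inv_mul_eq_div, le_div_iff₀ ha, mul_comm]
      exact this
    rw [ContinuousAt, tendsto_iff_norm_sub_tendsto_zero]
    refine squeeze_zero (fun _ => norm_nonneg _) hb ?_
    have hc : ContinuousAt (fun q : ℝ × ℝ => a⁻¹ * |q.2 - S q.1 (u p.1 p.2)|) p := by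
      have h3 : ContinuousAt (fun q : ℝ × ℝ => S q.1 (u p.1 p.2)) p :=
        ContinuousAt.comp (f := Prod.fst) (g := fun e => S e (u p.1 p.2))
          (d₁ p.1 (u p.1 p.2)).continuousAt continuousAt_fst
      exact continuousAt_const.mul ((continuousAt_snd.sub h3).abs)
    have h4 := hc.tendsto
    simp only [hu, sub_self, abs_zero, mul_zero] at h4
    exact h4
  -- `(ε, s) ↦ (ε, u ε s)` is the inverse of `(ε, x) ↦ (ε, S ε x)`, whose derivative is invertible
  have hfd : ∀ p : ℝ × ℝ, HasFDerivAt (fun p : ℝ × ℝ => u p.1 p.2)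
      ((S₂ p.1 (u p.1 p.2))⁻¹ • (ContinuousLinearMap.snd ℝ ℝ ℝ -
        S₁ p.1 (u p.1 p.2) • ContinuousLinearMap.fst ℝ ℝ ℝ)) p := fun p => by
    set x := u p.1 p.2 with hx
    have hne : S₂ p.1 x ≠ 0 := (ha.trans_le (hS₂ p.1 x)).ne'
    let f₁ : ℝ × ℝ →L[ℝ] ℝ × ℝ := (ContinuousLinearMap.fst ℝ ℝ ℝ).prod
      (S₁ p.1 x • ContinuousLinearMap.fst ℝ ℝ ℝ + S₂ p.1 x • ContinuousLinearMap.snd ℝ ℝ ℝ)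
    let f₂ : ℝ × ℝ →L[ℝ] ℝ × ℝ := (ContinuousLinearMap.fst ℝ ℝ ℝ).prod
      ((S₂ p.1 x)⁻¹ • (ContinuousLinearMap.snd ℝ ℝ ℝ - S₁ p.1 x • ContinuousLinearMap.fst ℝ ℝ ℝ))
    let e : (ℝ × ℝ) ≃L[ℝ] ℝ × ℝ := ContinuousLinearEquiv.equivOfInverse f₁ f₂
      (fun y => by ext <;> simp [f₁, f₂]; field_simp)
      (fun y => by ext <;> simp [f₁, f₂]; field_simp; ring)
    have hS := Joint.hasFDerivAt d₁ d₂ h₁ h₂ (p.1, x)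
    have hΨ : HasFDerivAt (fun q : ℝ × ℝ => (q.1, S q.1 q.2)) (e : ℝ × ℝ →L[ℝ] ℝ × ℝ)
        ((fun q : ℝ × ℝ => (q.1, u q.1 q.2)) p) := by
      refine (hasFDerivAt_fst.prodMk hS).congr_fderiv ?_
      refine ContinuousLinearMap.ext fun y => ?_
      simp [e, f₁, ContinuousLinearEquiv.equivOfInverse, mul_comm]
    have := HasFDerivAt.of_local_left_inverse (g := fun q : ℝ × ℝ => (q.1, u q.1 q.2))
      (continuous_fst.prodMk hcont).continuousAt hΨ (Eventually.of_forall fun q => by simp [hu])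
    have h5 := (ContinuousLinearMap.snd ℝ ℝ ℝ).hasFDerivAt.comp p this
    exact h5
  refine ⟨hcont, fun ε s => ?_, fun ε s => ?_⟩
  · have := (hfd (ε, s)).comp_hasDerivAt ε ((hasDerivAt_id ε).prodMk (hasDerivAt_const ε s))
    simp only [Function.comp_def] at this
    refine this.congr_deriv ?_
    simp [mul_comm]
  · have := (hfd (ε, s)).comp_hasDerivAt s ((hasDerivAt_const s ε).prodMk (hasDerivAt_id s))
    simp only [Function.comp_def] at this
    refine this.congr_deriv ?_
    simp

/-- The reparametrization by arclength of a family of curves with speed `1 + m`: the parameter `u`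
as a function of the arclength. -/
theorem exists_reparam {m : ℝ → ℝ → ℝ} {a : ℝ} (hD : D.J = Set.univ) (hm : D.JointSmooth 1 m)
    (ha : 0 < a) (hma : ∀ ε s, a ≤ 1 + m ε s) :
    ∃ (u : ℝ → ℝ → ℝ) (C : ℝ) (hu : ∀ ε s, |u ε s - s| ≤ C),
      (∀ ε s, u ε s + halfInt (m ε) (u ε s) = s) ∧
      (∀ ε x, u ε (x + halfInt (m ε) x) = x) ∧
      (∀ ε s, HasDerivAt (u ε) (1 + m ε (u ε s))⁻¹ s) ∧
      (∀ ε s, HasDerivAt (fun e => u e s) (-(halfInt (fun t => deriv (fun e => m e t) ε) (u ε s) *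
        (1 + m ε (u ε s))⁻¹)) ε) ∧
      (D.pullback u C hu).JointSmooth 0 u := by
  have hI : ∀ ε, ε ∈ D.I := fun ε => D.J_sub (hD ▸ Set.mem_univ ε)
  have hm₁ := hm.derivParam
  have hH := hm.halfInt hD
  have hH₁ := hm₁.halfInt hD
  have hint : ∀ ε, Integrable (m ε) := fun ε => by
    obtain ⟨C, hC⟩ := (hm 0).1.le_inv_one_add_sq
    exact (integrable_inv_one_add_sq.const_mul C).mono'
      (continuous_slice (hm 0).2 ε).aestronglyMeasurable (Eventually.of_forall (hC ε (hI ε)))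
  have hd₂ : ∀ ε s, HasDerivAt (halfInt (m ε)) (m ε s) s := fun ε s =>
    hasDerivAt_halfInt (hint ε) (continuous_slice (hm 0).2 ε) s
  have hd₁ : ∀ ε s, HasDerivAt (fun e => halfInt (m e) s)
      (halfInt (fun t => deriv (fun e => m e t) ε) s) ε := fun ε s => by
    obtain ⟨m₁, m₂, e₁, e₂, -, -⟩ := hm.exists_partials
    have h1 : D.Tame 0 1 m (fun ε t => deriv (fun e => m e t) ε) :=
      ⟨(hm 0).1, (hm₁ 0).1, fun ε _ => continuous_slice (hm 0).2 ε,
        fun ε _ => continuous_slice (F := fun ε t => deriv (fun e => m e t) ε) (hm₁ 0).2 ε, fun ε _ s => by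
          rw [(e₁ ε s).deriv]; exact e₁ ε s⟩
    exact Tame₀.hasDerivAt h1.halfInt ε (hD ▸ Set.mem_univ ε) s
  obtain ⟨C, hC⟩ : ∃ C, ∀ ε x, |halfInt (m ε) x| ≤ C := by
    obtain ⟨C, hC⟩ := (hm 0).1.le_inv_one_add_sq
    exact ⟨_, fun ε x => abs_halfInt_le (integrable_inv_one_add_sq.const_mul C) (hC ε (hI ε)) x⟩
  -- the arclength as a function of the original parameter
  set S : ℝ → ℝ → ℝ := fun ε x => x + halfInt (m ε) x with hS
  have dS₁ : ∀ ε s, HasDerivAt (fun e => S e s) (halfInt (fun t => deriv (fun e => m e t) ε) s) ε :=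
    fun ε s => (hd₁ ε s).const_add s
  have dS₂ : ∀ ε s, HasDerivAt (S ε) (1 + m ε s) s := fun ε s => (hasDerivAt_id s).add (hd₂ ε s)
  have hmono : ∀ ε, StrictMono (S ε) := fun ε => strictMono_of_deriv_pos fun s => by
    rw [(dS₂ ε s).deriv]
    exact ha.trans_le (hma ε s)
  have hsurj : ∀ ε s, ∃ x, S ε x = s := fun ε s => by
    have hc : Continuous (S ε) := continuous_iff_continuousAt.2 fun t => (dS₂ ε t).continuousAt
    have h1 : S ε (s - C) ≤ s := by
      have := (abs_le.1 (hC ε (s - C))).2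
      simp only [hS]; linarith
    have h2 : s ≤ S ε (s + C) := by
      have := (abs_le.1 (hC ε (s + C))).1
      simp only [hS]; linarith
    exact mem_range_of_exists_le_of_exists_ge hc ⟨_, h1⟩ ⟨_, h2⟩
  choose u hu using hsurj
  have huC : ∀ ε s, |u ε s - s| ≤ C := fun ε s => by
    have h1 := hu ε s
    have h2 := hC ε (u ε s)
    rw [show u ε s - s = -halfInt (m ε) (u ε s) by simp only [hS] at h1; linarith, abs_neg]
    exact h2
  have hm1 : D.JointSmooth 0 (fun ε s => 1 + m ε s) := fun k => by
    have := (hm k).lower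
    rw [sub_self] at this
    exact (Joint.const D k 1).add this
  obtain ⟨hc, du₁, du₂⟩ := hasDerivAt_inverse ha dS₁ dS₂ (hH₁ 0).2 (hm1 0).2 hma hu
  refine ⟨u, C, huC, hu, fun ε x => (hmono ε).injective (hu ε _), du₂, du₁, fun k => ?_⟩
  have h0 : (D.pullback u C huC).PolyBdd 0 u ∧ Continuous fun p : ℝ × ℝ => u p.1 p.2 := by
    refine ⟨⟨1 + C, 1, fun ε _ s => ?_⟩, hc⟩
    have h1 := huC ε s
    have h2 := abs_sub_abs_le_abs_sub (u ε s) s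
    have hC0 : 0 ≤ C := (abs_nonneg _).trans h1
    rw [pow_one, zpow_zero, mul_one, Real.norm_eq_abs]
    nlinarith [abs_nonneg s]
  -- the partial derivatives of `u` are jointly smooth functions evaluated at `u`, which permits
  -- induction on the order
  have hinv := hm1.inv ha hma
  induction k with
  | zero => exact h0
  | succ k ih =>
    have h1 : D.JointSmooth 0 (fun ε s => -(halfInt (fun t => deriv (fun e => m e t) ε) s *
        (1 + m ε s)⁻¹)) := fun k => by
      have := ((hH₁ k).mul (hinv k)).const_smul (-1)
      simpa using this
    exact ⟨h0, _, _, du₁, du₂, Joint.comp (D' := D.pullback u C huC) (u := u) hD (fun _ _ => rfl) (h1 k) ih,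
      Joint.comp (D' := D.pullback u C huC) (u := u) (F := fun ε s => (1 + m ε s)⁻¹) hD
        (fun _ _ => rfl) (hinv k) ih⟩

end Window

/-! ### Families of curves with jointly smooth tangent -/

theorem asympPolynomialLike_of_le {f : ℝ → ℝ} {C : ℝ} {N : ℕ}
    (h : ∀ s, |f s| ≤ C * (1 + |s|) ^ N) : AsympPolynomialLike f := by
  have hC : 0 ≤ C := by simpa using (abs_nonneg _).trans (h 0)
  refine ⟨(1 + Polynomial.X ^ 2) ^ (N + 1), ?_, ?_⟩
  · intro h0
    have := congrArg (Polynomial.eval 0) h0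
    simp at this
  have h1 : Tendsto (fun s : ℝ => C * 2 ^ N * ‖s‖⁻¹) (cocompact ℝ) (𝓝 (C * 2 ^ N * 0)) :=
    (tendsto_inv_atTop_zero.comp tendsto_norm_cocompact_atTop).const_mul _
  rw [mul_zero] at h1
  refine squeeze_zero_norm' ?_ h1
  have h0 : ∀ᶠ s : ℝ in cocompact ℝ, 1 < ‖s‖ :=
    tendsto_norm_cocompact_atTop.eventually_gt_atTop 1
  filter_upwards [h0] with s hs
  rw [Real.norm_eq_abs] at hs
  simp only [Polynomial.eval_pow, Polynomial.eval_add, Polynomial.eval_one, Polynomial.eval_X]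
  rw [norm_div, Real.norm_eq_abs, Real.norm_of_nonneg (by positivity), ← div_eq_mul_inv,
    Real.norm_eq_abs, div_le_div_iff₀ (by positivity) (by linarith)]
  have h2 : (1 + |s|) ≤ 2 * (1 + s ^ 2) := by nlinarith [sq_abs s]
  have h3 : |s| ≤ 1 + s ^ 2 := by nlinarith [sq_abs s]
  calc |f s| * |s| ≤ (C * (2 * (1 + s ^ 2)) ^ N) * (1 + s ^ 2) := by
        gcongr
        exact (h s).trans (by gcongr)
    _ = _ := by rw [mul_pow]; ring

/-- A family of curves `c ε`, for all real `ε`, with unit tangent `T`, `A = ∂ₛ T` comparable to the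
weight and `B = ∂_ε T` bounded by the weight. The constant in `le_accel` is immaterial. -/
structure JointFamily (D : Window) (c : ℝ → ℝ → E3) (T A B : ℝ → ℝ → E3) : Prop where
  univ : D.J = Set.univ
  curve : D.JointSmooth 0 c
  tangent : D.JointSmooth 0 T
  accel : D.JointSmooth 1 A
  speed : D.JointSmooth 1 B
  hasDerivAt_curve : ∀ ε s, HasDerivAt (c ε) (T ε s) s
  hasDerivAt_tangent : ∀ ε s, HasDerivAt (T ε) (A ε s) s
  hasDerivAt_param : ∀ ε s, HasDerivAt (fun e => T e s) (B ε s) ε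
  unit : ∀ ε s, ‖T ε s‖ = 1
  le_accel : ∀ ε s, D.w ε s ≤ 4 * ‖A ε s‖

namespace JointFamily

variable {D : Window} {c T A B : ℝ → ℝ → E3}

theorem mem_I (h : JointFamily D c T A B) (ε : ℝ) : ε ∈ D.I := D.J_sub (h.univ ▸ Set.mem_univ ε)

theorem tangent_eq (h : JointFamily D c T A B) (ε : ℝ) : VortexFilament.tangent (c ε) = T ε :=
  funext fun s => (h.hasDerivAt_curve ε s).deriv

theorem curvature_eq (h : JointFamily D c T A B) (ε s : ℝ) : curvature (c ε) s = ‖A ε s‖ := by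
  rw [curvature, h.tangent_eq, (h.hasDerivAt_tangent ε s).deriv]

theorem curvature_pos (h : JointFamily D c T A B) (ε s : ℝ) : 0 < curvature (c ε) s := by
  rw [h.curvature_eq]
  have := h.le_accel ε s
  have := D.pos ε (h.mem_I ε) s
  linarith

theorem joint_kappaInv (h : JointFamily D c T A B) :
    D.JointSmooth (-1) (fun ε s => (curvature (c ε) s)⁻¹) := by
  have h2 : D.JointSmooth (2 * 1) (fun ε s => (inner ℝ (A ε s) (A ε s) : ℝ)) := fun k =>
    (h.accel k).inner (h.accel k)
  refine h2.inv_sqrt (fun ε s => inv_pos.2 (h.curvature_pos ε s)) (fun ε s => ?_)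
    ⟨4, 0, fun ε hε s => ?_⟩
  · rw [real_inner_self_eq_norm_sq, ← h.curvature_eq]
    have := (h.curvature_pos ε s).ne'
    field_simp
  · have h1 := h.le_accel ε s
    have h3 := D.pos ε hε s
    have h4 := h.curvature_pos ε s
    rw [← h.curvature_eq] at h1
    rw [pow_zero, mul_one, zpow_neg_one, Real.norm_of_nonneg (inv_pos.2 h4).le,
      inv_le_comm₀ h4 (by positivity), mul_inv, inv_inv]
    linarith

theorem joint_kappa (h : JointFamily D c T A B) : D.JointSmooth 1 (fun ε => curvature (c ε)) := by
  intro k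
  have h2 := ((h.accel k).inner (h.accel k)).mul (h.joint_kappaInv k)
  rw [show (1 : ℤ) + 1 + -1 = 1 by norm_num] at h2
  convert h2 using 3 with ε s
  rw [real_inner_self_eq_norm_sq, ← h.curvature_eq]
  have := (h.curvature_pos ε s).ne'
  field_simp

theorem joint_normal (h : JointFamily D c T A B) : D.JointSmooth 0 (fun ε => normal (c ε)) := by
  intro k
  have h2 := (h.joint_kappaInv k).smul (h.accel k)
  rw [show (-1 : ℤ) + 1 = 0 by norm_num] at h2
  convert h2 using 3 with ε s
  rw [normal, h.tangent_eq, (h.hasDerivAt_tangent ε s).deriv]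

theorem joint_torsion (h : JointFamily D c T A B) : D.JointSmooth 0 (fun ε => torsion (c ε)) := by
  intro k
  have hB := (h.tangent k).cross (h.joint_normal k)
  have h2 := (h.joint_normal.deriv k).inner hB
  simp only [add_zero] at h2
  convert h2 using 3 with ε s
  rw [torsion, binormal, h.tangent_eq]

theorem polyBdd_curvature (h : JointFamily D c T A B) {F : ℝ → ℝ → ℝ} (hF : D.PolyBdd 1 F) :
    ∃ (C : ℝ) (N : ℕ), ∀ ε s, |F ε s| ≤ C * (1 + |s|) ^ N * curvature (c ε) s := by
  obtain ⟨C, N, hC, hF⟩ := hF.exists_nonneg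
  refine ⟨C * 4, N, fun ε s => (hF ε (h.mem_I ε) s).trans ?_⟩
  have h1 := h.le_accel ε s
  rw [← h.curvature_eq] at h1
  rw [zpow_one]
  calc C * (1 + |s|) ^ N * D.w ε s ≤ C * (1 + |s|) ^ N * (4 * curvature (c ε) s) := by gcongr
    _ = _ := by ring

theorem mem_bal (h : JointFamily D c T A B) {ε L : ℝ} (hL : IsBalancedWith γ₀ (c ε) L) :
    c ε ∈ BAL γ₀ := by
  refine ⟨⟨?_, fun s => ?_⟩, fun s => (h.curvature_pos ε s).ne', ⟨L, hL⟩, fun P => ?_,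
    fun n => ?_, fun n => ?_⟩
  · exact h.curve.contDiff.comp (contDiff_const.prodMk contDiff_id)
  · rw [(h.hasDerivAt_curve ε s).deriv, h.unit]
  · obtain ⟨C, hC, hP⟩ := abs_eval_le P
    have h1 : D.PolyBdd 0 (fun _ s => P.eval s) :=
      ⟨C, P.natDegree, fun ε _ s => by simpa using hP s⟩
    have h2 := (h.joint_kappa 0).1.bilin (ContinuousLinearMap.mul ℝ ℝ) h1
    rw [add_zero] at h2
    exact h2.tendsto_zero (h.mem_I ε)
  · have h2 := ((h.joint_kappaInv 0).mul (h.joint_kappa.iteratedDeriv n 0)).1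
    obtain ⟨C, N, h2⟩ := h2
    exact asympPolynomialLike_of_le (C := C) (N := N) fun s => by simpa using h2 ε (h.mem_I ε) s
  · obtain ⟨C, N, h2⟩ := (h.joint_torsion.iteratedDeriv n 0).1
    exact asympPolynomialLike_of_le (C := C) (N := N) fun s => by simpa using h2 ε (h.mem_I ε) s

theorem isVariation (h : JointFamily D c T A B) {γ : BAL γ₀} {V : ℝ → E3}
    (hbal : ∀ ε, c ε ∈ BAL γ₀) (h0 : c 0 = γ.1) (hV : ∀ s, HasDerivAt (fun ε => c ε s) (V s) 0) :
    IsVariation γ V (fun ε => ⟨c ε, hbal ε⟩) := by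
  refine ⟨Subtype.ext h0, hV, 1, one_pos, h.curve.contDiff.contDiffOn, fun k => ?_, fun k => ?_,
    fun k => ?_, fun k hk => ?_⟩
  · obtain ⟨C, hC⟩ := (h.joint_kappa 0).1.rapid k
    refine ⟨C, fun ε _ s => ?_⟩
    have := hC ε (h.mem_I ε) s
    rwa [Real.norm_of_nonneg (h.curvature_pos ε s).le] at this
  · obtain ⟨C, N, hC⟩ := h.polyBdd_curvature (h.joint_kappa.iteratedDeriv k 0).1
    exact ⟨C, N, fun ε _ s => hC ε s⟩
  · obtain ⟨C, N, hC⟩ := (h.joint_torsion.iteratedDeriv k 0).1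
    exact ⟨C, N, fun ε _ s => by simpa using hC ε (h.mem_I ε) s⟩
  · have key : D.PolyBdd 1 (fun ε s => deriv (fun e => iteratedDeriv k (c e) s) ε) := by
      obtain ⟨j, rfl⟩ : ∃ j, k = j + 1 := ⟨k - 1, by omega⟩
      have e1 : ∀ e, iteratedDeriv (j + 1) (c e) = iteratedDeriv j (T e) := fun e => by
        rw [iteratedDeriv_succ']
        congr 1
        exact h.tangent_eq e
      simp_rw [e1]
      cases j with
      | zero =>
        have e2 : (fun ε s => deriv (fun e => iteratedDeriv 0 (T e) s) ε) = B :=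
          funext fun ε => funext fun s => by
            simpa only [iteratedDeriv_zero] using (h.hasDerivAt_param ε s).deriv
        rw [e2]
        exact (h.speed 0).1
      | succ j =>
        have e2 : ∀ e, iteratedDeriv (j + 1) (T e) = iteratedDeriv j (A e) := fun e => by
          rw [iteratedDeriv_succ']
          congr 1
          exact funext fun s => (h.hasDerivAt_tangent e s).deriv
        simp_rw [e2]
        exact ((h.accel.iteratedDeriv j).derivParam 0).1
    have hn : D.PolyBdd 1 (fun ε s => ‖deriv (fun e => iteratedDeriv k (c e) s) ε‖) := by
      obtain ⟨C, N, hC⟩ := key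
      exact ⟨C, N, fun ε hε s => by rw [norm_norm]; exact hC ε hε s⟩
    obtain ⟨C, N, hC⟩ := h.polyBdd_curvature hn
    exact ⟨C, N, fun ε _ s => by simpa only [abs_norm] using hC ε s⟩

end JointFamily

/-! ### A cutoff in the parameter -/

namespace Window

variable {D : Window}

theorem Joint.sin_cos (D : Window) (k : ℕ) :
    D.Joint k 0 (fun ε _ => Real.sin ε) ∧ D.Joint k 0 (fun ε _ => Real.cos ε) := by
  have h1 : D.PolyBdd 0 (fun ε _ => Real.sin ε) ∧ Continuous fun p : ℝ × ℝ => Real.sin p.1 :=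
    ⟨⟨1, 0, fun ε _ s => by simpa using Real.abs_sin_le_one ε⟩, by fun_prop⟩
  have h2 : D.PolyBdd 0 (fun ε _ => Real.cos ε) ∧ Continuous fun p : ℝ × ℝ => Real.cos p.1 :=
    ⟨⟨1, 0, fun ε _ s => by simpa using Real.abs_cos_le_one ε⟩, by fun_prop⟩
  induction k with
  | zero => exact ⟨h1, h2⟩
  | succ k ih =>
    exact ⟨⟨h1, _, _, fun ε _ => Real.hasDerivAt_sin ε, fun _ _ => hasDerivAt_const _ _, ih.2,
        Joint.const D k 0⟩, h2, _, _, fun ε _ => Real.hasDerivAt_cos ε,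
        fun _ _ => hasDerivAt_const _ _, by simpa using ih.1.const_smul (-1), Joint.const D k 0⟩

theorem Joint.param (D : Window) (k : ℕ) : D.Joint k 0 (fun _ s => s) := by
  have h0 : D.PolyBdd 0 (fun _ s => s) ∧ Continuous fun p : ℝ × ℝ => p.2 :=
    ⟨⟨1, 1, fun ε _ s => by simp⟩, continuous_snd⟩
  cases k with
  | zero => exact h0
  | succ k =>
    exact ⟨h0, _, _, fun _ _ => hasDerivAt_const _ _, fun _ s => hasDerivAt_id s,
      Joint.const D k 0, Joint.const D k 1⟩

theorem Joint.pow {k : ℕ} {F : ℝ → ℝ → ℝ} (h : D.Joint k 0 F) (M : ℕ) :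
    D.Joint k 0 (fun ε s => F ε s ^ M) := by
  induction M with
  | zero => simpa using Joint.const D k (1 : ℝ)
  | succ M ih => simpa [pow_succ] using ih.mul h

/-- A smooth replacement of the parameter `ε`, tangent to it at `ε = 0`, which is small, together
with two derivatives in `s`, compared to a given negative power of `1 + |s|`, for all values of the
parameter. The function is `σ / (1 + σ² P²)` with `σ = sin ε` and a polynomial `P` of `s`. -/
theorem exists_cutoff (D : Window) (N : ℕ) {η : ℝ} (hη : 0 < η) : ∃ θ : ℝ → ℝ → ℝ,
    D.JointSmooth 0 θ ∧ (∀ s, θ 0 s = 0) ∧ (∀ s, HasDerivAt (fun e => θ e s) 1 0) ∧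
    ∀ ε s, |θ ε s| * (1 + |s|) ^ N ≤ η ∧ |deriv (θ ε) s| * (1 + |s|) ^ N ≤ η ∧
      |deriv (deriv (θ ε)) s| * (1 + |s|) ^ N ≤ η := by
  -- `k` bounds the factors by which `θ` is multiplied on differentiating it once or twice
  set M : ℝ := N + 1 with hM
  have hM0 : 0 < M := by positivity
  set k : ℝ := 1 + 4 * M + 8 * M ^ 2 with hk
  have hk0 : 1 ≤ k := by nlinarith
  set A : ℝ := 2 ^ N * k / η with hA
  have hA0 : 0 < A := by positivity
  set P : ℝ → ℝ := fun s => A * (1 + s ^ 2) ^ (N + 1) with hP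
  have hP0 : ∀ s, 0 < P s := fun s => by positivity
  -- `ρ = P' / P`
  set ρ : ℝ → ℝ := fun s => 2 * M * s / (1 + s ^ 2) with hρ
  set ρ' : ℝ → ℝ := fun s => 2 * M * (1 - s ^ 2) / (1 + s ^ 2) ^ 2 with hρ'
  set E : ℝ → ℝ → ℝ := fun ε s => (1 + (Real.sin ε * P s) ^ 2)⁻¹ with hE
  have hE0 : ∀ ε s, 0 < E ε s := fun ε s => by positivity
  have hE1 : ∀ ε s, E ε s ≤ 1 := fun ε s => inv_le_one_of_one_le₀ (by nlinarith [sq_nonneg (Real.sin ε * P s)])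
  set θ : ℝ → ℝ → ℝ := fun ε s => Real.sin ε * E ε s with hθ
  have dP : ∀ s, HasDerivAt P (P s * ρ s) s := fun s => by
    have := ((((hasDerivAt_id' s).pow 2).const_add 1).pow (N + 1)).const_mul A
    refine this.congr_deriv ?_
    simp only [hP, hρ, hM, Pi.pow_apply, Nat.add_sub_cancel]
    push_cast
    rw [pow_succ (1 + s ^ 2) N]
    field_simp
  have dρ : ∀ s, HasDerivAt ρ (ρ' s) s := fun s => by
    have hne : 1 + s ^ 2 ≠ 0 := by positivity
    have := ((hasDerivAt_id' s).const_mul (2 * M)).div (((hasDerivAt_id' s).pow 2).const_add 1) hne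
    refine this.congr_deriv ?_
    simp only [hρ', Pi.pow_apply]
    congr 1
    push_cast
    ring
  have dE : ∀ ε s, HasDerivAt (E ε) (-2 * ρ s * (1 - E ε s) * E ε s) s := fun ε s => by
    have hne : 1 + (Real.sin ε * P s) ^ 2 ≠ 0 := by positivity
    have := ((((dP s).const_mul (Real.sin ε)).pow 2).const_add 1).inv hne
    refine this.congr_deriv ?_
    simp only [hE, Pi.pow_apply]
    field_simp
    push_cast
    ring
  have dθ : ∀ ε s, HasDerivAt (θ ε) (-2 * ρ s * (1 - E ε s) * θ ε s) s := fun ε s =>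
    ((dE ε s).const_mul (Real.sin ε)).congr_deriv (by simp only [hθ]; ring)
  have dθ' : ∀ ε s, HasDerivAt (deriv (θ ε)) (θ ε s * (-2 * ρ' s * (1 - E ε s)
      - 4 * ρ s ^ 2 * ((1 - E ε s) * E ε s) + 4 * ρ s ^ 2 * (1 - E ε s) ^ 2)) s := fun ε s => by
    rw [show deriv (θ ε) = fun s => -2 * ρ s * (1 - E ε s) * θ ε s from
      funext fun s => (dθ ε s).deriv]
    refine ((((dρ s).const_mul (-2)).mul ((dE ε s).const_sub 1)).mul (dθ ε s)).congr_deriv ?_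
    simp only [Pi.mul_apply]
    ring
  have bρ : ∀ s, |ρ s| ≤ M := fun s => by
    simp only [hρ]
    rw [abs_div, abs_of_pos (by positivity : 0 < 1 + s ^ 2), div_le_iff₀ (by positivity), abs_mul,
      abs_of_pos (by positivity : 0 < 2 * M)]
    nlinarith [sq_nonneg (|s| - 1), sq_abs s]
  have bρ' : ∀ s, |ρ' s| ≤ 2 * M := fun s => by
    simp only [hρ']
    rw [abs_div, abs_of_pos (by positivity : 0 < (1 + s ^ 2) ^ 2), div_le_iff₀ (by positivity), abs_mul,
      abs_of_pos (by positivity : 0 < 2 * M)]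
    have : |1 - s ^ 2| ≤ (1 + s ^ 2) ^ 2 := abs_le.2 ⟨by nlinarith [sq_nonneg s], by nlinarith [sq_nonneg s]⟩
    gcongr
  have bθ : ∀ ε s, |θ ε s| * (1 + |s|) ^ N * k ≤ η := fun ε s => by
    -- as `|σ| P ≤ 1 + σ² P²`
    have h1 : |θ ε s| * P s ≤ 1 := by
      simp only [hθ, hE]
      rw [abs_mul, abs_of_pos (hE0 ε s), mul_right_comm, ← div_eq_mul_inv, div_le_one (by positivity),
        mul_pow, ← sq_abs (Real.sin ε)]
      nlinarith [sq_nonneg (|Real.sin ε| * P s - 1)]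
    have h2 : (1 + |s|) ≤ 2 * (1 + s ^ 2) := by nlinarith [sq_abs s, sq_nonneg (|s| - 1)]
    have h3 : (1 + |s|) ^ N * k ≤ η * P s := by
      have : η * P s = 2 ^ N * k * (1 + s ^ 2) ^ (N + 1) := by
        simp only [hP, hA]
        field_simp
      rw [this]
      calc (1 + |s|) ^ N * k ≤ (2 * (1 + s ^ 2)) ^ N * k := by gcongr
        _ = 2 ^ N * k * (1 + s ^ 2) ^ N := by rw [mul_pow]; ring
        _ ≤ 2 ^ N * k * (1 + s ^ 2) ^ (N + 1) := by
          gcongr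
          · nlinarith [sq_nonneg s]
          · omega
    calc |θ ε s| * (1 + |s|) ^ N * k = |θ ε s| * ((1 + |s|) ^ N * k) := by ring
      _ ≤ |θ ε s| * (η * P s) := by gcongr
      _ = η * (|θ ε s| * P s) := by ring
      _ ≤ η * 1 := by gcongr
      _ = η := mul_one η
  have hb : ∀ {x : ℝ} ε s, |x| ≤ k → |θ ε s * x| * (1 + |s|) ^ N ≤ η := fun {x} ε s hx => by
    rw [abs_mul]
    calc |θ ε s| * |x| * (1 + |s|) ^ N ≤ |θ ε s| * k * (1 + |s|) ^ N := by gcongr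
      _ = |θ ε s| * (1 + |s|) ^ N * k := by ring
      _ ≤ η := bθ ε s
  refine ⟨θ, ?_, fun s => by simp [hθ], fun s => ?_, fun ε s => ⟨?_, ?_, ?_⟩⟩
  · have hsin : D.JointSmooth 0 (fun ε _ => Real.sin ε) := fun k => (Joint.sin_cos D k).1
    have hPJ : D.JointSmooth 0 (fun _ s => P s) := fun k => by
      have := (((Joint.const D k (1 : ℝ)).add ((Joint.param D k).pow 2)).pow (N + 1)).const_smul A
      simpa using this
    have hq : D.JointSmooth 0 (fun ε s => 1 + (Real.sin ε * P s) ^ 2) := fun k =>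
      (Joint.const D k (1 : ℝ)).add (Joint.pow (by simpa using (hsin k).mul (hPJ k)) 2)
    have hEJ := hq.inv one_pos fun ε s => by nlinarith [sq_nonneg (Real.sin ε * P s)]
    exact fun k => by simpa using (hsin k).mul (hEJ k)
  · have h1 : HasDerivAt (fun e => E e s) 0 0 := by
      have hne : 1 + (Real.sin 0 * P s) ^ 2 ≠ 0 := by positivity
      have := ((((Real.hasDerivAt_sin 0).mul_const (P s)).pow 2).const_add 1).inv hne
      refine this.congr_deriv ?_
      simp
    refine ((Real.hasDerivAt_sin 0).mul h1).congr_deriv ?_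
    simp [hE]
  · simpa using hb (x := 1) ε s (by simpa using hk0)
  · rw [(dθ ε s).deriv, mul_comm _ (θ ε s)]
    refine hb ε s ?_
    have h1 : |1 - E ε s| ≤ 1 := abs_le.2 ⟨by linarith [hE1 ε s], by linarith [hE0 ε s]⟩
    rw [abs_mul, abs_mul, abs_neg, abs_two]
    have := mul_le_mul (bρ s) h1 (abs_nonneg _) hM0.le
    nlinarith
  · rw [(dθ' ε s).deriv]
    refine hb ε s ?_
    have h1 : |1 - E ε s| ≤ 1 := abs_le.2 ⟨by linarith [hE1 ε s], by linarith [hE0 ε s]⟩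
    have h2 : |E ε s| ≤ 1 := abs_le.2 ⟨by linarith [hE0 ε s], hE1 ε s⟩
    have h3 : ρ s ^ 2 ≤ M ^ 2 := sq_le_sq' (by linarith [(abs_le.1 (bρ s)).1]) (abs_le.1 (bρ s)).2
    have a1 : |-2 * ρ' s * (1 - E ε s)| ≤ 4 * M := by
      rw [abs_mul, abs_mul, abs_neg, abs_two]
      have := mul_le_mul (bρ' s) h1 (abs_nonneg _) (by positivity)
      nlinarith
    have a2 : |4 * ρ s ^ 2 * ((1 - E ε s) * E ε s)| ≤ 4 * M ^ 2 := by
      rw [abs_mul, abs_of_nonneg (by positivity : 0 ≤ 4 * ρ s ^ 2), abs_mul]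
      have := mul_le_mul h1 h2 (abs_nonneg _) zero_le_one
      have h4 : 4 * ρ s ^ 2 ≤ 4 * M ^ 2 := by linarith
      have := mul_le_mul h4 this (by positivity) (by positivity)
      linarith
    have a3 : |4 * ρ s ^ 2 * (1 - E ε s) ^ 2| ≤ 4 * M ^ 2 := by
      rw [abs_mul, abs_of_nonneg (by positivity : 0 ≤ 4 * ρ s ^ 2), abs_pow]
      have h5 : |1 - E ε s| ^ 2 ≤ 1 := pow_le_one₀ (abs_nonneg _) h1
      have h4 : 4 * ρ s ^ 2 ≤ 4 * M ^ 2 := by linarith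
      have := mul_le_mul h4 h5 (by positivity) (by positivity)
      linarith
    have := abs_add_le (-2 * ρ' s * (1 - E ε s) - 4 * ρ s ^ 2 * ((1 - E ε s) * E ε s))
      (4 * ρ s ^ 2 * (1 - E ε s) ^ 2)
    have := abs_sub (-2 * ρ' s * (1 - E ε s)) (4 * ρ s ^ 2 * ((1 - E ε s) * E ε s))
    linarith

end Window

/-! ### Existence of variations -/

/-- The curvature of a curve as a weight on functions of `(ε, s)`. -/
def weightWindow (γ : BAL γ₀) : Window where
  I := Set.univ
  J := Set.univ
  w _ s := curvature γ.1 s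
  isOpen_J := isOpen_univ
  J_sub := subset_rfl
  pos _ _ s := (BAL.frenet γ).curvature_pos s
  rapid k := by
    obtain ⟨C, hC⟩ := (RegularFamily.const γ).rapid k
    exact ⟨C, fun ε _ s => hC 0 ⟨by norm_num, by norm_num⟩ s⟩

section

open Window

variable {E : Type} [NormedAddCommGroup E] [NormedSpace ℝ E]

theorem jointSmooth_static {γ : BAL γ₀} {n : ℤ} {f : ℝ → E} {G : ℝ → ℝ → E}
    (h : (curveWindow γ).TameSmooth n (fun _ => f) G) :
    (weightWindow γ).JointSmooth n (fun _ => f) :=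
  JointSmooth.of_static (zero_mem_curveWindow γ) (fun _ _ => rfl) h

theorem jointSmooth_of_mem {γ : BAL γ₀} {n : ℤ} {f : ScalarField γ₀} (hf : f ∈ algSpace γ₀ n) :
    (weightWindow γ).JointSmooth n (fun _ => f γ) :=
  jointSmooth_static (tameSmooth_of_mem hf γ)

theorem jointSmooth_frame (γ : BAL γ₀) :
    (weightWindow γ).JointSmooth 0 (fun _ => tangent γ.1) ∧
    (weightWindow γ).JointSmooth 0 (fun _ => normal γ.1) ∧
    (weightWindow γ).JointSmooth 0 (fun _ => binormal γ.1) := by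
  obtain ⟨_, hN⟩ := (RegularFamily.const γ).tame_normal
  obtain ⟨_, hB⟩ := (RegularFamily.const γ).tame_binormal
  exact ⟨jointSmooth_static (RegularFamily.const γ).tame_tangent, jointSmooth_static hN,
    jointSmooth_static hB⟩

/-- The curve grows linearly, so it is of degree `0`. -/
theorem jointSmooth_curve (γ : BAL γ₀) : (weightWindow γ).JointSmooth 0 (fun _ => γ.1) := by
  have hlip : ∀ s, ‖γ.1 s‖ ≤ ‖γ.1 0‖ + |s| := fun s => by
    have := Convex.norm_image_sub_le_of_norm_deriv_le (f := γ.1) (C := 1) (s := Set.univ)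
      (fun t _ => ((BAL.frenet γ).hasDerivAt_curve t).differentiableAt)
      (fun t _ => ((BAL.frenet γ).norm_tangent t).le) convex_univ (Set.mem_univ 0) (Set.mem_univ s)
    rw [one_mul, sub_zero, Real.norm_eq_abs] at this
    linarith [norm_le_norm_add_norm_sub' (γ.1 s) (γ.1 0)]
  have h0 : (weightWindow γ).PolyBdd 0 (fun _ => γ.1) ∧ Continuous fun p : ℝ × ℝ => γ.1 p.2 := by
    refine ⟨⟨1 + ‖γ.1 0‖, 1, fun ε _ s => (hlip s).trans ?_⟩,
      (BAL.frenet γ).smooth.continuous.comp continuous_snd⟩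
    rw [pow_one, zpow_zero, mul_one]
    nlinarith [norm_nonneg (γ.1 0), abs_nonneg s, mul_nonneg (norm_nonneg (γ.1 0)) (abs_nonneg s)]
  intro k
  cases k with
  | zero => exact h0
  | succ k =>
    exact ⟨h0, fun _ _ => 0, fun _ => tangent γ.1, fun _ _ => hasDerivAt_const _ _,
      fun _ s => (BAL.frenet γ).hasDerivAt_curve s, Joint.const _ k 0, (jointSmooth_frame γ).1 k⟩

/-- A common bound for three functions of degree `1`. -/
theorem PolyBdd.le_common {D : Window} {e₀ : ℝ} (he₀ : e₀ ∈ D.I) {F₁ F₂ F₃ : ℝ → ℝ → E}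
    (h₁ : D.PolyBdd 1 F₁) (h₂ : D.PolyBdd 1 F₂) (h₃ : D.PolyBdd 1 F₃) :
    ∃ (C : ℝ) (N : ℕ), 1 ≤ C ∧ ∀ s, ‖F₁ e₀ s‖ ≤ C * (1 + |s|) ^ N * D.w e₀ s ∧
      ‖F₂ e₀ s‖ ≤ C * (1 + |s|) ^ N * D.w e₀ s ∧ ‖F₃ e₀ s‖ ≤ C * (1 + |s|) ^ N * D.w e₀ s := by
  obtain ⟨C₁, N₁, hC₁, h₁⟩ := h₁.exists_nonneg
  obtain ⟨C₂, N₂, hC₂, h₂⟩ := h₂.exists_nonneg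
  obtain ⟨C₃, N₃, hC₃, h₃⟩ := h₃.exists_nonneg
  have key : ∀ {x C : ℝ} {N : ℕ} (s : ℝ), 0 ≤ C → x ≤ C * (1 + |s|) ^ N * D.w e₀ s ^ (1 : ℤ) →
      C ≤ 1 + C₁ + C₂ + C₃ → N ≤ N₁ + N₂ + N₃ →
      x ≤ (1 + C₁ + C₂ + C₃) * (1 + |s|) ^ (N₁ + N₂ + N₃) * D.w e₀ s := fun {x C N} s h0 hx hC hN => by
    refine hx.trans ?_
    rw [zpow_one]
    have := D.pos e₀ he₀ s
    have h1 : (1 + |s|) ^ N ≤ (1 + |s|) ^ (N₁ + N₂ + N₃) :=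
      pow_le_pow_right₀ (by linarith [abs_nonneg s]) hN
    gcongr
  exact ⟨1 + C₁ + C₂ + C₃, N₁ + N₂ + N₃, by linarith, fun s =>
    ⟨key s hC₁ (h₁ e₀ he₀ s) (by linarith) (by omega),
      key s hC₂ (h₂ e₀ he₀ s) (by linarith) (by omega),
      key s hC₃ (h₃ e₀ he₀ s) (by linarith) (by omega)⟩⟩

/-- Small perturbations of the velocity and acceleration of a unit speed curve do not destroy its
curvature. -/
theorem norm_cross_perturb {t n z z' : E3} {κ : ℝ} (ht : ‖t‖ = 1) (hn : ‖n‖ = 1)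
    (htn : ‖cross t n‖ = 1) (hκ : 0 < κ) (hz : ‖z‖ ≤ 1 / 8) (hz' : ‖z'‖ ≤ κ / 8) :
    κ / 2 ≤ ‖cross (t + z) (κ • n + z')‖ := by
  have h1 : cross (t + z) (κ • n + z') =
      κ • cross t n + (cross t z' + κ • cross z n + cross z z') := by
    rw [cross_add_left, cross_add_right, cross_add_right, cross_smul_right, cross_smul_right]
    module
  have h2 : ‖cross t z' + κ • cross z n + cross z z'‖ ≤ κ / 8 + κ * (1 / 8) + 1 / 8 * (κ / 8) := by
    refine (norm_add₃_le).trans ?_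
    have a1 := norm_cross_le t z'
    have a2 := norm_cross_le z n
    have a3 := norm_cross_le z z'
    rw [norm_smul, Real.norm_of_nonneg hκ.le]
    rw [ht, one_mul] at a1
    rw [hn, mul_one] at a2
    have a4 : ‖z‖ * ‖z'‖ ≤ 1 / 8 * (κ / 8) := by gcongr
    have a5 : κ * ‖cross z n‖ ≤ κ * (1 / 8) := by gcongr; exact a2.trans hz
    linarith
  have h3 : ‖κ • cross t n‖ = κ := by rw [norm_smul, htn, mul_one, Real.norm_of_nonneg hκ.le]
  have h4 := norm_sub_le_norm_add (κ • cross t n) (cross t z' + κ • cross z n + cross z z')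
  rw [h1]
  linarith

end

section

open Window

/-- The speed of a perturbed curve, minus one. -/
theorem exists_speed {γ : BAL γ₀} {Z : ℝ → ℝ → E3} (hZ : (weightWindow γ).JointSmooth 1 Z)
    (hZb : ∀ ε s, ‖Z ε s‖ ≤ 1 / 8) : ∃ m : ℝ → ℝ → ℝ, (weightWindow γ).JointSmooth 1 m ∧
      (∀ ε s, 1 + m ε s = ‖tangent γ.1 s + Z ε s‖) ∧ (∀ ε s, |m ε s| ≤ 1 / 8) := by
  have hT := (jointSmooth_frame γ).1
  have hnT := (BAL.frenet γ).norm_tangent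
  have hm : ∀ ε s, |‖tangent γ.1 s + Z ε s‖ - 1| ≤ 1 / 8 := fun ε s => by
    have h1 := abs_norm_sub_norm_le (tangent γ.1 s + Z ε s) (tangent γ.1 s)
    rw [hnT, add_sub_cancel_left] at h1
    exact h1.trans (hZb ε s)
  have hpos : ∀ ε s, 7 / 8 ≤ ‖tangent γ.1 s + Z ε s‖ := fun ε s => by
    linarith [(abs_le.1 (hm ε s)).1]
  have hZ0 : (weightWindow γ).JointSmooth 0 Z := fun k => by
    have := (hZ k).lower
    rwa [sub_self] at this
  have hV : (weightWindow γ).JointSmooth 0 (fun ε s => tangent γ.1 s + Z ε s) := fun k =>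
    (hT k).add (hZ0 k)
  have hq : (weightWindow γ).JointSmooth (2 * 0)
      (fun ε s => (inner ℝ (tangent γ.1 s + Z ε s) (tangent γ.1 s + Z ε s) : ℝ)) := fun k => by
    simpa only [add_zero, mul_zero] using (hV k).inner (hV k)
  have hinv := hq.inv_sqrt (h := fun ε s => ‖tangent γ.1 s + Z ε s‖⁻¹)
    (fun ε s => inv_pos.2 (by linarith [hpos ε s]))
    (fun ε s => by
      have := hpos ε s
      have h0 : ‖tangent γ.1 s + Z ε s‖ ≠ 0 := by linarith
      rw [real_inner_self_eq_norm_sq]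
      field_simp)
    ⟨(7 / 8)⁻¹, 0, fun ε _ s => by
      have := hpos ε s
      rw [Real.norm_of_nonneg (inv_nonneg.2 (norm_nonneg _)), neg_zero, zpow_zero, pow_zero,
        mul_one, mul_one]
      exact inv_anti₀ (by norm_num) (hpos ε s)⟩
  rw [neg_zero] at hinv
  have hw : (weightWindow γ).JointSmooth 0 (fun ε s => 1 + ‖tangent γ.1 s + Z ε s‖) := fun k => by
    have := (hq k).mul (hinv k)
    rw [mul_zero, add_zero] at this
    refine (Joint.const _ k 1).add ?_
    convert this using 3 with ε s
    have := hpos ε s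
    have h0 : ‖tangent γ.1 s + Z ε s‖ ≠ 0 := by linarith
    rw [real_inner_self_eq_norm_sq]
    field_simp
  have hwi := hw.inv one_pos fun ε s => by linarith [hpos ε s]
  refine ⟨fun ε s => ‖tangent γ.1 s + Z ε s‖ - 1, fun k => ?_, fun ε s => by ring, hm⟩
  -- `m = (2 ⟨T, Z⟩ + |Z|²) / (1 + |T + Z|)` exhibits `m` as a quantity of degree `1`
  have h1 := (((hT k).inner (hZ k)).const_smul 2).add
    (by simpa only [zero_add] using (hZ0 k).inner (hZ k))
  have h2 := h1.mul (hwi k)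
  rw [zero_add, add_zero] at h2
  convert h2 using 3 with ε s
  have h0 : 1 + ‖tangent γ.1 s + Z ε s‖ ≠ 0 := by linarith [hpos ε s]
  rw [eq_mul_inv_iff_mul_eq₀ h0]
  have h3 : (‖tangent γ.1 s + Z ε s‖ - 1) * (1 + ‖tangent γ.1 s + Z ε s‖) =
      ‖tangent γ.1 s + Z ε s‖ ^ 2 - ‖tangent γ.1 s‖ ^ 2 := by rw [hnT]; ring
  rw [h3, norm_add_sq_real, real_inner_self_eq_norm_sq, smul_eq_mul]
  ring

/-- Passing to the arclength parameter of a curve with speed `1 + m` shifts the ends by `± (1/2) ∫ m`,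
and a perturbation vanishing at the ends has no influence. -/
theorem isBalancedWith_reparam {γ : BAL γ₀} {L : ℝ} (hL : IsBalancedWith γ₀ γ.1 L) {m u : ℝ → ℝ}
    {Γ : ℝ → E3} {C : ℝ} (hm : Integrable m) (hu : ∀ s, |u s - s| ≤ C)
    (hS : ∀ s, u s + halfInt m (u s) = s)
    (hΓ : Tendsto (fun x => Γ x - γ.1 x) (cocompact ℝ) (𝓝 0)) :
    IsBalancedWith γ₀ (fun s => Γ (u s)) (L + (1 / 2 : ℝ) * ∫ t, m t) := by
  have hlip : ∀ x y, ‖γ.1 x - γ.1 y‖ ≤ |x - y| := fun x y => by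
    have := Convex.norm_image_sub_le_of_norm_deriv_le (f := γ.1) (C := 1) (s := Set.univ)
      (fun t _ => ((BAL.frenet γ).hasDerivAt_curve t).differentiableAt)
      (fun t _ => ((BAL.frenet γ).norm_tangent t).le) convex_univ (Set.mem_univ y) (Set.mem_univ x)
    rwa [one_mul, Real.norm_eq_abs] at this
  -- the behaviour at one end, `b` being the limit of the reparametrization
  have key : ∀ {l : Filter ℝ} {b d e : ℝ}, Tendsto (fun s => u (s + e)) l (cocompact ℝ) →
      Tendsto (fun s => halfInt m (u (s + e))) l (𝓝 b) → e = d + b →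
      Tendsto (fun s => γ.1 (s + d) - γ₀ s) l (𝓝 0) →
      Tendsto (fun s => Γ (u (s + e)) - γ₀ s) l (𝓝 0) := fun {l b d e} h1 h2 h3 h4 => by
    have h5 := hΓ.comp h1
    have h6 : Tendsto (fun s => γ.1 (u (s + e)) - γ.1 (s + d)) l (𝓝 0) := by
      have h7 : Tendsto (fun s => |b - halfInt m (u (s + e))|) l (𝓝 0) := by
        have := (h2.const_sub b).abs
        rwa [sub_self, abs_zero] at this
      refine squeeze_zero_norm (fun s => (hlip _ _).trans (le_of_eq ?_)) h7
      congr 1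
      have := hS (s + e)
      linarith
    have := (h5.add h6).add h4
    simp only [add_zero] at this
    refine this.congr fun s => ?_
    simp only [Function.comp]
    abel
  have htop : Tendsto u atTop atTop := by
    refine tendsto_atTop_mono (fun s => ?_) (tendsto_atTop_add_const_right _ (-C) tendsto_id)
    linarith [(abs_le.1 (hu s)).1, id_eq s]
  have hbot : Tendsto u atBot atBot := by
    refine tendsto_atBot_mono (fun s => ?_) (tendsto_atBot_add_const_right _ C tendsto_id)
    linarith [(abs_le.1 (hu s)).2, id_eq s]
  constructor
  · have h1 := htop.comp (tendsto_atTop_add_const_right _ (L + (1 / 2 : ℝ) * ∫ t, m t) tendsto_id)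
    refine key (h1.mono_right ?_) ((tendsto_halfInt_atTop hm).comp h1) rfl hL.1
    rw [cocompact_eq_atBot_atTop]
    exact le_sup_right
  · have h1 := hbot.comp (tendsto_atBot_add_const_right _ (-(L + (1 / 2 : ℝ) * ∫ t, m t)) tendsto_id)
    have h2 := key (d := -L) (h1.mono_right (by rw [cocompact_eq_atBot_atTop]; exact le_sup_left))
      ((tendsto_halfInt_atBot hm).comp h1) (by ring) (by simpa [sub_eq_add_neg] using hL.2)
    simpa [sub_eq_add_neg] using h2

/-- The reparametrization by arclength of a small perturbation of a curve in `BAL`. -/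
theorem exists_jointFamily {γ : BAL γ₀} {Γ Z Z' : ℝ → ℝ → E3}
    (hΓ : (weightWindow γ).JointSmooth 0 Γ) (hZ : (weightWindow γ).JointSmooth 1 Z)
    (dΓ : ∀ ε s, HasDerivAt (Γ ε) (tangent γ.1 s + Z ε s) s)
    (dZ : ∀ ε s, HasDerivAt (Z ε) (Z' ε s) s) (hZb : ∀ ε s, ‖Z ε s‖ ≤ 1 / 8)
    (hZb' : ∀ ε s, ‖Z' ε s‖ ≤ curvature γ.1 s / 8) {m : ℝ → ℝ → ℝ}
    (hm : (weightWindow γ).JointSmooth 1 m)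
    (hm1 : ∀ ε s, 1 + m ε s = ‖tangent γ.1 s + Z ε s‖) (hmb : ∀ ε s, |m ε s| ≤ 1 / 8)
    {u : ℝ → ℝ → ℝ} {C : ℝ} {hu : ∀ ε s, |u ε s - s| ≤ C}
    (du : ∀ ε s, HasDerivAt (u ε) (1 + m ε (u ε s))⁻¹ s)
    (hujs : ((weightWindow γ).pullback u C hu).JointSmooth 0 u) :
    ∃ T A B, JointFamily ((weightWindow γ).pullback u C hu) (fun ε s => Γ ε (u ε s)) T A B := by
  have hF := BAL.frenet γ
  have hT := (jointSmooth_frame γ).1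
  have lower : ∀ {F : ℝ → ℝ → ℝ}, (weightWindow γ).JointSmooth 1 F →
      (weightWindow γ).JointSmooth 0 F := fun h k => by
    have := (h k).lower
    rwa [sub_self] at this
  have hpos : ∀ ε s, 7 / 8 ≤ 1 + m ε s := fun ε s => by linarith [(abs_le.1 (hmb ε s)).1]
  have hw : (weightWindow γ).JointSmooth 0 (fun ε s => 1 + m ε s) := fun k =>
    (Joint.const _ k 1).add (lower hm k)
  have hwi := hw.inv (by norm_num) hpos
  set wi : ℝ → ℝ → ℝ := fun ε s => (1 + m ε s)⁻¹ with hwi_def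
  -- the unit tangent differs from the original one by the degree-one quantity `Q`
  set Q : ℝ → ℝ → E3 := fun ε s => (-1 : ℝ) • ((m ε s * wi ε s) • tangent γ.1 s) +
    wi ε s • Z ε s with hQ_def
  have hQ : (weightWindow γ).JointSmooth 1 Q := fun k => by
    have h1 := (((hm k).mul (hwi k)).smul (hT k)).const_smul (-1)
    have h2 := (hwi k).smul (hZ k)
    simp only [add_zero, zero_add] at h1 h2
    exact h1.add h2
  have hQT : ∀ ε s, tangent γ.1 s + Q ε s = wi ε s • (tangent γ.1 s + Z ε s) := fun ε s => by
    have h0 : 1 + m ε s ≠ 0 := by linarith [hpos ε s]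
    have h1 : m ε s * wi ε s = 1 - wi ε s := by
      simp only [hwi_def]
      field_simp
      ring
    simp only [hQ_def]
    rw [h1]
    module
  obtain ⟨Q₁, Q₂, dQ₁, dQ₂, hQ₁, hQ₂⟩ := hQ.exists_partials
  obtain ⟨wi₁, wi₂, dwi₁, dwi₂, hwi₁, hwi₂⟩ := hwi.exists_partials
  have hκN : (weightWindow γ).JointSmooth 1 (fun _ s => curvature γ.1 s • normal γ.1 s) := fun k => by
    have := (jointSmooth_of_mem Alg.kappa k).smul ((jointSmooth_frame γ).2.1 k)
    rwa [add_zero] at this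
  -- the unit tangent before reparametrization
  set U : ℝ → ℝ → E3 := fun ε s => tangent γ.1 s + Q ε s with hU_def
  set U₂ : ℝ → ℝ → E3 := fun ε s => curvature γ.1 s • normal γ.1 s + Q₂ ε s with hU₂_def
  have hU : (weightWindow γ).JointSmooth 0 U := fun k => by
    have := (hQ k).lower
    rw [sub_self] at this
    exact (hT k).add this
  have hU₂ : (weightWindow γ).JointSmooth 1 U₂ := fun k => (hκN k).add (hQ₂ k)
  have dU₁ : ∀ ε s, HasDerivAt (fun e => U e s) (Q₁ ε s) ε := fun ε s => (dQ₁ ε s).const_add _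
  have dU₂ : ∀ ε s, HasDerivAt (U ε) (U₂ ε s) s := fun ε s =>
    (hF.hasDerivAt_tangent s).add (dQ₂ ε s)
  have hcomp : ∀ {E : Type} [NormedAddCommGroup E] [NormedSpace ℝ E] {n : ℤ} {F : ℝ → ℝ → E},
      (weightWindow γ).JointSmooth n F →
      ((weightWindow γ).pullback u C hu).JointSmooth n (fun ε s => F ε (u ε s)) := fun hF =>
    JointSmooth.comp (D' := (weightWindow γ).pullback u C hu) (u := u) rfl (fun _ _ => rfl) hF hujs
  obtain ⟨u₁, u₂, du₁, du₂, hu₁, hu₂⟩ := hujs.exists_partials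
  have hU₂c := hcomp hU₂
  have hwic := hcomp hwi
  refine ⟨fun ε s => U ε (u ε s), fun ε s => wi ε (u ε s) • U₂ ε (u ε s),
    fun ε s => Q₁ ε (u ε s) + u₁ ε s • U₂ ε (u ε s), rfl, hcomp hΓ, hcomp hU, fun k => ?_,
    fun k => ?_, fun ε s => ?_, fun ε s => ?_, fun ε s => ?_, fun ε s => ?_, fun ε s => ?_⟩
  · simpa only [zero_add] using (hwic k).smul (hU₂c k)
  · exact (hcomp hQ₁ k).add (by simpa only [zero_add] using (hu₁ k).smul (hU₂c k))
  · simp only [hU_def, hQT]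
    exact (dΓ ε (u ε s)).scomp s (du ε s)
  · exact (dU₂ ε (u ε s)).scomp s (du ε s)
  · have := Joint.hasDerivAt_comp dU₁ dU₂ (hQ₁ 0).2 (hU₂ 0).2 (hasDerivAt_id ε) (du₁ ε s)
    simpa using this
  · simp only [hU_def, hQT]
    rw [norm_smul, Real.norm_of_nonneg (inv_nonneg.2 (by linarith [hpos ε (u ε s)])), ← hm1,
      inv_mul_cancel₀ (by linarith [hpos ε (u ε s)])]
  · -- lower bound for the curvature
    set x := u ε s with hx
    have hκ := hF.curvature_pos x
    have e1 : U₂ ε x = wi ε x • (curvature γ.1 x • normal γ.1 x + Z' ε x) +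
        wi₂ ε x • (tangent γ.1 x + Z ε x) := by
      have h1 : U ε = fun s => wi ε s • (tangent γ.1 s + Z ε s) := funext fun s => hQT ε s
      have h2 := (dwi₂ ε x).smul ((hF.hasDerivAt_tangent x).add (dZ ε x))
      have h3 := dU₂ ε x
      rw [h1] at h3
      exact h3.unique h2
    have e2 : cross (U ε x) (U₂ ε x) = (wi ε x * wi ε x) •
        cross (tangent γ.1 x + Z ε x) (curvature γ.1 x • normal γ.1 x + Z' ε x) := by
      rw [e1]
      simp only [hU_def, hQT]
      rw [cross_add_right, cross_smul_left, cross_smul_left, cross_smul_right, cross_smul_right,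
        cross_self]
      module
    have e3 : ‖U ε x‖ = 1 := by
      simp only [hU_def, hQT]
      rw [norm_smul, Real.norm_of_nonneg (inv_nonneg.2 (by linarith [hpos ε x])), ← hm1,
        inv_mul_cancel₀ (by linarith [hpos ε x])]
    have hTN : ‖cross (tangent γ.1 x) (normal γ.1 x)‖ = 1 := hF.norm_binormal x
    have e4 := norm_cross_perturb (hF.norm_tangent x) (hF.norm_normal x) hTN hκ (hZb ε x) (hZb' ε x)
    have e5 := norm_cross_le (U ε x) (U₂ ε x)
    have hwi0 : 8 / 9 ≤ wi ε x := by
      simp only [hwi_def]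
      rw [show (8 / 9 : ℝ) = (9 / 8)⁻¹ by norm_num]
      exact inv_anti₀ (by linarith [hpos ε x]) (by linarith [(abs_le.1 (hmb ε x)).2])
    rw [e2, e3, one_mul, norm_smul, Real.norm_of_nonneg (mul_self_nonneg _)] at e5
    rw [norm_smul, Real.norm_of_nonneg (by linarith)]
    change curvature γ.1 x ≤ _
    have e6 : 8 / 9 * (8 / 9) ≤ wi ε x * wi ε x := by nlinarith
    have e7 : 8 / 9 * (8 / 9) * (curvature γ.1 x / 2) ≤ ‖U₂ ε x‖ := le_trans (by gcongr) e5
    nlinarith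

end

section

open Window

/-- The tangential component of the derivative of a normal field. -/
theorem inner_tangent_deriv {X : NB γ₀} (γ : BAL γ₀) {V V' : ℝ → E3}
    (hV : V = fun s => X.1 γ s • normal γ.1 s + X.2 γ s • binormal γ.1 s)
    (hd : ∀ s, HasDerivAt V (V' s) s) (s : ℝ) :
    inner ℝ (tangent γ.1 s) (V s) = (0 : ℝ) ∧
    inner ℝ (tangent γ.1 s) (V' s) = -(curvature γ.1 s * X.1 γ s) := by
  have hF := BAL.frenet γ
  have h1 : ∀ s, inner ℝ (tangent γ.1 s) (V s) = (0 : ℝ) := fun s => by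
    rw [hV]
    simp [inner_add_right, inner_smul_right, hF.inner_TN, hF.inner_TB]
  refine ⟨h1 s, ?_⟩
  have h2 := (hF.hasDerivAt_tangent s).inner ℝ (hd s)
  rw [funext h1] at h2
  have h3 := h2.unique (hasDerivAt_const s (0 : ℝ))
  rw [inner_smul_left, hV] at h3
  simp only [inner_add_right, inner_smul_right, hF.inner_NN, hF.inner_NB, conj_trivial] at h3
  linarith

/-- Every vector field in `𝒳` is, along every curve, the initial velocity of a variation. The curve
is moved by the normal part `V = g N + h B`, multiplied by a cutoff of the parameter, and then
parametrized by arclength. The reparametrization contributes the tangential part of `℘ X`, as the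
speed changes at the rate `-κ g`. -/
theorem exists_isVariation (γ : BAL γ₀) {X : NB γ₀} (hX : X ∈ vectorFields γ₀) :
    ∃ c, IsVariation γ (lift X γ) c := by
  have hF := BAL.frenet γ
  set D := weightWindow γ with hD
  have hI : ∀ ε, ε ∈ D.I := fun ε => Set.mem_univ ε
  obtain ⟨-, hN, hB⟩ := jointSmooth_frame γ
  -- the normal part of the velocity, bounded with two derivatives by `C (1 + |s|) ^ N κ`
  set V : ℝ → E3 := fun s => X.1 γ s • normal γ.1 s + X.2 γ s • binormal γ.1 s with hV_def
  have hV : D.JointSmooth 1 (fun _ => V) := fun k => by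
    have h1 := (jointSmooth_of_mem (γ := γ) hX.1 k).smul (hN k)
    have h2 := (jointSmooth_of_mem (γ := γ) hX.2 k).smul (hB k)
    rw [add_zero] at h1 h2
    exact h1.add h2
  have hV₁ := hV.deriv
  have hV₂ := hV₁.deriv
  have dV : ∀ s, HasDerivAt V (deriv V s) s := fun s => by
    obtain ⟨_, F, -, h, -, -⟩ := hV.exists_partials
    exact (h 0 s).differentiableAt.hasDerivAt
  have dV₁ : ∀ s, HasDerivAt (deriv V) (deriv (deriv V) s) s := fun s => by
    obtain ⟨_, F, -, h, -, -⟩ := hV₁.exists_partials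
    exact (h 0 s).differentiableAt.hasDerivAt
  obtain ⟨C, N, hC, hb⟩ := PolyBdd.le_common (hI 0) (hV 0).1 (hV₁ 0).1 (hV₂ 0).1
  obtain ⟨K, hK⟩ := D.rapid 0
  replace hK : ∀ s, curvature γ.1 s ≤ K := fun s => by
    have := hK 0 (hI 0) s
    rwa [pow_zero, mul_one] at this
  have hK0 : 0 < K := (hF.curvature_pos 0).trans_le (hK 0)
  -- up to four terms of size `1 / 32` are added below
  set η : ℝ := 1 / (32 * C * (1 + K)) with hη
  have hη0 : 0 < η := by positivity
  obtain ⟨θ, hθ, hθ0, hθ1, hθb⟩ := D.exists_cutoff N hη0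
  have hθs := hθ.deriv
  have dθ : ∀ ε s, HasDerivAt (θ ε) (deriv (θ ε) s) s := fun ε s => by
    obtain ⟨_, F, -, h, -, -⟩ := hθ.exists_partials
    exact (h ε s).differentiableAt.hasDerivAt
  have dθs : ∀ ε s, HasDerivAt (deriv (θ ε)) (deriv (deriv (θ ε)) s) s := fun ε s => by
    obtain ⟨_, F, -, h, -, -⟩ := hθs.exists_partials
    exact (h ε s).differentiableAt.hasDerivAt
  have small : ∀ {a s : ℝ} {v : E3}, |a| * (1 + |s|) ^ N ≤ η →
      ‖v‖ ≤ C * (1 + |s|) ^ N * curvature γ.1 s →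
      ‖a • v‖ ≤ curvature γ.1 s / (32 * (1 + K)) := fun {a s v} ha hv => by
    have := hF.curvature_pos s
    rw [norm_smul, Real.norm_eq_abs]
    calc |a| * ‖v‖ ≤ |a| * (C * (1 + |s|) ^ N * curvature γ.1 s) := by gcongr
      _ = (|a| * (1 + |s|) ^ N) * (C * curvature γ.1 s) := by ring
      _ ≤ η * (C * curvature γ.1 s) := by gcongr
      _ = _ := by rw [hη]; field_simp
  set Z : ℝ → ℝ → E3 := fun ε s => deriv (θ ε) s • V s + θ ε s • deriv V s with hZ_def
  set Z' : ℝ → ℝ → E3 := fun ε s => (deriv (deriv (θ ε)) s • V s + deriv (θ ε) s • deriv V s) +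
    (deriv (θ ε) s • deriv V s + θ ε s • deriv (deriv V) s) with hZ'_def
  have hZ : D.JointSmooth 1 Z := fun k => by
    have h1 := (hθs k).smul (hV k)
    have h2 := (hθ k).smul (hV₁ k)
    rw [zero_add] at h1 h2
    exact h1.add h2
  have dZ : ∀ ε s, HasDerivAt (Z ε) (Z' ε s) s := fun ε s => by
    refine (((dθs ε s).smul (dV s)).add ((dθ ε s).smul (dV₁ s))).congr_deriv ?_
    simp only [hZ'_def]
    abel
  have hle : ∀ s, curvature γ.1 s / (32 * (1 + K)) ≤ curvature γ.1 s / 32 := fun s => by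
    have := hF.curvature_pos s
    gcongr
    linarith
  have hle' : ∀ s, curvature γ.1 s / (32 * (1 + K)) ≤ 1 / 32 := fun s => by
    rw [div_le_div_iff₀ (by positivity) (by norm_num)]
    nlinarith [hK s]
  have hZb : ∀ ε s, ‖Z ε s‖ ≤ 1 / 8 := fun ε s => by
    have h1 := small (hθb ε s).2.1 (hb s).1
    have h2 := small (hθb ε s).1 (hb s).2.1
    refine (norm_add_le _ _).trans ?_
    linarith [hle' s]
  have hZb' : ∀ ε s, ‖Z' ε s‖ ≤ curvature γ.1 s / 8 := fun ε s => by
    have h1 := small (hθb ε s).2.2 (hb s).1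
    have h2 := small (hθb ε s).2.1 (hb s).2.1
    have h3 := small (hθb ε s).1 (hb s).2.2
    have h4 := norm_add_le (deriv (deriv (θ ε)) s • V s + deriv (θ ε) s • deriv V s)
      (deriv (θ ε) s • deriv V s + θ ε s • deriv (deriv V) s)
    have h5 := norm_add_le (deriv (deriv (θ ε)) s • V s) (deriv (θ ε) s • deriv V s)
    have h6 := norm_add_le (deriv (θ ε) s • deriv V s) (θ ε s • deriv (deriv V) s)
    have h7 := hle s
    change ‖_ + _‖ ≤ _
    linarith
  obtain ⟨m, hm, hm1, hmb⟩ := exists_speed hZ hZb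
  obtain ⟨u, B, hu, huS, huS', du, due, hujs⟩ := exists_reparam (D := D) rfl hm
    (a := 7 / 8) (by norm_num) fun ε s => by linarith [(abs_le.1 (hmb ε s)).1]
  set Γ : ℝ → ℝ → E3 := fun ε s => γ.1 s + θ ε s • V s with hΓ_def
  have hθV : D.JointSmooth 1 (fun ε s => θ ε s • V s) := fun k => by
    simpa only [zero_add] using (hθ k).smul (hV k)
  have hΓ : D.JointSmooth 0 Γ := fun k => by
    have := (hθV k).lower
    rw [sub_self] at this
    exact (jointSmooth_curve γ k).add this
  have dΓ : ∀ ε s, HasDerivAt (Γ ε) (tangent γ.1 s + Z ε s) s := fun ε s => by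
    refine ((hF.hasDerivAt_curve s).add ((dθ ε s).smul (dV s))).congr_deriv ?_
    simp only [hZ_def]
    abel
  obtain ⟨T, A, B', hJ⟩ := exists_jointFamily hΓ hZ dΓ dZ hZb hZb' hm hm1 hmb du hujs
  obtain ⟨L, hL⟩ := γ.2.2.2.1
  have hint : ∀ ε, Integrable (m ε) := fun ε => by
    obtain ⟨C, hC⟩ := (hm 0).1.le_inv_one_add_sq
    exact (integrable_inv_one_add_sq.const_mul C).mono'
      (continuous_slice (hm 0).2 ε).aestronglyMeasurable (Eventually.of_forall (hC ε (hI ε)))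
  have hbal : ∀ ε, (fun s => Γ ε (u ε s)) ∈ BAL γ₀ := fun ε =>
    hJ.mem_bal (isBalancedWith_reparam hL (hint ε) (hu ε) (huS ε) (by
      simpa [hΓ_def] using (hθV 0).1.tendsto_zero (hI ε)))
  -- at the parameter `0` nothing has been changed
  have hZ0 : ∀ s, Z 0 s = 0 := fun s => by
    have : θ 0 = fun _ => 0 := funext hθ0
    simp [hZ_def, this]
  have hm0 : m 0 = fun _ => 0 := funext fun s => by
    have := hm1 0 s
    rw [hZ0, add_zero, hF.norm_tangent] at this
    linarith
  have hu0 : ∀ s, u 0 s = s := fun s => by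
    have := huS 0 s
    rw [hm0] at this
    simpa [halfInt] using this
  refine ⟨_, hJ.isVariation hbal (funext fun s => by simp [hΓ_def, hu0, hθ0]) fun s => ?_⟩
  -- the first variation of the speed
  have hmε : ∀ s, deriv (fun e => m e s) 0 = -(curvature γ.1 s * X.1 γ s) := fun s => by
    obtain ⟨m₁, m₂, dm₁, -, -, -⟩ := hm.exists_partials
    obtain ⟨Z₁, Z₂, dZ₁, -, -, -⟩ := hZ.exists_partials
    obtain ⟨i1, i2⟩ := inner_tangent_deriv γ hV_def dV s
    have e1 : (fun e => (1 + m e s) ^ 2) = fun e => 1 + 2 * (θ e s *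
        inner ℝ (tangent γ.1 s) (deriv V s)) + inner ℝ (Z e s) (Z e s) := funext fun e => by
      rw [hm1, norm_add_sq_real, hF.norm_tangent, real_inner_self_eq_norm_sq]
      have : (inner ℝ (tangent γ.1 s) (Z e s) : ℝ) =
          θ e s * inner ℝ (tangent γ.1 s) (deriv V s) := by
        simp only [hZ_def, inner_add_right, inner_smul_right, i1]
        ring
      rw [this]
      ring
    have e2 := ((dm₁ 0 s).const_add 1).pow 2
    have e3 := ((((hθ1 s).mul_const (inner ℝ (tangent γ.1 s) (deriv V s) : ℝ)).const_mul 2).const_add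
      1).add ((dZ₁ 0 s).inner ℝ (dZ₁ 0 s))
    have e4 := (e2.congr_of_eventuallyEq (Eventually.of_forall fun e => (congrFun e1 e).symm)).unique e3
    rw [hZ0, i2, hm0] at e4
    rw [(dm₁ 0 s).deriv]
    simp at e4
    linarith
  obtain ⟨Γ₁, Γ₂, dΓ₁, dΓ₂, hΓ₁, hΓ₂⟩ := hΓ.exists_partials
  have h1 := Joint.hasDerivAt_comp dΓ₁ dΓ₂ (hΓ₁ 0).2 (hΓ₂ 0).2 (hasDerivAt_id 0) (due 0 s)
  refine h1.congr_deriv ?_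
  have e1 : Γ₁ 0 s = V s := (dΓ₁ 0 s).unique
    ((((hθ1 s).smul_const (V s)).const_add (γ.1 s)).congr_deriv (one_smul ℝ _))
  have e2 : Γ₂ 0 s = tangent γ.1 s := (dΓ₂ 0 s).unique (by simpa [hZ0] using dΓ 0 s)
  have e3 : halfInt (fun t => deriv (fun e => m e t) 0) s = -dsInv (kappa * X.1) γ s := by
    rw [dsInv_apply]
    simp only [hmε, halfInt, integral_neg]
    change _ = -((1 / 2 : ℝ) * ((∫ t in Set.Iic s, curvature γ.1 t * X.1 γ t) -
      ∫ t in Set.Ioi s, curvature γ.1 t * X.1 γ t))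
    ring
  simp only [id, hu0, e1, e2, e3, hm0, lift, fieldT, fieldN, fieldB, hV_def]
  simp
  module

end

/-! ### Variational derivatives -/

theorem HasVariationAt.unique {E : Type} [NormedAddCommGroup E] [NormedSpace ℝ E]
    {X : TangentField γ₀} {f : BAL γ₀ → ℝ → E} {γ : BAL γ₀} {s : ℝ} {v w : E}
    (hv : HasVariationAt X f γ s v) (hw : HasVariationAt X f γ s w) : v = w := by
  obtain ⟨c, hc⟩ := hv.1
  exact (hv.2 c hc).unique (hw.2 c hc)

theorem HasVariationAt.vari_eq {E : Type} [NormedAddCommGroup E] [NormedSpace ℝ E]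
    {X : TangentField γ₀} {f : BAL γ₀ → ℝ → E} {γ : BAL γ₀} {s : ℝ} {v : E}
    (hv : HasVariationAt X f γ s v) : vari X f γ s = v := by
  have h : ∃ v, HasVariationAt X f γ s v := ⟨v, hv⟩
  rw [vari, dif_pos h]
  exact h.choose_spec.unique hv

section

variable {E : Type} [NormedAddCommGroup E] [NormedSpace ℝ E] {X : NB γ₀}

theorem hasVariationAt_of_forall (hX : X ∈ vectorFields γ₀) {f : BAL γ₀ → ℝ → E} {γ : BAL γ₀} {s : ℝ}
    {v : E} (h : ∀ c, c 0 = γ → IsVariation (c 0) (lift X (c 0)) c → ∀ r, RegularFamily c r →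
      HasDerivAt (fun ε => f (c ε) s) v 0) : HasVariationAt (lift X) f γ s v := by
  refine ⟨exists_isVariation γ hX, fun c hc => ?_⟩
  obtain ⟨r, hr⟩ := hc.regular
  have h0 : c 0 = γ := hc.1
  exact h c h0 (by rw [h0]; exact hc) r hr

theorem HasVariationAt.hasDerivAt {f : BAL γ₀ → ℝ → E} {c : ℝ → BAL γ₀} {s : ℝ} {v : E}
    (h : HasVariationAt (lift X) f (c 0) s v) (hc : IsVariation (c 0) (lift X (c 0)) c) :
    HasDerivAt (fun ε => f (c ε) s) v 0 := h.2 c hc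

/-- Along a variation, two pairs `(F, G)` with the same `F` have the same `G`. -/
theorem Window.TameSmooth.eq_vari {n : ℤ} {c : ℝ → BAL γ₀} {r : ℝ} {h : RegularFamily c r}
    {f : BAL γ₀ → ℝ → E} {G : ℝ → ℝ → E} (hG : h.window.TameSmooth n (fun ε => f (c ε)) G)
    (hc : IsVariation (c 0) (lift X (c 0)) c)
    (hf : ∀ s, HasVariationAt (lift X) f (c 0) s (vari (lift X) f (c 0) s)) :
    G 0 = vari (lift X) f (c 0) :=
  funext fun s => ((hG 0).tame₀.hasDerivAt 0 h.zero_mem s).unique ((hf s).hasDerivAt hc)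

end

section Scalar

variable {n i j : ℤ} {f g : ScalarField γ₀}

/-- The variational derivative of an expression along `℘ X` exists, that is, there are variations in
the direction `℘ X` and all of them give the same derivative, which is linear in `X`. -/
theorem exists_vari_linExpr {v : E3} (hv : AsympDirection γ₀ v) {n : ℤ} {f : ScalarField γ₀}
    (hf : f ∈ algSpace γ₀ n) : ∃ L : NB γ₀ → ScalarField γ₀, LinExpr n L ∧
      ∀ X ∈ vectorFields γ₀, vari (lift X) f = L X ∧
        ∀ γ s, HasVariationAt (lift X) f γ s (vari (lift X) f γ s) := by
  obtain ⟨L, hL, h⟩ := exists_linearization hv hf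
  have key : ∀ X ∈ vectorFields γ₀, ∀ γ s, HasVariationAt (lift X) f γ s (L X γ s) :=
    fun X hX γ s => hasVariationAt_of_forall hX fun c h0 hc r hr => by
      obtain ⟨G, hG, e⟩ := h X hX c hc r hr
      have := (hG 0).tame₀.hasDerivAt 0 hr.zero_mem s
      rwa [e, h0] at this
  have e : ∀ X ∈ vectorFields γ₀, vari (lift X) f = L X := fun X hX =>
    funext fun γ => funext fun s => (key X hX γ s).vari_eq
  exact ⟨L, hL, fun X hX => ⟨e X hX, fun γ s => by rw [e X hX]; exact key X hX γ s⟩⟩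

theorem hasVariationAt_vari {v : E3} (hv : AsympDirection γ₀ v) {X : NB γ₀}
    (hX : X ∈ vectorFields γ₀) (hf : f ∈ algSpace γ₀ n) (γ : BAL γ₀) (s : ℝ) :
    HasVariationAt (lift X) f γ s (vari (lift X) f γ s) := by
  obtain ⟨L, -, h⟩ := exists_vari_linExpr hv hf
  exact (h X hX).2 γ s

theorem vari_mem {v : E3} (hv : AsympDirection γ₀ v) {X : NB γ₀}
    (hX : X ∈ vectorFields γ₀) (hf : f ∈ algSpace γ₀ n) : vari (lift X) f ∈ algSpace γ₀ n := by
  obtain ⟨L, hL, h⟩ := exists_vari_linExpr hv hf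
  rw [(h X hX).1]
  exact hL.mem_algSpace hX

theorem tameSmooth_vari {v : E3} (hv : AsympDirection γ₀ v) {X : NB γ₀}
    (hX : X ∈ vectorFields γ₀) (hf : f ∈ algSpace γ₀ n) {c : ℝ → BAL γ₀}
    (hc : IsVariation (c 0) (lift X (c 0)) c) {r : ℝ} (h : RegularFamily c r) :
    ∃ G, h.window.TameSmooth n (fun ε => f (c ε)) G ∧ G 0 = vari (lift X) f (c 0) := by
  obtain ⟨L, -, h'⟩ := exists_linearization hv hf
  obtain ⟨G, hG, -⟩ := h' X hX c hc r h
  exact ⟨G, hG, hG.eq_vari hc (hasVariationAt_vari hv hX hf (c 0))⟩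

theorem vari_eq_of_tame {X : NB γ₀} (hX : X ∈ vectorFields γ₀) {f' : ScalarField γ₀}
    (h : ∀ c : ℝ → BAL γ₀, IsVariation (c 0) (lift X (c 0)) c → ∀ r, ∀ h : RegularFamily c r,
      ∃ (m : ℤ) (G : ℝ → ℝ → ℝ), h.window.Tame 0 m (fun ε => f (c ε)) G ∧ G 0 = f' (c 0)) :
    vari (lift X) f = f' := by
  refine funext fun γ => funext fun s => (hasVariationAt_of_forall hX fun c h0 hc r hr => ?_).vari_eq
  obtain ⟨m, G, hG, e⟩ := h c hc r hr
  have := Window.Tame₀.hasDerivAt hG 0 hr.zero_mem s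
  rwa [e, h0] at this

theorem vari_mul {v : E3} (hv : AsympDirection γ₀ v) {X : NB γ₀}
    (hX : X ∈ vectorFields γ₀) (hf : f ∈ algSpace γ₀ i) (hg : g ∈ algSpace γ₀ j) :
    vari (lift X) (f * g) = vari (lift X) f * g + f * vari (lift X) g := by
  refine vari_eq_of_tame hX fun c hc r h => ?_
  obtain ⟨F, hF, e⟩ := tameSmooth_vari hv hX hf hc h
  obtain ⟨G, hG, e'⟩ := tameSmooth_vari hv hX hg hc h
  exact ⟨_, _, (hF 0).mul (hG 0), by rw [e, e']; rfl⟩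

theorem vari_add {v : E3} (hv : AsympDirection γ₀ v) {X : NB γ₀}
    (hX : X ∈ vectorFields γ₀) (hf : f ∈ algSpace γ₀ n) (hg : g ∈ algSpace γ₀ n) :
    vari (lift X) (f + g) = vari (lift X) f + vari (lift X) g := by
  refine vari_eq_of_tame hX fun c hc r h => ?_
  obtain ⟨F, hF, e⟩ := tameSmooth_vari hv hX hf hc h
  obtain ⟨G, hG, e'⟩ := tameSmooth_vari hv hX hg hc h
  exact ⟨_, _, (hF 0).add (hG 0), by rw [e, e']; rfl⟩

theorem vari_integ {v : E3} (hv : AsympDirection γ₀ v) {X : NB γ₀}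
    (hX : X ∈ vectorFields γ₀) (hf : f ∈ algSpace γ₀ 2) :
    vari (lift X) (integ f) = integ (vari (lift X) f) := by
  refine vari_eq_of_tame hX fun c hc r h => ?_
  obtain ⟨F, hF, e⟩ := tameSmooth_vari hv hX hf hc h
  exact ⟨_, _, Window.Tame.integ (k := 0) (by simpa using (hF 0).lower.tame₀), by rw [e]; rfl⟩

theorem vari_dsInv {v : E3} (hv : AsympDirection γ₀ v) {X : NB γ₀}
    (hX : X ∈ vectorFields γ₀) (hf : f ∈ algSpace γ₀ 2) :
    vari (lift X) (dsInv f) = dsInv (vari (lift X) f) := by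
  refine vari_eq_of_tame hX fun c hc r h => ?_
  obtain ⟨F, hF, e⟩ := tameSmooth_vari hv hX hf hc h
  exact ⟨_, _, Window.Tame.halfInt (k := 0) (by simpa using (hF 0).lower), by rw [e]; rfl⟩

end Scalar

/-! ### Covariant derivatives of vector fields -/

/-- The second variation `δ_U V` of a pair of vector fields, `U = ℘ X` and `V = ℘ Y`. -/
def covar (X Y : NB γ₀) : TangentField γ₀ := vari (lift X) (lift Y)

section Covar

/-- The `N`-component of `covar X Y`. -/
def covarN (X Y : NB γ₀) : ScalarField γ₀ :=
  vari (lift X) Y.1 + dsInv (kappa * Y.1) * strainN X - Y.2 * spin X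

/-- The `B`-component of `covar X Y`. -/
def covarB (X Y : NB γ₀) : ScalarField γ₀ :=
  vari (lift X) Y.2 + dsInv (kappa * Y.1) * strainB X + Y.1 * spin X

/-- The `T`-component of `covar X Y`. -/
def covarT (X Y : NB γ₀) : ScalarField γ₀ :=
  dsInv (vari (lift X) (kappa * Y.1)) - (Y.1 * strainN X + Y.2 * strainB X)

theorem covarN_mem {v : E3} (hv : AsympDirection γ₀ v) {X Y : NB γ₀}
    (hX : X ∈ vectorFields γ₀) (hY : Y ∈ vectorFields γ₀) : covarN X Y ∈ algSpace γ₀ 1 :=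
  Alg.sub (Alg.add (vari_mem hv hX hY.1) (Alg.mul (Alg.dsInv (kappa_fst_mem hY)) (strainN_mem hX)
    (by norm_num))) (Alg.mul hY.2 (spin_mem hX) (by norm_num))

theorem covarB_mem {v : E3} (hv : AsympDirection γ₀ v) {X Y : NB γ₀}
    (hX : X ∈ vectorFields γ₀) (hY : Y ∈ vectorFields γ₀) : covarB X Y ∈ algSpace γ₀ 1 :=
  Alg.add (Alg.add (vari_mem hv hX hY.2) (Alg.mul (Alg.dsInv (kappa_fst_mem hY)) (strainB_mem hX)
    (by norm_num))) (Alg.mul hY.1 (spin_mem hX) (by norm_num))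

/-- Along a variation in the direction `℘ X`, the field `℘ Y` is tame; its derivative has the frame
components `covarT`, `covarN` and `covarB`. -/
theorem tameSmooth_covar {v : E3} (hv : AsympDirection γ₀ v) {X Y : NB γ₀}
    (hX : X ∈ vectorFields γ₀) (hY : Y ∈ vectorFields γ₀) {c : ℝ → BAL γ₀} (hc : IsVariation (c 0) (lift X (c 0)) c) {r : ℝ}
    (h : RegularFamily c r) : ∃ G, h.window.TameSmooth 0 (fun ε => lift Y (c ε)) G ∧
      ∀ s, G 0 s = covarT X Y (c 0) s • tangent (c 0).1 s + covarN X Y (c 0) s • normal (c 0).1 s +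
        covarB X Y (c 0) s • binormal (c 0).1 s := by
  obtain ⟨GT, GN, GB, Gκ, Gι, Gτ, hT, hN, hB, hκ, hι, hτ, eT, eN, eB, eκ, eι, eτ⟩ :=
    h.frame_variation hX hc
  obtain ⟨A, hA, eA⟩ := tameSmooth_vari hv hX (Alg.dsInv (kappa_fst_mem hY)) hc h
  obtain ⟨F, hF, eF⟩ := tameSmooth_vari hv hX hY.1 hc h
  obtain ⟨G, hG, eG⟩ := tameSmooth_vari hv hX hY.2 hc h
  rw [vari_dsInv hv hX (kappa_fst_mem hY)] at eA
  have h1 : ∀ k, _ := fun k => (hA k).smul (hT k)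
  have h2 : ∀ k, _ := fun k => ((hF k).smul (hN k)).lower
  have h3 : ∀ k, _ := fun k => ((hG k).smul (hB k)).lower
  simp only [add_zero, sub_self] at h1 h2 h3
  refine ⟨_, fun k => ((h1 k).add (h2 k)).add (h3 k), fun s => ?_⟩
  simp only [eA, eF, eG, eT, eN, eB, covarT, covarN, covarB, Pi.add_apply, Pi.sub_apply,
    Pi.mul_apply]
  module

theorem hasVariationAt_covar {v : E3} (hv : AsympDirection γ₀ v) {X Y : NB γ₀}
    (hX : X ∈ vectorFields γ₀) (hY : Y ∈ vectorFields γ₀) (γ : BAL γ₀) (s : ℝ) :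
    HasVariationAt (lift X) (lift Y) γ s (covar X Y γ s) ∧
    covar X Y γ s = covarT X Y γ s • tangent γ.1 s + covarN X Y γ s • normal γ.1 s +
        covarB X Y γ s • binormal γ.1 s := by
  have key : HasVariationAt (lift X) (lift Y) γ s (covarT X Y γ s • tangent γ.1 s +
      covarN X Y γ s • normal γ.1 s + covarB X Y γ s • binormal γ.1 s) :=
    hasVariationAt_of_forall hX fun c h0 hc r hr => by
      obtain ⟨G, hG, e⟩ := tameSmooth_covar hv hX hY hc hr
      have := (hG 0).tame₀.hasDerivAt 0 hr.zero_mem s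
      rwa [e, h0] at this
  have e := key.vari_eq
  exact ⟨by rw [covar, e]; exact key, e⟩

/-- Along a variation in the direction `℘ X`, the field `℘ Y` is tame, with derivative
`covar X Y`. -/
theorem exists_tameSmooth_covar {v : E3} (hv : AsympDirection γ₀ v) {X Y : NB γ₀}
    (hX : X ∈ vectorFields γ₀) (hY : Y ∈ vectorFields γ₀) {c : ℝ → BAL γ₀} (hc : IsVariation (c 0) (lift X (c 0)) c) {r : ℝ}
    (h : RegularFamily c r) : ∃ G, h.window.TameSmooth 0 (fun ε => lift Y (c ε)) G ∧
      G 0 = covar X Y (c 0) := by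
  obtain ⟨G, hG, e⟩ := tameSmooth_covar hv hX hY hc h
  exact ⟨G, hG, funext fun s => by rw [e, (hasVariationAt_covar hv hX hY (c 0) s).2]⟩

/-- As for `℘ Y` itself, only the tangential part survives at the ends; it is an anti-derivative
because variations commute with `∂ₛ⁻¹`. -/
theorem oddLimits_covar {v : E3} (hv : AsympDirection γ₀ v) {X Y : NB γ₀}
    (hX : X ∈ vectorFields γ₀) (hY : Y ∈ vectorFields γ₀) (γ : BAL γ₀) : OddLimits v (covar X Y γ) := by
  have e : covar X Y γ = fun s => dsInv (vari (lift X) (kappa * Y.1)) γ s • tangent γ.1 s -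
      (Y.1 * strainN X + Y.2 * strainB X : ScalarField γ₀) γ s • tangent γ.1 s +
      (covarN X Y γ s • normal γ.1 s + covarB X Y γ s • binormal γ.1 s) := funext fun s => by
    rw [(hasVariationAt_covar hv hX hY γ s).2, covarT]
    simp only [Pi.sub_apply]
    module
  have h0 := tendsto_normal_part (covarN_mem hv hX hY) (covarB_mem hv hX hY) γ
  have hsm : (Y.1 * strainN X + Y.2 * strainB X : ScalarField γ₀) ∈ algSpace γ₀ 1 :=
    Alg.add (Alg.mul hY.1 (strainN_mem hX) (by norm_num)) (Alg.mul hY.2 (strainB_mem hX) (by norm_num))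
  have h1 := tendsto_smul_unit (Alg.tendsto hsm le_rfl γ) (BAL.frenet γ).norm_tangent
  have hT := hv.tendsto_tangent γ
  have hi := Alg.integrable (vari_mem hv hX (kappa_fst_mem hY)) (by norm_num) γ
  rw [cocompact_eq_atBot_atTop, tendsto_sup] at h0 h1 hT
  refine ⟨(1 / 2 : ℝ) * ∫ t, vari (lift X) (kappa * Y.1) γ t, ?_, ?_⟩
  · have := (((tendsto_halfInt_atTop hi).smul hT.2).sub h1.2).add h0.2
    rw [sub_zero, add_zero] at this
    rw [e]
    exact this
  · have := (((tendsto_halfInt_atBot hi).smul hT.1).sub h1.1).add h0.1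
    rw [sub_zero, add_zero, neg_smul] at this
    rw [e]
    exact this

end Covar

/-! ### The recursion operator -/

namespace OddLimits

variable {v : E3} {V W : ℝ → E3}

theorem add (hV : OddLimits v V) (hW : OddLimits v W) : OddLimits v (fun s => V s + W s) := by
  obtain ⟨α, h1, h2⟩ := hV
  obtain ⟨β, h3, h4⟩ := hW
  exact ⟨α + β, by simpa only [add_smul] using h1.add h3, by
    simpa only [add_smul, neg_add] using h2.add h4⟩

theorem neg (hV : OddLimits v V) : OddLimits v (fun s => -V s) := by
  obtain ⟨α, h1, h2⟩ := hV
  exact ⟨-α, by simpa only [neg_smul] using h1.neg, by simpa only [neg_smul] using h2.neg⟩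

theorem sub (hV : OddLimits v V) (hW : OddLimits v W) : OddLimits v (fun s => V s - W s) := by
  simpa only [sub_eq_add_neg] using hV.add hW.neg

theorem cross (hV : OddLimits v V) (hW : OddLimits v W) :
    OddLimits v (fun s => cross (V s) (W s)) := by
  obtain ⟨α, h1, h2⟩ := hV
  obtain ⟨β, h3, h4⟩ := hW
  refine ⟨0, ?_, ?_⟩
  · simpa only [cross_smul_left, cross_smul_right, cross_self, smul_zero, zero_smul]
      using h1.cross h3
  · simpa only [← neg_smul, cross_smul_left, cross_smul_right, cross_self, smul_zero, zero_smul,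
      neg_zero] using h2.cross h4

theorem inner (hV : OddLimits v V) (hW : OddLimits v W) : ∃ a : ℝ,
    Tendsto (fun s => (inner ℝ (V s) (W s) : ℝ)) atTop (𝓝 a) ∧
    Tendsto (fun s => (inner ℝ (V s) (W s) : ℝ)) atBot (𝓝 a) := by
  obtain ⟨α, h1, h2⟩ := hV
  obtain ⟨β, h3, h4⟩ := hW
  exact ⟨_, h1.inner h3, by simpa only [inner_neg_neg] using h2.inner h4⟩

theorem exists_bound (hV : OddLimits v V) (hc : Continuous V) : ∃ C, ∀ s, ‖V s‖ ≤ C := by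
  obtain ⟨α, h1, h2⟩ := hV
  have h : Tendsto (fun s => ‖V s‖) (cocompact ℝ) (𝓝 ‖α • v‖) := by
    rw [cocompact_eq_atBot_atTop, tendsto_sup]
    exact ⟨by simpa only [norm_neg] using h2.norm, h1.norm⟩
  obtain ⟨C, hC⟩ := exists_bound_of_tendsto_cocompact hc.norm h
  exact ⟨C, fun s => by simpa using hC s⟩

end OddLimits

/-- A field `V` with `V' ⟂ T` and opposite limits is determined by its normal part: its tangential
component is obtained by anti-differentiation. -/
theorem eq_lift_of_hasDerivAt_cross {v : E3} (hv : AsympDirection γ₀ v) (γ : BAL γ₀)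
    {V W : TangentField γ₀} (hd : ∀ s, HasDerivAt (V γ) (cross (tangent γ.1 s) (W γ s)) s)
    (hV : OddLimits v (V γ)) : V γ = lift (proj V) γ := by
  have hF := BAL.frenet γ
  have hc : Continuous (V γ) := continuous_iff_continuousAt.2 fun s => (hd s).continuousAt
  obtain ⟨C, hC⟩ := hV.exists_bound hc
  have hf : ∀ s, HasDerivAt (fun s => (inner ℝ (tangent γ.1 s) (V γ s) : ℝ))
      (curvature γ.1 s * inner ℝ (normal γ.1 s) (V γ s)) s := fun s => by
    refine ((hF.hasDerivAt_tangent s).inner ℝ (hd s)).congr_deriv ?_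
    rw [real_inner_comm, inner_cross_left_self, inner_smul_left]
    simp
  have hi : Integrable (fun s => curvature γ.1 s * inner ℝ (normal γ.1 s) (V γ s)) := by
    refine ((Alg.integrable Alg.kappa le_rfl γ).norm.mul_const C).mono'
      (hF.smooth_curvature.continuous.mul
        (hF.smooth_normal.continuous.inner hc)).aestronglyMeasurable
      (Eventually.of_forall fun s => ?_)
    rw [norm_mul]
    have h1 := norm_inner_le_norm (𝕜 := ℝ) (normal γ.1 s) (V γ s)
    rw [hF.norm_normal, one_mul] at h1
    exact mul_le_mul_of_nonneg_left (h1.trans (hC s)) (norm_nonneg _)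
  obtain ⟨α, h1, h2⟩ := hV
  have hT := hv.tendsto_tangent γ
  rw [cocompact_eq_atBot_atTop, tendsto_sup] at hT
  have key := halfInt_deriv_eq (a := α) hf hi (by
    simpa [inner_smul_right, hv.unit] using hT.2.inner (𝕜 := ℝ) h1)
    (by
    simpa [inner_smul_right, hv.unit] using hT.1.inner (𝕜 := ℝ) h2)
  funext s
  have e : dsInv (kappa * (proj V).1) γ s = inner ℝ (tangent γ.1 s) (V γ s) := congrFun key s
  rw [lift, e]
  exact hF.expansion s (V γ s)

section

variable {X Y Z : NB γ₀}

/-- `R X` is read off from any representation `(℘ X)' = T × S`. -/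
theorem opR_eq_of_hasDerivAt_cross {S : TangentField γ₀}
    (h : ∀ γ s, HasDerivAt (lift X γ) (cross (tangent γ.1 s) (S γ s)) s) : opR X = proj S := by
  have key : ∀ (γ : BAL γ₀) s, nablaS (lift X) γ s = cross (tangent γ.1 s) (S γ s) := fun γ s =>
    (h γ s).deriv
  refine Prod.ext ?_ ?_
  · funext γ s
    simp only [opR, opJ, proj, fieldB, fieldN, key, inner_cross_cycle]
    rw [cross_anticomm, (BAL.frenet γ).cross_TB, neg_neg]
  · funext γ s
    simp only [opR, opJ, proj, fieldB, fieldN, Pi.neg_apply, key, inner_cross_cycle]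
    rw [(BAL.frenet γ).cross_NT, inner_neg_left, neg_neg]

theorem opR_eq (hX : X ∈ vectorFields γ₀) : opR X = (strainB X, -strainN X) := by
  have key : ∀ (γ : BAL γ₀) s, nablaS (lift X) γ s =
      strainN X γ s • normal γ.1 s + strainB X γ s • binormal γ.1 s := fun γ s =>
    (hasDerivAt_lift hX γ s).deriv
  refine Prod.ext ?_ ?_
  · funext γ s
    have hF := BAL.frenet γ
    simp [opR, opJ, proj, fieldB, key, inner_add_right, inner_smul_right, hF.inner_BN, hF.norm_binormal]
  · funext γ s
    have hF := BAL.frenet γ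
    simp [opR, opJ, proj, fieldN, key, inner_add_right, inner_smul_right, hF.norm_normal, hF.inner_NB]

theorem opR_mem (hX : X ∈ vectorFields γ₀) : opR X ∈ vectorFields γ₀ := by
  rw [opR_eq hX]
  exact ⟨strainB_mem hX, Alg.neg (strainN_mem hX)⟩

/-- `(℘ X)' = T × ℘ (R X)`. -/
theorem hasDerivAt_lift_cross (hX : X ∈ vectorFields γ₀) (γ : BAL γ₀) (s : ℝ) :
    HasDerivAt (lift X γ) (cross (tangent γ.1 s) (lift (opR X) γ s)) s := by
  refine (hasDerivAt_lift hX γ s).congr_deriv ?_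
  have hF := BAL.frenet γ
  simp only [lift, opR_eq hX, fieldT, fieldN, fieldB, Pi.neg_apply]
  rw [cross_add_right, cross_add_right, cross_smul_right, cross_smul_right, cross_smul_right,
    cross_self, hF.cross_TN, hF.cross_TB]
  module

theorem lift_oddLimits {v : E3} (hv : AsympDirection γ₀ v) (hX : X ∈ vectorFields γ₀) (γ : BAL γ₀) :
    OddLimits v (lift X γ) := ⟨_, oddLimits_lift hv hX γ⟩

/-- `(δ_U V)' = U' × ℘ (R Y) + T × δ_U ℘ (R Y)` for `U = ℘ X` and `V = ℘ Y`. -/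
theorem hasDerivAt_covar {v : E3} (hv : AsympDirection γ₀ v) (hX : X ∈ vectorFields γ₀)
    (hY : Y ∈ vectorFields γ₀) (γ : BAL γ₀) (s : ℝ) :
    HasDerivAt (covar X Y γ)
      (cross (cross (tangent γ.1 s) (lift (opR X) γ s)) (lift (opR Y) γ s) +
        cross (tangent γ.1 s) (covar X (opR Y) γ s)) s := by
  obtain ⟨c, hc⟩ := exists_isVariation γ hX
  obtain ⟨r, h⟩ := hc.regular
  obtain rfl : c 0 = γ := hc.1
  obtain ⟨G, hG, e⟩ := exists_tameSmooth_covar hv hX hY hc h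
  obtain ⟨G', hG', e'⟩ := exists_tameSmooth_covar hv hX (opR_mem hY) hc h
  have h1 := (hG.deriv 0).tame₀.hasDerivAt 0 h.zero_mem s
  have h2 := ((h.tame_tangent 0).cross (hG' 0)).tame₀.hasDerivAt 0 h.zero_mem s
  have e1 : (fun ε => deriv (lift Y (c ε)) s) =
      fun ε => cross (tangent (c ε).1 s) (lift (opR Y) (c ε) s) :=
    funext fun ε => (hasDerivAt_lift_cross hY (c ε) s).deriv
  rw [e1] at h1
  have h3 := h1.unique h2
  have h4 := (hG.hasDerivAt (h.window.J_sub h.zero_mem) s).2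
  rw [h3, e, e', h.tangent_variation hX hc s,
    (hasDerivAt_lift hX (c 0) s).unique (hasDerivAt_lift_cross hX (c 0) s)] at h4
  exact h4

theorem proj_covar {v : E3} (hv : AsympDirection γ₀ v) (hX : X ∈ vectorFields γ₀)
    (hY : Y ∈ vectorFields γ₀) : proj (covar X Y) = (covarN X Y, covarB X Y) := by
  have key := fun γ s => (hasVariationAt_covar hv hX hY γ s).2
  refine Prod.ext ?_ ?_
  · funext γ s
    have hF := BAL.frenet γ
    simp [proj, fieldN, key, inner_add_right, inner_smul_right, hF.norm_normal, hF.inner_NB,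
      hF.inner_NT]
  · funext γ s
    have hF := BAL.frenet γ
    simp [proj, fieldB, key, inner_add_right, inner_smul_right, hF.inner_BN, hF.norm_binormal,
      hF.inner_BT]

theorem proj_add (V W : TangentField γ₀) : proj (V + W) = proj V + proj W := by
  refine Prod.ext ?_ ?_ <;> funext γ s <;> simp [proj, inner_add_right]

theorem proj_sub (V W : TangentField γ₀) : proj (V - W) = proj V - proj W := by
  refine Prod.ext ?_ ?_ <;> funext γ s <;> simp [proj, inner_sub_right]

theorem bracket_eq_proj : bracket X Y = proj (covar X Y - covar Y X) := rfl

theorem bracket_eq {v : E3} (hv : AsympDirection γ₀ v) (hX : X ∈ vectorFields γ₀)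
    (hY : Y ∈ vectorFields γ₀) :
    bracket X Y = (covarN X Y - covarN Y X, covarB X Y - covarB Y X) := by
  rw [bracket_eq_proj, proj_sub, proj_covar hv hX hY, proj_covar hv hY hX]
  rfl

theorem bracket_mem {v : E3} (hv : AsympDirection γ₀ v) (hX : X ∈ vectorFields γ₀)
    (hY : Y ∈ vectorFields γ₀) : bracket X Y ∈ vectorFields γ₀ := by
  rw [bracket_eq hv hX hY]
  exact ⟨Alg.sub (covarN_mem hv hX hY) (covarN_mem hv hY hX),
    Alg.sub (covarB_mem hv hX hY) (covarB_mem hv hY hX)⟩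

/-- The field `℘ (R X) × ℘ (R Y) + δ_U ℘ (R Y) - δ_V ℘ (R X)`, which turns out to be
`℘ (R [X, Y])`. -/
def covarCurl (X Y : NB γ₀) : TangentField γ₀ := fun γ s =>
  cross (lift (opR X) γ s) (lift (opR Y) γ s) + covar X (opR Y) γ s - covar Y (opR X) γ s

theorem hasDerivAt_covar_sub {v : E3} (hv : AsympDirection γ₀ v) (hX : X ∈ vectorFields γ₀)
    (hY : Y ∈ vectorFields γ₀) (γ : BAL γ₀) (s : ℝ) :
    HasDerivAt ((covar X Y - covar Y X) γ) (cross (tangent γ.1 s) (covarCurl X Y γ s)) s := by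
  refine ((hasDerivAt_covar hv hX hY γ s).sub (hasDerivAt_covar hv hY hX γ s)).congr_deriv ?_
  have := cross_jacobi (tangent γ.1 s) (lift (opR X) γ s) (lift (opR Y) γ s)
  rw [covarCurl, cross_sub_right, cross_add_right, ← this]
  abel

/-- The difference `δ_U V - δ_V U` is again of the form `℘ [X, Y]`, not only in its normal part. -/
theorem lift_bracket {v : E3} (hv : AsympDirection γ₀ v) (hX : X ∈ vectorFields γ₀)
    (hY : Y ∈ vectorFields γ₀) : lift (bracket X Y) = covar X Y - covar Y X :=
  funext fun γ => (eq_lift_of_hasDerivAt_cross hv γ (hasDerivAt_covar_sub hv hX hY γ)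
    ((oddLimits_covar hv hX hY γ).sub (oddLimits_covar hv hY hX γ))).symm

theorem opR_bracket {v : E3} (hv : AsympDirection γ₀ v) (hX : X ∈ vectorFields γ₀)
    (hY : Y ∈ vectorFields γ₀) : opR (bracket X Y) = proj (covarCurl X Y) :=
  opR_eq_of_hasDerivAt_cross fun γ s => by
    rw [lift_bracket hv hX hY]
    exact hasDerivAt_covar_sub hv hX hY γ s

theorem opR_opR_bracket {v : E3} (hv : AsympDirection γ₀ v) (hX : X ∈ vectorFields γ₀)
    (hY : Y ∈ vectorFields γ₀) : opR (opR (bracket X Y)) = proj (fun γ s =>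
      (cross (lift (opR (opR X)) γ s) (lift (opR Y) γ s) +
        cross (lift (opR X) γ s) (lift (opR (opR Y)) γ s) + covar X (opR (opR Y)) γ s -
        covar Y (opR (opR X)) γ s : E3)) := by
  have hRX := opR_mem hX
  have hRY := opR_mem hY
  set W : TangentField γ₀ := fun γ s =>
    cross (lift (opR (opR X)) γ s) (lift (opR Y) γ s) +
      cross (lift (opR X) γ s) (lift (opR (opR Y)) γ s) + covar X (opR (opR Y)) γ s -
      covar Y (opR (opR X)) γ s with hW
  -- differentiating `covarCurl` produces once more a vector product with `T`, by the Jacobi identity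
  have hd : ∀ γ s, HasDerivAt (covarCurl X Y γ) (cross (tangent γ.1 s) (W γ s)) s := fun γ s => by
    refine (((hasDerivAt_lift_cross hRX γ s).cross (hasDerivAt_lift_cross hRY γ s)).add
      (hasDerivAt_covar hv hX hRY γ s)).sub (hasDerivAt_covar hv hY hRX γ s) |>.congr_deriv ?_
    have h1 := cross_jacobi (tangent γ.1 s) (lift (opR (opR X)) γ s) (lift (opR Y) γ s)
    have h2 := cross_jacobi' (tangent γ.1 s) (lift (opR X) γ s) (lift (opR (opR Y)) γ s)
    simp only [hW]
    rw [cross_sub_right, cross_add_right, cross_add_right, ← h1, ← h2]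
    abel
  have hS : ∀ γ, covarCurl X Y γ = lift (opR (bracket X Y)) γ := fun γ => by
    rw [opR_bracket hv hX hY]
    refine eq_lift_of_hasDerivAt_cross hv γ (hd γ) ?_
    exact (((lift_oddLimits hv hRX γ).cross (lift_oddLimits hv hRY γ)).add
      (oddLimits_covar hv hX hRY γ)).sub (oddLimits_covar hv hY hRX γ)
  exact opR_eq_of_hasDerivAt_cross fun γ s => by
    rw [← hS]
    exact hd γ s

/-- The recursion operator has vanishing Nijenhuis torsion. -/
theorem nijenhuis {v : E3} (hv : AsympDirection γ₀ v) (hX : X ∈ vectorFields γ₀)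
    (hY : Y ∈ vectorFields γ₀) : opR (opR (bracket X Y)) =
      opR (bracket (opR X) Y) + opR (bracket X (opR Y)) - bracket (opR X) (opR Y) := by
  rw [opR_opR_bracket hv hX hY, opR_bracket hv (opR_mem hX) hY, opR_bracket hv hX (opR_mem hY),
    bracket_eq_proj, ← proj_add, ← proj_sub]
  congr 1
  funext γ s
  simp only [covarCurl, Pi.add_apply, Pi.sub_apply]
  abel

end

/-! ### The symplectic forms -/

/-- The integrand of `symp`; it equals `-det (T, ℘ X, ℘ Y)`. -/
def pairing (X Y : NB γ₀) : ScalarField γ₀ := X.2 * Y.1 - X.1 * Y.2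

/-- The Marsden–Weinstein symplectic form `ω(X, Y) = g(-J⁻¹ X, Y)` on vector fields. -/
def symp (X Y : NB γ₀) : ScalarField γ₀ := integ (pairing X Y)

/-- The exterior derivative of a two-form. -/
def extDeriv (Ω : NB γ₀ → NB γ₀ → ScalarField γ₀) (X Y Z : NB γ₀) : ScalarField γ₀ :=
  (act X (Ω Y Z) - Ω (bracket X Y) Z) + (act Y (Ω Z X) - Ω (bracket Y Z) X) +
    (act Z (Ω X Y) - Ω (bracket Z X) Y)

section

variable {X Y Z : NB γ₀}

theorem pairing_mem (hX : X ∈ vectorFields γ₀) (hY : Y ∈ vectorFields γ₀) :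
    pairing X Y ∈ algSpace γ₀ 2 :=
  Alg.sub (Alg.mul hX.2 hY.1 (by norm_num)) (Alg.mul hX.1 hY.2 (by norm_num))

theorem pairing_proj (V : TangentField γ₀) (X : NB γ₀) (γ : BAL γ₀) (s : ℝ) :
    pairing (proj V) X γ s = -inner ℝ (tangent γ.1 s) (cross (V γ s) (lift X γ s)) := by
  have hF := BAL.frenet γ
  have hN : inner ℝ (tangent γ.1 s) (cross (V γ s) (normal γ.1 s)) =
      -(inner ℝ (binormal γ.1 s) (V γ s) : ℝ) := by
    rw [cross_anticomm, inner_neg_right, inner_cross_cycle]; rfl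
  have hB : inner ℝ (tangent γ.1 s) (cross (V γ s) (binormal γ.1 s)) =
      (inner ℝ (normal γ.1 s) (V γ s) : ℝ) := by
    rw [cross_anticomm, inner_neg_right, inner_cross_cycle, hF.cross_TB, inner_neg_left, neg_neg]
  have hT : inner ℝ (tangent γ.1 s) (cross (V γ s) (tangent γ.1 s)) = (0 : ℝ) := by
    rw [real_inner_comm, inner_cross_right_self]
  simp only [pairing, proj, lift, Pi.sub_apply, Pi.mul_apply, fieldT, fieldN, fieldB]
  rw [cross_add_right, cross_add_right, cross_smul_right, cross_smul_right, cross_smul_right,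
    inner_add_right, inner_add_right, inner_smul_right, inner_smul_right, inner_smul_right, hT, hN,
    hB]
  ring

theorem proj_lift (X : NB γ₀) : proj (lift X) = X := by
  refine Prod.ext ?_ ?_ <;> funext γ s <;> have hF := BAL.frenet γ <;>
  simp [proj, lift, fieldT, fieldN, fieldB, inner_add_right, inner_smul_right, hF.inner_NT,
    hF.norm_normal, hF.inner_NB, hF.inner_BT, hF.inner_BN, hF.norm_binormal]

theorem pairing_apply (X Y : NB γ₀) (γ : BAL γ₀) (s : ℝ) :
    pairing X Y γ s = -inner ℝ (tangent γ.1 s) (cross (lift X γ s) (lift Y γ s)) := by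
  have := pairing_proj (lift X) Y γ s
  rwa [proj_lift] at this

theorem symp_antisymm (X Y : NB γ₀) : symp X Y = -symp Y X := by
  funext γ s
  simp only [symp, integ, Pi.neg_apply, ← integral_neg]
  congr 1
  funext t
  simp only [pairing, Pi.sub_apply, Pi.mul_apply]
  ring

theorem hasVariationAt_pairing {v : E3} (hv : AsympDirection γ₀ v) (hX : X ∈ vectorFields γ₀)
    (hY : Y ∈ vectorFields γ₀) (hZ : Z ∈ vectorFields γ₀) (γ : BAL γ₀) (s : ℝ) :
    vari (lift X) (pairing Y Z) γ s =
      -(inner ℝ (cross (tangent γ.1 s) (lift (opR X) γ s)) (cross (lift Y γ s) (lift Z γ s)) +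
        inner ℝ (tangent γ.1 s) (cross (covar X Y γ s) (lift Z γ s)) +
        inner ℝ (tangent γ.1 s) (cross (lift Y γ s) (covar X Z γ s))) := by
  refine (hasVariationAt_of_forall hX fun c h0 hc r h => ?_).vari_eq
  subst h0
  have h1 := (h.tame_tangent 0).tame₀.hasDerivAt 0 h.zero_mem s
  rw [h.tangent_variation hX hc s,
    (hasDerivAt_lift hX (c 0) s).unique (hasDerivAt_lift_cross hX (c 0) s)] at h1
  have h2 := (hasVariationAt_covar hv hX hY (c 0) s).1.hasDerivAt hc
  have h3 := (hasVariationAt_covar hv hX hZ (c 0) s).1.hasDerivAt hc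
  have h4 := (h1.inner ℝ (h2.cross h3)).neg
  have e : (fun ε => pairing Y Z (c ε) s) = -fun ε =>
      (inner ℝ (tangent (c ε).1 s) (cross (lift Y (c ε) s) (lift Z (c ε) s)) : ℝ) :=
    funext fun ε => pairing_apply Y Z (c ε) s
  rw [e]
  refine h4.congr_deriv ?_
  rw [inner_add_right]
  ring

theorem integ_eq_zero_of_hasDerivAt {f : ScalarField γ₀} (hf : f ∈ algSpace γ₀ 2) {γ : BAL γ₀}
    {F : ℝ → ℝ} {a : ℝ} (hd : ∀ s, HasDerivAt F (f γ s) s) (h1 : Tendsto F atTop (𝓝 a))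
    (h2 : Tendsto F atBot (𝓝 a)) : ∫ t, f γ t = 0 := by
  rw [integral_of_hasDerivAt_of_tendsto hd (Alg.integrable hf (by norm_num) γ) h2 h1, sub_self]

theorem integ_add {f g : ScalarField γ₀} (hf : f ∈ algSpace γ₀ 2) (hg : g ∈ algSpace γ₀ 2) :
    integ (f + g) = integ f + integ g := by
  funext γ _
  exact integral_add (Alg.integrable hf (by norm_num) γ) (Alg.integrable hg (by norm_num) γ)

theorem integ_sub {f g : ScalarField γ₀} (hf : f ∈ algSpace γ₀ 2) (hg : g ∈ algSpace γ₀ 2) :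
    integ (f - g) = integ f - integ g := by
  funext γ _
  exact integral_sub (Alg.integrable hf (by norm_num) γ) (Alg.integrable hg (by norm_num) γ)

/-- The exterior derivative of `∫ p (X, Y)` vanishes if its integrand is the derivative of a function
with equal limits at the two ends. -/
theorem extDeriv_integ {v : E3} (hv : AsympDirection γ₀ v) {p : NB γ₀ → NB γ₀ → ScalarField γ₀}
    (hp : ∀ X ∈ vectorFields γ₀, ∀ Y ∈ vectorFields γ₀, p X Y ∈ algSpace γ₀ 2)
    (hX : X ∈ vectorFields γ₀) (hY : Y ∈ vectorFields γ₀) (hZ : Z ∈ vectorFields γ₀)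
    (h : ∀ γ : BAL γ₀, ∃ (F : ℝ → ℝ) (a : ℝ), Tendsto F atTop (𝓝 a) ∧ Tendsto F atBot (𝓝 a) ∧
      ∀ s, HasDerivAt F ((vari (lift X) (p Y Z) γ s - p (bracket X Y) Z γ s) +
        (vari (lift Y) (p Z X) γ s - p (bracket Y Z) X γ s) +
        (vari (lift Z) (p X Y) γ s - p (bracket Z X) Y γ s)) s) :
    extDeriv (fun X Y => integ (p X Y)) X Y Z = 0 := by
  have key : ∀ {X Y Z : NB γ₀}, X ∈ vectorFields γ₀ → Y ∈ vectorFields γ₀ → Z ∈ vectorFields γ₀ →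
      vari (lift X) (p Y Z) ∈ algSpace γ₀ 2 ∧ p (bracket X Y) Z ∈ algSpace γ₀ 2 :=
    fun hX hY hZ => ⟨vari_mem hv hX (hp _ hY _ hZ), hp _ (bracket_mem hv hX hY) _ hZ⟩
  obtain ⟨a1, a2⟩ := key hX hY hZ
  obtain ⟨b1, b2⟩ := key hY hZ hX
  obtain ⟨c1, c2⟩ := key hZ hX hY
  simp only [extDeriv, act]
  rw [vari_integ hv hX (hp _ hY _ hZ), vari_integ hv hY (hp _ hZ _ hX),
    vari_integ hv hZ (hp _ hX _ hY), ← integ_sub a1 a2, ← integ_sub b1 b2, ← integ_sub c1 c2,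
    ← integ_add (Alg.sub a1 a2) (Alg.sub b1 b2),
    ← integ_add (Alg.add (Alg.sub a1 a2) (Alg.sub b1 b2)) (Alg.sub c1 c2)]
  funext γ _
  obtain ⟨F, a, h1, h2, hd⟩ := h γ
  exact integ_eq_zero_of_hasDerivAt
    (Alg.add (Alg.add (Alg.sub a1 a2) (Alg.sub b1 b2)) (Alg.sub c1 c2)) hd h1 h2

/-- `ω` is closed, since the integrand of `dω (X, Y, Z)` is the derivative of
`-det (℘ X, ℘ Y, ℘ Z)`. -/
theorem extDeriv_symp {v : E3} (hv : AsympDirection γ₀ v) (hX : X ∈ vectorFields γ₀)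
    (hY : Y ∈ vectorFields γ₀) (hZ : Z ∈ vectorFields γ₀) : extDeriv symp X Y Z = 0 := by
  refine extDeriv_integ (p := pairing) hv (fun _ h _ h' => pairing_mem h h') hX hY hZ fun γ => ?_
  have oX := lift_oddLimits hv hX γ
  have oY := lift_oddLimits hv hY γ
  have oZ := lift_oddLimits hv hZ γ
  obtain ⟨a, h1, h2⟩ := oX.inner (oY.cross oZ)
  refine ⟨_, -a, h1.neg, h2.neg, fun s => ?_⟩
  have hd := ((hasDerivAt_lift_cross hX γ s).inner ℝ ((hasDerivAt_lift_cross hY γ s).cross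
    (hasDerivAt_lift_cross hZ γ s))).neg
  refine hd.congr_deriv ?_
  rw [hasVariationAt_pairing hv hX hY hZ, hasVariationAt_pairing hv hY hZ hX,
    hasVariationAt_pairing hv hZ hX hY, bracket_eq_proj, bracket_eq_proj, bracket_eq_proj,
    pairing_proj, pairing_proj, pairing_proj]
  simp only [inner_coord, cross_zero_coord, cross_one_coord, cross_two_coord, Pi.sub_apply,
    PiLp.sub_apply, PiLp.add_apply]
  ring

/-- `ω (R X, Y) = -∫ ⟨(℘ X)', ℘ Y⟩` is skew-symmetric, by an integration by parts. -/
theorem symp_opR {v : E3} (hv : AsympDirection γ₀ v) (hX : X ∈ vectorFields γ₀)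
    (hY : Y ∈ vectorFields γ₀) : symp (opR X) Y = symp X (opR Y) := by
  have m1 := pairing_mem (opR_mem hX) hY
  have m2 := pairing_mem hX (opR_mem hY)
  rw [← sub_eq_zero, symp, symp, ← integ_sub m1 m2]
  funext γ _
  obtain ⟨a, h1, h2⟩ := (lift_oddLimits hv hX γ).inner (lift_oddLimits hv hY γ)
  refine integ_eq_zero_of_hasDerivAt (Alg.sub m1 m2) (fun s => ?_) h1.neg h2.neg
  refine ((hasDerivAt_lift_cross hX γ s).inner ℝ (hasDerivAt_lift_cross hY γ s)).neg.congr_deriv ?_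
  simp only [Pi.sub_apply, pairing_apply, inner_coord, cross_zero_coord, cross_one_coord,
    cross_two_coord]
  ring

/-- `ω (R X, Y)` is closed, since the integrand of its exterior derivative is the derivative of
the cyclic sum of `-⟨℘ Y, δ_X ℘ Z⟩`. -/
theorem extDeriv_symp_opR {v : E3} (hv : AsympDirection γ₀ v) (hX : X ∈ vectorFields γ₀)
    (hY : Y ∈ vectorFields γ₀) (hZ : Z ∈ vectorFields γ₀) :
    extDeriv (fun X Y => symp (opR X) Y) X Y Z = 0 := by
  refine extDeriv_integ (p := fun X Y => pairing (opR X) Y) hv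
    (fun _ h _ h' => pairing_mem (opR_mem h) h') hX hY hZ fun γ => ?_
  obtain ⟨a, a1, a2⟩ := (lift_oddLimits hv hY γ).inner (oddLimits_covar hv hX hZ γ)
  obtain ⟨b, b1, b2⟩ := (lift_oddLimits hv hZ γ).inner (oddLimits_covar hv hY hX γ)
  obtain ⟨c, c1, c2⟩ := (lift_oddLimits hv hX γ).inner (oddLimits_covar hv hZ hY γ)
  refine ⟨_, _, ((a1.add b1).add c1).neg, ((a2.add b2).add c2).neg, fun s => ?_⟩
  have hd := ((((hasDerivAt_lift_cross hY γ s).inner ℝ (hasDerivAt_covar hv hX hZ γ s)).add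
    ((hasDerivAt_lift_cross hZ γ s).inner ℝ (hasDerivAt_covar hv hY hX γ s))).add
    ((hasDerivAt_lift_cross hX γ s).inner ℝ (hasDerivAt_covar hv hZ hY γ s))).neg
  refine hd.congr_deriv ?_
  rw [hasVariationAt_pairing hv hX (opR_mem hY) hZ, hasVariationAt_pairing hv hY (opR_mem hZ) hX,
    hasVariationAt_pairing hv hZ (opR_mem hX) hY, opR_bracket hv hX hY, opR_bracket hv hY hZ,
    opR_bracket hv hZ hX, pairing_proj, pairing_proj, pairing_proj]
  simp only [covarCurl, inner_coord, cross_zero_coord, cross_one_coord, cross_two_coord,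
    PiLp.sub_apply, PiLp.add_apply]
  ring

end

/-! ### Adjoints of linear expressions -/

section

variable {X Y Z : NB γ₀} {F : ScalarField γ₀}

theorem vectorFields_add (hX : X ∈ vectorFields γ₀) (hY : Y ∈ vectorFields γ₀) :
    X + Y ∈ vectorFields γ₀ := ⟨Alg.add hX.1 hY.1, Alg.add hX.2 hY.2⟩

theorem vectorFields_scale {F : ScalarField γ₀} (hF : F ∈ algSpace γ₀ 0)
    (hX : X ∈ vectorFields γ₀) : scale F X ∈ vectorFields γ₀ :=
  ⟨Alg.mul hF hX.1 (by norm_num), Alg.mul hF hX.2 (by norm_num)⟩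

theorem vectorFields_zero : (0 : NB γ₀) ∈ vectorFields γ₀ := ⟨Alg.zero 1, Alg.zero 1⟩

theorem opJ_mem (hX : X ∈ vectorFields γ₀) : opJ X ∈ vectorFields γ₀ := ⟨hX.2, Alg.neg hX.1⟩

theorem riem_integrand_mem (hX : X ∈ vectorFields γ₀) (hY : Y ∈ vectorFields γ₀) :
    X.1 * Y.1 + X.2 * Y.2 ∈ algSpace γ₀ 2 :=
  Alg.add (Alg.mul hX.1 hY.1 (by norm_num)) (Alg.mul hX.2 hY.2 (by norm_num))

theorem riem_comm (X Y : NB γ₀) : riem X Y = riem Y X := by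
  rw [riem, riem, mul_comm X.1, mul_comm X.2]

theorem riem_add_right (hX : X ∈ vectorFields γ₀) (hY : Y ∈ vectorFields γ₀)
    (hZ : Z ∈ vectorFields γ₀) : riem X (Y + Z) = riem X Y + riem X Z := by
  rw [riem, riem, riem, ← integ_add (riem_integrand_mem hX hY) (riem_integrand_mem hX hZ)]
  congr 1
  simp only [Prod.fst_add, Prod.snd_add]
  ring

theorem integ_functional_mul (hF : ∀ γ s t, F γ s = F γ t) (f : ScalarField γ₀) :
    integ (F * f) = F * integ f := by
  funext γ s
  simp only [integ, Pi.mul_apply]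
  rw [← integral_const_mul]
  exact integral_congr_ae (Eventually.of_forall fun t => by simp only [hF γ t s])

theorem dsInv_functional_mul (hF : ∀ γ s t, F γ s = F γ t) (f : ScalarField γ₀) :
    dsInv (F * f) = F * dsInv f := by
  funext γ s
  have e : (F * f) γ = fun t => F γ s * f γ t := funext fun t => by
    simp only [Pi.mul_apply, hF γ t s]
  simp only [dsInv, e, Pi.mul_apply, integral_const_mul]
  ring

theorem ds_functional_mul (hF : ∀ γ s t, F γ s = F γ t) (f : ScalarField γ₀) :
    ds (F * f) = F * ds f := by
  funext γ s
  have e : (F * f) γ = fun t => F γ s * f γ t := funext fun t => by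
    simp only [Pi.mul_apply, hF γ t s]
  simp only [ds, e, Pi.mul_apply]
  exact deriv_const_mul_field _

theorem riem_scale_right (hF : ∀ γ s t, F γ s = F γ t) (X Y : NB γ₀) :
    riem X (scale F Y) = F * riem X Y := by
  rw [riem, riem, ← integ_functional_mul hF]
  congr 1
  simp only [scale]
  ring

theorem dsInv_add {f g : ScalarField γ₀} (hf : f ∈ algSpace γ₀ 2) (hg : g ∈ algSpace γ₀ 2) :
    dsInv (f + g) = dsInv f + dsInv g := by
  funext γ s
  have h1 := Alg.integrable hf (by norm_num) γ
  have h2 := Alg.integrable hg (by norm_num) γ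
  have e : (f + g) γ = fun t => f γ t + g γ t := rfl
  simp only [dsInv, e, Pi.add_apply]
  rw [integral_add h1.integrableOn h2.integrableOn, integral_add h1.integrableOn h2.integrableOn]
  ring

theorem ds_add {n : ℤ} {f g : ScalarField γ₀} (hf : f ∈ algSpace γ₀ n) (hg : g ∈ algSpace γ₀ n) :
    ds (f + g) = ds f + ds g := by
  funext γ s
  exact ((Alg.hasDerivAt hf γ s).add (Alg.hasDerivAt hg γ s)).deriv

theorem LinExpr.map_add {n : ℤ} {L : NB γ₀ → ScalarField γ₀} (hL : LinExpr n L)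
    (hX : X ∈ vectorFields γ₀) (hY : Y ∈ vectorFields γ₀) : L (X + Y) = L X + L Y := by
  induction hL with
  | fst => rfl
  | snd => rfl
  | add _ _ h₁ h₂ => simp only [h₁, h₂]; ring
  | mul _ _ h => simp only [h]; ring
  | ds hL h => simp only [h, ds_add (hL.mem_algSpace hX) (hL.mem_algSpace hY)]
  | dsInv hL h => simp only [h, dsInv_add (hL.mem_algSpace hX) (hL.mem_algSpace hY)]
  | integ hL h => simp only [h, integ_add (hL.mem_algSpace hX) (hL.mem_algSpace hY)]

theorem LinExpr.map_scale {n : ℤ} {L : NB γ₀ → ScalarField γ₀} (hL : LinExpr n L)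
    (hF : ∀ γ s t, F γ s = F γ t) (X : NB γ₀) : L (scale F X) = F * L X := by
  induction hL with
  | fst => rfl
  | snd => rfl
  | add _ _ h₁ h₂ => simp only [h₁, h₂]; ring
  | mul _ _ h => simp only [h]; ring
  | ds _ h => simp only [h, ds_functional_mul hF]
  | dsInv _ h => simp only [h, dsInv_functional_mul hF]
  | integ _ h => simp only [h, integ_functional_mul hF]

theorem integ_mul_ds {i j : ℤ} {a f : ScalarField γ₀} (ha : a ∈ algSpace γ₀ i)
    (hf : f ∈ algSpace γ₀ j) (h : 2 ≤ i + j) : integ (a * ds f) = integ (-ds a * f) := by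
  have m1 : a * ds f ∈ algSpace γ₀ 2 := Alg.mul ha (Alg.ds hf) h
  have m2 : -ds a * f ∈ algSpace γ₀ 2 := Alg.mul (Alg.neg (Alg.ds ha)) hf h
  rw [← sub_eq_zero, ← integ_sub m1 m2]
  funext γ _
  have ht := Alg.tendsto (Alg.mul ha hf h) (by norm_num) γ
  rw [cocompact_eq_atBot_atTop, tendsto_sup] at ht
  refine integ_eq_zero_of_hasDerivAt (Alg.sub m1 m2) (fun s => ?_) ht.2 ht.1
  refine ((Alg.hasDerivAt ha γ s).mul (Alg.hasDerivAt hf γ s)).congr_deriv ?_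
  simp only [Pi.sub_apply, Pi.mul_apply, Pi.neg_apply]
  ring

theorem integ_mul_dsInv {a f : ScalarField γ₀} (ha : a ∈ algSpace γ₀ 2)
    (hf : f ∈ algSpace γ₀ 2) : integ (a * dsInv f) = integ (-dsInv a * f) := by
  have m1 : a * dsInv f ∈ algSpace γ₀ 2 := Alg.mul ha (Alg.dsInv hf) (by norm_num)
  have m2 : -dsInv a * f ∈ algSpace γ₀ 2 := Alg.mul (Alg.neg (Alg.dsInv ha)) hf (by norm_num)
  rw [← sub_eq_zero, ← integ_sub m1 m2]
  funext γ _
  have i1 := Alg.integrable ha (by norm_num) γ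
  have i2 := Alg.integrable hf (by norm_num) γ
  have t2 := (tendsto_halfInt_atBot i1).mul (tendsto_halfInt_atBot i2)
  rw [neg_mul_neg] at t2
  refine integ_eq_zero_of_hasDerivAt (Alg.sub m1 m2) (fun s => ?_)
    ((tendsto_halfInt_atTop i1).mul (tendsto_halfInt_atTop i2)) t2
  refine ((Alg.hasDerivAt_dsInv ha (by norm_num) γ s).mul
    (Alg.hasDerivAt_dsInv hf (by norm_num) γ s)).congr_deriv ?_
  simp only [Pi.sub_apply, Pi.mul_apply, Pi.neg_apply, dsInv_apply]
  ring

/-- Linear expressions have formal adjoints: integration by parts moves all operators onto the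
coefficients. -/
theorem LinExpr.exists_adjoint {n : ℤ} {L : NB γ₀ → ScalarField γ₀} (hL : LinExpr n L)
    {a : ScalarField γ₀} (ha : a ∈ algSpace γ₀ (2 - n)) :
    ∃ Z ∈ vectorFields γ₀, ∀ X ∈ vectorFields γ₀, VortexFilament.integ (a * L X) = riem Z X := by
  induction hL generalizing a with
  | fst =>
    exact ⟨(a, 0), ⟨ha, Alg.zero 1⟩, fun X _ => by simp [riem]⟩
  | snd =>
    exact ⟨(0, a), ⟨Alg.zero 1, ha⟩, fun X _ => by simp [riem]⟩
  | add h₁ h₂ ih₁ ih₂ =>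
    obtain ⟨Z, hZ, e⟩ := ih₁ ha
    obtain ⟨Z', hZ', e'⟩ := ih₂ ha
    refine ⟨Z + Z', vectorFields_add hZ hZ', fun X hX => ?_⟩
    rw [riem_comm, riem_add_right hX hZ hZ', riem_comm X, riem_comm X, ← e X hX, ← e' X hX,
      ← integ_add (Alg.mul ha (h₁.mem_algSpace hX) (by omega))
        (Alg.mul ha (h₂.mem_algSpace hX) (by omega)), mul_add]
  | mul hb _ ih =>
    obtain ⟨Z, hZ, e⟩ := ih (Alg.mul ha hb (by omega))
    exact ⟨Z, hZ, fun X hX => by rw [← e X hX, mul_assoc]⟩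
  | ds h ih =>
    obtain ⟨Z, hZ, e⟩ := ih (Alg.neg (Alg.ds ha))
    exact ⟨Z, hZ, fun X hX => by rw [← e X hX, integ_mul_ds ha (h.mem_algSpace hX) (by omega)]⟩
  | dsInv h ih =>
    obtain ⟨Z, hZ, e⟩ := ih (a := -VortexFilament.dsInv _) (Alg.neg (Alg.dsInv ha))
    exact ⟨Z, hZ, fun X hX => by rw [← e X hX, integ_mul_dsInv ha (h.mem_algSpace hX)]⟩
  | integ h ih =>
    obtain ⟨Z, hZ, e⟩ := ih (a := VortexFilament.integ _) (Alg.integ ha)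
    refine ⟨Z, hZ, fun X hX => ?_⟩
    rw [← e X hX, mul_comm, integ_functional_mul (fun _ _ _ => rfl),
      integ_functional_mul (fun _ _ _ => rfl), mul_comm]

theorem LinExpr.exists_riem {L : NB γ₀ → ScalarField γ₀} (hL : LinExpr 2 L) :
    ∃ Z ∈ vectorFields γ₀, ∀ X ∈ vectorFields γ₀, VortexFilament.integ (L X) = riem Z X := by
  simpa using hL.exists_adjoint (a := 1) Alg.one

/-! ### One-forms -/

theorem Window.Tame.time {D : Window} (hI : ∀ ε ∈ D.I, |ε| ≤ 1) (k : ℕ) :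
    D.Tame k 0 (fun ε _ => ε) (fun _ _ => (1 : ℝ)) := by
  have h0 : D.Tame₀ 0 (fun ε _ => ε) (fun _ _ => (1 : ℝ)) :=
    ⟨⟨1, 0, fun ε hε s => by simpa using hI ε hε⟩, ⟨1, 0, by simp⟩, fun _ _ => continuous_const,
      fun _ _ => continuous_const, fun _ _ _ => hasDerivAt_id _⟩
  cases k with
  | zero => exact h0
  | succ k =>
    exact ⟨h0, _, _, fun ε _ s => ⟨hasDerivAt_const _ _, hasDerivAt_const _ _⟩, Tame.const D k 0⟩

theorem deformable_smul {L : NB γ₀ → ScalarField γ₀} (hL : LinExpr 1 L)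
    (h : ∀ (t : ℝ) (X : NB γ₀), L (t • X) = t • L X) :
    Deformable (constRel (fun (X : NB γ₀) (t : ℝ) => t • X) (vectorFields γ₀)) 1 L := by
  refine ⟨L, hL, ?_⟩
  rintro X c r y ⟨hX, ⟨γ, rfl⟩, rfl, rfl⟩ h'
  refine ⟨fun _ => L X γ, fun k => ?_, rfl⟩
  have h1 : ∀ ε ∈ (curveWindow γ).I, |ε| ≤ 1 := fun ε hε => (abs_lt.2 hε).le
  have := (Window.Tame.time h1 k).mul (tameSmooth_of_mem (hL.mem_algSpace hX) γ k)
  refine (this.congr (fun ε _ => ?_) fun ε _ => ?_)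
  · funext s; rw [h]; rfl
  · funext s; simp

/-- The derivative at `0` of a functional-valued expression exists, and is represented by a vector
field. -/
theorem exists_hasDerivAt_smul {Φ : NB γ₀ → ScalarField γ₀} (hΦ : Φ ∈ functionalVars γ₀) :
    Φ 0 ∈ functionals γ₀ ∧ ∃ Z ∈ vectorFields γ₀, ∀ X ∈ vectorFields γ₀, ∀ γ s,
      HasDerivAt (fun t : ℝ => Φ (t • X) γ s) (riem Z X γ s) 0 := by
  have r0 : ∀ X : NB γ₀, riem 0 X = 0 := fun X => by
    funext γ s
    simp [riem, integ]
  induction hΦ using Algebra.adjoin_induction with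
  | mem Φ hΦ =>
    rcases hΦ with hΦ | ⟨f, hf, rfl⟩
    · rw [Set.mem_singleton_iff.1 hΦ]
      refine ⟨Algebra.subset_adjoin (Or.inl rfl), 0, vectorFields_zero, fun X _ γ s => ?_⟩
      rw [r0]
      exact hasDerivAt_const _ _
    · have hvars : ∀ v ∈ ({Prod.fst, Prod.snd} : Set (NB γ₀ → ScalarField γ₀)),
          v 0 ∈ algSpace γ₀ 1 := by
        rintro v (rfl | rfl)
        exacts [Alg.zero 1, Alg.zero 1]
      refine ⟨Algebra.subset_adjoin (Or.inr ⟨_, hf.subst hvars, rfl⟩), ?_⟩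
      obtain ⟨L, hL, h⟩ := AlgVar.deformable_const hvars (fun (X : NB γ₀) (t : ℝ) => t • X)
        (vectorFields γ₀) (fun X _ => zero_smul ℝ X) (by
          rintro v (rfl | rfl)
          exacts [deformable_smul LinExpr.fst fun _ _ => rfl,
            deformable_smul LinExpr.snd fun _ _ => rfl]) hf
      obtain ⟨Z, hZ, e⟩ := hL.exists_riem
      refine ⟨Z, hZ, fun X hX γ s => ?_⟩
      obtain ⟨G, hG, e'⟩ := h X (fun _ => γ) 1 _ ⟨hX, ⟨γ, rfl⟩, rfl, rfl⟩ (RegularFamily.const γ)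
      have := (Window.Tame.integ (k := 0) (by simpa using (hG 0).lower.tame₀)).tame₀.hasDerivAt 0
        (zero_mem_curveWindow γ) s
      rw [e'] at this
      rw [← e X hX]
      exact this
  | algebraMap r =>
    refine ⟨Subalgebra.algebraMap_mem _ r, 0, vectorFields_zero, fun X _ γ s => ?_⟩
    rw [r0]
    exact hasDerivAt_const _ _
  | add Φ Ψ _ _ h₁ h₂ =>
    obtain ⟨f₁, Z₁, hZ₁, h₁⟩ := h₁
    obtain ⟨f₂, Z₂, hZ₂, h₂⟩ := h₂
    refine ⟨Subalgebra.add_mem _ f₁ f₂, Z₁ + Z₂, vectorFields_add hZ₁ hZ₂, fun X hX γ s => ?_⟩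
    rw [riem_comm, riem_add_right hX hZ₁ hZ₂, riem_comm X, riem_comm X]
    exact (h₁ X hX γ s).add (h₂ X hX γ s)
  | mul Φ Ψ _ _ h₁ h₂ =>
    obtain ⟨f₁, Z₁, hZ₁, h₁⟩ := h₁
    obtain ⟨f₂, Z₂, hZ₂, h₂⟩ := h₂
    have g₁ := functionals_le f₁
    have g₂ := functionals_le f₂
    have m₁ := vectorFields_scale g₂.1 hZ₁
    have m₂ := vectorFields_scale g₁.1 hZ₂
    refine ⟨Subalgebra.mul_mem _ f₁ f₂, _, vectorFields_add m₁ m₂, fun X hX γ s => ?_⟩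
    rw [riem_comm, riem_add_right hX m₁ m₂, riem_scale_right g₂.2, riem_scale_right g₁.2,
      riem_comm X, riem_comm X]
    refine ((h₁ X hX γ s).mul (h₂ X hX γ s)).congr_deriv ?_
    simp only [zero_smul, Pi.add_apply, Pi.mul_apply]
    ring

variable {η ξ : NB γ₀ → ScalarField γ₀}

/-- One-forms are represented by vector fields with respect to the Riemannian structure: a one-form
is real linear, so it is its own derivative at `0`. -/
theorem IsOneForm.exists_riem (h : IsOneForm η) :
    ∃ Z ∈ vectorFields γ₀, ∀ X ∈ vectorFields γ₀, η X = riem Z X := by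
  obtain ⟨Φ, hΦ, e⟩ := h.algebraic
  obtain ⟨-, Z, hZ, hd⟩ := exists_hasDerivAt_smul hΦ
  refine ⟨Z, hZ, fun X hX => ?_⟩
  funext γ s
  have key : ∀ t : ℝ, Φ (t • X) γ s = t * η X γ s := fun t => by
    have ht : algebraMap ℝ (ScalarField γ₀) t ∈ functionals γ₀ := Subalgebra.algebraMap_mem _ t
    have h1 : scale (algebraMap ℝ (ScalarField γ₀) t) X = t • X := by
      simp only [scale, ← Algebra.smul_def]
      rfl
    have h2 : t • X ∈ vectorFields γ₀ := ⟨Alg.smul t hX.1, Alg.smul t hX.2⟩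
    rw [← e _ h2, ← h1, h.map_scale _ ht X hX, ← Algebra.smul_def]
    rfl
  have h1 := hd X hX γ s
  simp only [key] at h1
  simpa using ((hasDerivAt_id (0 : ℝ)).mul_const (η X γ s)).unique h1

theorem isOneForm_of_eq_riem (hZ : Z ∈ vectorFields γ₀)
    (h : ∀ X ∈ vectorFields γ₀, η X = riem Z X) : IsOneForm η where
  mem_functionals X hX := by
    rw [h X hX]
    exact Algebra.subset_adjoin (Or.inr ⟨_, riem_integrand_mem hZ hX, rfl⟩)
  map_add X hX Y hY := by
    rw [h X hX, h Y hY, h _ (vectorFields_add hX hY), riem_add_right hZ hX hY]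
  map_scale F hF X hX := by
    obtain ⟨h0, hF⟩ := functionals_le hF
    rw [h X hX, h _ (vectorFields_scale h0 hX), riem_scale_right hF]
  algebraic := by
    refine ⟨fun X => riem Z X, Algebra.subset_adjoin (Or.inr ⟨_, ?_, rfl⟩), h⟩
    exact AlgVar.add (AlgVar.mul (AlgVar.of_mem hZ.1) (AlgVar.var (Or.inl rfl)))
      (AlgVar.mul (AlgVar.of_mem hZ.2) (AlgVar.var (Or.inr rfl)))

theorem isOneForm_riem (hX : X ∈ vectorFields γ₀) : IsOneForm (riem X) :=
  isOneForm_of_eq_riem hX fun _ _ => rfl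

/-- The Riemannian structure is nondegenerate. -/
theorem eq_of_riem_eq (hX : X ∈ vectorFields γ₀) (hY : Y ∈ vectorFields γ₀)
    (h : ∀ Z ∈ vectorFields γ₀, riem Z X = riem Z Y) : X = Y := by
  set D : NB γ₀ := (X.1 - Y.1, X.2 - Y.2)
  have hD : D ∈ vectorFields γ₀ := ⟨Alg.sub hX.1 hY.1, Alg.sub hX.2 hY.2⟩
  have hDY : D + Y = X := by ext <;> simp [D]
  have h0 : riem D D = 0 := by
    have := riem_add_right hD hD hY
    rw [hDY, h D hD] at this
    exact (right_eq_add.1 this)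
  have key : ∀ γ s, D.1 γ s = 0 ∧ D.2 γ s = 0 := fun γ s => by
    have hm := riem_integrand_mem hD hD
    have h1 : ∫ t, (D.1 * D.1 + D.2 * D.2 : ScalarField γ₀) γ t = 0 := congrFun (congrFun h0 γ) 0
    have h2 := (integral_eq_zero_iff_of_nonneg
      (fun t => add_nonneg (mul_self_nonneg (D.1 γ t)) (mul_self_nonneg (D.2 γ t)))
      (Alg.integrable hm (by norm_num) γ)).1 h1
    have h3 := congrFun ((Alg.contDiff hm γ).continuous.ae_eq_iff_eq volume continuous_zero |>.1 h2) s
    simp only [Pi.add_apply, Pi.mul_apply, Pi.zero_apply] at h3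
    exact mul_self_add_mul_self_eq_zero.1 h3
  refine Prod.ext ?_ ?_ <;> funext γ s
  exacts [sub_eq_zero.1 (key γ s).1, sub_eq_zero.1 (key γ s).2]

theorem isH0_opJ (hZ : Z ∈ vectorFields γ₀) (h : ∀ X ∈ vectorFields γ₀, η X = riem Z X) :
    IsH0 η (opJ Z) := by
  refine ⟨opJ_mem hZ, fun Y hY => ?_⟩
  rw [h _ (opJ_mem hY)]
  funext γ s
  simp only [riem, integ, Pi.neg_apply, ← integral_neg]
  congr 1
  funext t
  simp only [opJ, Pi.add_apply, Pi.mul_apply, Pi.neg_apply]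
  ring

theorem IsOneForm.existsUnique_isH0 (h : IsOneForm η) : ∃! X, IsH0 η X := by
  obtain ⟨Z, hZ, e⟩ := h.exists_riem
  refine ⟨_, isH0_opJ hZ e, fun X hX => ?_⟩
  have hJ := isH0_opJ hZ e
  exact eq_of_riem_eq hX.1 hJ.1 fun Y hY => by rw [hX.2 Y hY, hJ.2 Y hY]

theorem opH0_eq (hZ : Z ∈ vectorFields γ₀) (h : ∀ X ∈ vectorFields γ₀, η X = riem Z X) :
    opH0 η = opJ Z := by
  have hex : ∃ X, IsH0 η X := ⟨_, isH0_opJ hZ h⟩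
  rw [opH0, dif_pos hex]
  exact (isOneForm_of_eq_riem hZ h).existsUnique_isH0.unique hex.choose_spec (isH0_opJ hZ h)

theorem IsOneForm.opH0_mem (h : IsOneForm η) : opH0 η ∈ vectorFields γ₀ := by
  obtain ⟨Z, hZ, e⟩ := h.exists_riem
  rw [opH0_eq hZ e]
  exact opJ_mem hZ

/-- `H₀` inverts the identification of vector fields with one-forms given by `ω`. -/
theorem IsOneForm.eq_symp (h : IsOneForm η) (hX : X ∈ vectorFields γ₀) :
    η X = symp X (opH0 η) := by
  obtain ⟨Z, hZ, e⟩ := h.exists_riem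
  rw [opH0_eq hZ e, e X hX, riem, symp, pairing]
  congr 1
  simp only [opJ]
  ring

/-- Lie derivatives of one-forms are one-forms. -/
theorem isOneForm_lieForm {v : E3} (hv : AsympDirection γ₀ v) (hX : X ∈ vectorFields γ₀)
    (h : IsOneForm η) : IsOneForm (lieForm X η) := by
  obtain ⟨Z, hZ, e⟩ := h.exists_riem
  obtain ⟨L₁, hL₁, e₁⟩ := exists_vari_linExpr hv hX.1
  obtain ⟨L₂, hL₂, e₂⟩ := exists_vari_linExpr hv hX.2
  have hk := Alg.dsInv (kappa_fst_mem hX)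
  have hN : LinExpr 1 (fun Y : NB γ₀ =>
      L₁ Y + VortexFilament.dsInv (kappa * X.1) * strainN Y - X.2 * spin Y) :=
    (hL₁.add (LinExpr.mul_le hk linExpr_strainN (by omega))).sub
      (LinExpr.mul_le hX.2 linExpr_spin (by omega))
  have hB : LinExpr 1 (fun Y : NB γ₀ =>
      L₂ Y + VortexFilament.dsInv (kappa * X.1) * strainB Y + X.1 * spin Y) :=
    (hL₂.add (LinExpr.mul_le hk linExpr_strainB (by omega))).add
      (LinExpr.mul_le hX.1 linExpr_spin (by omega))
  have hd : LinExpr 0 (fun Y : NB γ₀ => VortexFilament.dsInv (kappa * Y.1)) :=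
    linExpr_kappa_fst.dsInv
  -- `X (η Y) - η [X, Y]` is linear in `Y`, and involves no `δ_X Y`: the derivatives of the
  -- components of `Y` along `X` occur in both terms and cancel
  have hM : LinExpr 2 (fun Y : NB γ₀ =>
      (vari (lift X) Z.1 * Y.1 + vari (lift X) Z.2 * Y.2) -
      (Z.1 * ((strainN X * VortexFilament.dsInv (kappa * Y.1) - spin X * Y.2) -
        (L₁ Y + VortexFilament.dsInv (kappa * X.1) * strainN Y - X.2 * spin Y)) +
      Z.2 * ((strainB X * VortexFilament.dsInv (kappa * Y.1) + spin X * Y.1) -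
        (L₂ Y + VortexFilament.dsInv (kappa * X.1) * strainB Y + X.1 * spin Y)))) :=
    ((LinExpr.mul_le (vari_mem hv hX hZ.1) LinExpr.fst (by omega)).add
      (LinExpr.mul_le (vari_mem hv hX hZ.2) LinExpr.snd (by omega))).sub
    ((LinExpr.mul_le hZ.1 (((LinExpr.mul_le (strainN_mem hX) hd (by omega : (1 : ℤ) ≤ 1 + 0)).sub
      (LinExpr.mul_le (spin_mem hX) LinExpr.snd (by omega))).sub hN) (by omega)).add
    (LinExpr.mul_le hZ.2 (((LinExpr.mul_le (strainB_mem hX) hd (by omega : (1 : ℤ) ≤ 1 + 0)).add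
      (LinExpr.mul_le (spin_mem hX) LinExpr.fst (by omega))).sub hB) (by omega)))
  obtain ⟨Z', hZ', e'⟩ := hM.exists_riem
  refine isOneForm_of_eq_riem hZ' fun Y hY => ?_
  have hb := bracket_mem hv hX hY
  rw [← e' Y hY, lieForm, act, e _ hb]
  have e3 : η Y = riem Z Y := e Y hY
  have m : ∀ {f g : ScalarField γ₀}, f ∈ algSpace γ₀ 1 → g ∈ algSpace γ₀ 1 →
      f * g ∈ algSpace γ₀ 2 := fun hf hg => Alg.mul hf hg (by norm_num)
  have hm := riem_integrand_mem hZ hY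
  rw [e3, riem, riem, vari_integ hv hX hm, ← integ_sub (vari_mem hv hX hm)
    (riem_integrand_mem hZ hb), vari_add hv hX (m hZ.1 hY.1) (m hZ.2 hY.2),
    vari_mul hv hX hZ.1 hY.1, vari_mul hv hX hZ.2 hY.2, bracket_eq hv hX hY]
  congr 1
  simp only [covarN, covarB, (e₁ Y hY).1, (e₂ Y hY).1]
  ring

end

/-! ### The hierarchy of symplectic forms -/

section

variable {X Y Z : NB γ₀} {F : ScalarField γ₀}

theorem opR_add (hX : X ∈ vectorFields γ₀) (hY : Y ∈ vectorFields γ₀) :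
    opR (X + Y) = opR X + opR Y := by
  rw [opR_eq hX, opR_eq hY, opR_eq (vectorFields_add hX hY), linExpr_strainB.map_add hX hY,
    linExpr_strainN.map_add hX hY, neg_add]
  rfl

theorem opR_scale (hF : F ∈ functionals γ₀) (hX : X ∈ vectorFields γ₀) :
    opR (scale F X) = scale F (opR X) := by
  obtain ⟨h0, h1⟩ := functionals_le hF
  rw [opR_eq hX, opR_eq (vectorFields_scale h0 hX), linExpr_strainB.map_scale h1,
    linExpr_strainN.map_scale h1, ← mul_neg]
  rfl

theorem opR_iterate_mem (n : ℕ) (hX : X ∈ vectorFields γ₀) : opR^[n] X ∈ vectorFields γ₀ := by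
  induction n generalizing X with
  | zero => exact hX
  | succ n ih => exact ih (opR_mem hX)

theorem opR_iterate_add (n : ℕ) (hX : X ∈ vectorFields γ₀) (hY : Y ∈ vectorFields γ₀) :
    opR^[n] (X + Y) = opR^[n] X + opR^[n] Y := by
  induction n generalizing X Y with
  | zero => rfl
  | succ n ih =>
    rw [Function.iterate_succ_apply, opR_add hX hY, ih (opR_mem hX) (opR_mem hY)]
    rfl

theorem opR_iterate_scale (n : ℕ) (hF : F ∈ functionals γ₀) (hX : X ∈ vectorFields γ₀) :
    opR^[n] (scale F X) = scale F (opR^[n] X) := by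
  induction n generalizing X with
  | zero => rfl
  | succ n ih =>
    rw [Function.iterate_succ_apply, opR_scale hF hX, ih (opR_mem hX)]
    rfl

theorem symp_add_left (hX : X ∈ vectorFields γ₀) (hY : Y ∈ vectorFields γ₀)
    (hZ : Z ∈ vectorFields γ₀) : symp (X + Y) Z = symp X Z + symp Y Z := by
  rw [symp, symp, symp, ← integ_add (pairing_mem hX hZ) (pairing_mem hY hZ)]
  congr 1
  simp only [pairing, Prod.fst_add, Prod.snd_add]
  ring

/-- The two-forms `ωₙ = ω (Rⁿ ·, ·)`. -/
def sympIter (n : ℕ) (X Y : NB γ₀) : ScalarField γ₀ := symp (opR^[n] X) Y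

variable {v : E3}

theorem symp_opR_iterate (hv : AsympDirection γ₀ v) (n : ℕ) (hX : X ∈ vectorFields γ₀)
    (hY : Y ∈ vectorFields γ₀) : symp X (opR^[n] Y) = sympIter n X Y := by
  induction n generalizing X with
  | zero => rfl
  | succ n ih =>
    rw [Function.iterate_succ_apply', ← symp_opR hv hX (opR_iterate_mem n hY), ih (opR_mem hX)]
    rfl

theorem sympIter_opR_iterate (hv : AsympDirection γ₀ v) (m n : ℕ) (hX : X ∈ vectorFields γ₀)
    (hY : Y ∈ vectorFields γ₀) : sympIter m X (opR^[n] Y) = sympIter (m + n) X Y := by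
  rw [sympIter, symp_opR_iterate hv n (opR_iterate_mem m hX) hY, sympIter, sympIter,
    ← Function.iterate_add_apply, add_comm]

theorem sympIter_opR_left (n : ℕ) (X Y : NB γ₀) : sympIter n (opR X) Y = sympIter (n + 1) X Y :=
  rfl

theorem sympIter_opR_right (hv : AsympDirection γ₀ v) (n : ℕ) (hX : X ∈ vectorFields γ₀)
    (hY : Y ∈ vectorFields γ₀) : sympIter n X (opR Y) = sympIter (n + 1) X Y :=
  sympIter_opR_iterate hv n 1 hX hY

theorem sympIter_add_left (n : ℕ) (hX : X ∈ vectorFields γ₀) (hY : Y ∈ vectorFields γ₀)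
    (hZ : Z ∈ vectorFields γ₀) : sympIter n (X + Y) Z = sympIter n X Z + sympIter n Y Z := by
  rw [sympIter, opR_iterate_add n hX hY,
    symp_add_left (opR_iterate_mem n hX) (opR_iterate_mem n hY) hZ]
  rfl

/-- The vanishing of the torsion of `R`, paired with `Z`. -/
theorem sympIter_nijenhuis (hv : AsympDirection γ₀ v) (n : ℕ) (hX : X ∈ vectorFields γ₀)
    (hY : Y ∈ vectorFields γ₀) (hZ : Z ∈ vectorFields γ₀) :
    sympIter (n + 2) (bracket X Y) Z + sympIter n (bracket (opR X) (opR Y)) Z =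
      sympIter (n + 1) (bracket (opR X) Y) Z + sympIter (n + 1) (bracket X (opR Y)) Z := by
  have h1 := bracket_mem hv hX hY
  have h2 := bracket_mem hv (opR_mem hX) hY
  have h3 := bracket_mem hv hX (opR_mem hY)
  have h4 := bracket_mem hv (opR_mem hX) (opR_mem hY)
  rw [← sympIter_opR_left (n + 1), ← sympIter_opR_left n (opR _), ← sympIter_opR_left n,
    ← sympIter_opR_left n, ← sympIter_add_left n (opR_mem (opR_mem h1)) h4 hZ,
    ← sympIter_add_left n (opR_mem h2) (opR_mem h3) hZ, nijenhuis hv hX hY, sub_add_cancel]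

/-- All the forms `ωₙ` are closed: as `R` has no torsion, `dωₙ₊₂` is expressed by `dωₙ` and
`dωₙ₊₁`. -/
theorem extDeriv_sympIter (hv : AsympDirection γ₀ v) (n : ℕ) (hX : X ∈ vectorFields γ₀)
    (hY : Y ∈ vectorFields γ₀) (hZ : Z ∈ vectorFields γ₀) : extDeriv (sympIter n) X Y Z = 0 := by
  have key : ∀ n : ℕ,
      (∀ X ∈ vectorFields γ₀, ∀ Y ∈ vectorFields γ₀, ∀ Z ∈ vectorFields γ₀,
        extDeriv (sympIter n) X Y Z = 0) ∧
      (∀ X ∈ vectorFields γ₀, ∀ Y ∈ vectorFields γ₀, ∀ Z ∈ vectorFields γ₀,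
        extDeriv (sympIter (n + 1)) X Y Z = 0) := by
    intro n
    induction n with
    | zero =>
      exact ⟨fun X hX Y hY Z hZ => extDeriv_symp hv hX hY hZ,
        fun X hX Y hY Z hZ => extDeriv_symp_opR hv hX hY hZ⟩
    | succ n ih =>
      refine ⟨ih.2, fun X hX Y hY Z hZ => ?_⟩
      have rX := opR_mem hX
      have rY := opR_mem hY
      have h1 := ih.1 _ rX _ rY _ hZ
      have h2 := ih.2 _ rX _ hY _ hZ
      have h3 := ih.2 _ hX _ rY _ hZ
      have h4 := sympIter_nijenhuis hv n hX hY hZ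
      simp only [extDeriv] at h1 h2 h3 ⊢
      rw [sympIter_opR_left, sympIter_opR_left, sympIter_opR_right hv n hZ hX,
        sympIter_opR_right hv n (bracket_mem hv rY hZ) hX,
        sympIter_opR_right hv n (bracket_mem hv hZ rX) hY,
        sympIter_opR_right hv (n + 1) hX hY] at h1
      rw [sympIter_opR_right hv (n + 1) hZ hX, sympIter_opR_left (n + 1),
        sympIter_opR_right hv (n + 1) (bracket_mem hv hY hZ) hX] at h2
      rw [sympIter_opR_left (n + 1), sympIter_opR_right hv (n + 1) hX hY,
        sympIter_opR_right hv (n + 1) (bracket_mem hv hZ hX) hY] at h3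
      -- the terms with brackets of `X` and `Y` are matched by `h4`, and the others cancel
      linear_combination -h1 + h2 + h3 - h4
  exact (key n).1 X hX Y hY Z hZ

/-! ### The Hamiltonian pairs -/

variable {ξ η ζ : NB γ₀ → ScalarField γ₀}

theorem opH0_add (hξ : IsOneForm ξ) (hη : IsOneForm η) : opH0 (ξ + η) = opH0 ξ + opH0 η := by
  obtain ⟨X, hX, e⟩ := hξ.exists_riem
  obtain ⟨Y, hY, e'⟩ := hη.exists_riem
  rw [opH0_eq hX e, opH0_eq hY e', opH0_eq (vectorFields_add hX hY) fun Z hZ => by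
    rw [riem_comm, riem_add_right hZ hX hY, riem_comm Z, riem_comm Z, ← e Z hZ, ← e' Z hZ]; rfl]
  ext <;> simp [opJ, add_comm]

theorem opH0_scale (hF : F ∈ functionals γ₀) (hη : IsOneForm η) :
    opH0 (fun X => F * η X) = scale F (opH0 η) := by
  obtain ⟨Y, hY, e⟩ := hη.exists_riem
  obtain ⟨h0, h1⟩ := functionals_le hF
  rw [opH0_eq hY e, opH0_eq (vectorFields_scale h0 hY) fun Z hZ => by
    rw [riem_comm, riem_scale_right h1, riem_comm Z, ← e Z hZ]]
  simp [opJ, scale]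

theorem sympIter_antisymm (hv : AsympDirection γ₀ v) (n : ℕ) (hX : X ∈ vectorFields γ₀)
    (hY : Y ∈ vectorFields γ₀) : sympIter n X Y = -sympIter n Y X := by
  rw [sympIter, symp_antisymm, symp_opR_iterate hv n hY hX]

theorem isSkewOperator_opH (hv : AsympDirection γ₀ v) (n : ℕ) :
    IsSkewOperator (γ₀ := γ₀) (opH n) where
  mem_vectorFields η hη := opR_iterate_mem n hη.opH0_mem
  map_add ξ η hξ hη := by
    rw [opH, opH0_add hξ hη, opR_iterate_add n hξ.opH0_mem hη.opH0_mem]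
    rfl
  map_scale F hF η hη := by
    rw [opH, opH0_scale hF hη, opR_iterate_scale n hF hη.opH0_mem]
    rfl
  skew ξ η hξ hη := by
    rw [opH, opH, hξ.eq_symp (opR_iterate_mem n hη.opH0_mem), hη.eq_symp (opR_iterate_mem n hξ.opH0_mem)]
    exact sympIter_antisymm hv n hη.opH0_mem hξ.opH0_mem

/-- The terms of the Schouten bracket, expressed by `ω`. -/
theorem apply_opH_lieForm (hv : AsympDirection γ₀ v) (m n : ℕ) (hξ : IsOneForm ξ)
    (hη : IsOneForm η) (hζ : IsOneForm ζ) :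
    ξ (opH m (lieForm (opH n η) ζ)) =
      -(act (opR^[n] (opH0 η)) (symp (opR^[m] (opH0 ξ)) (opH0 ζ)) -
        symp (bracket (opR^[n] (opH0 η)) (opR^[m] (opH0 ξ))) (opH0 ζ)) := by
  have mX := opR_iterate_mem m hξ.opH0_mem
  have mY := opR_iterate_mem n hη.opH0_mem
  have hl := isOneForm_lieForm hv mY hζ
  have h1 := (isSkewOperator_opH hv m).skew _ _ hξ hl
  have h2 : ζ (opR^[m] (opH0 ξ)) = symp (opR^[m] (opH0 ξ)) (opH0 ζ) := hζ.eq_symp mX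
  refine h1.trans ?_
  simp only [opH, lieForm]
  rw [h2, hζ.eq_symp (bracket_mem hv mY mX)]

/-- A reduction of the terms of the Schouten bracket, by the closedness of `ω` and of `ωₙ`. The
last two terms cancel after cyclic summation and symmetrization in `m` and `n`. -/
theorem act_symp_sub (hv : AsympDirection γ₀ v) (m n : ℕ) (hX : X ∈ vectorFields γ₀)
    (hY : Y ∈ vectorFields γ₀) (hZ : Z ∈ vectorFields γ₀) :
    act (opR^[n] Y) (symp (opR^[m] X) Z) - symp (bracket (opR^[n] Y) (opR^[m] X)) Z =
      act Y (sympIter (m + n) X Z) - sympIter (m + n) (bracket Z Y) X -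
        sympIter n (bracket Y (opR^[m] X)) Z + sympIter m (bracket Z (opR^[n] Y)) X := by
  have mX := opR_iterate_mem m hX
  have mY := opR_iterate_mem n hY
  have h1 := extDeriv_symp hv mY mX hZ
  have h2 := extDeriv_sympIter hv n mX hZ hY
  have e : sympIter n (opR^[m] X) Z = sympIter (m + n) X Z := by
    rw [sympIter, sympIter, ← Function.iterate_add_apply, add_comm]
  have e' : symp (opR^[n] Y) (opR^[m] X) = sympIter (m + n) Y X := by
    rw [symp_opR_iterate hv m mY hX, sympIter, sympIter, ← Function.iterate_add_apply]
  simp only [extDeriv] at h1 h2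
  rw [symp_opR_iterate hv n hZ hY, symp_opR_iterate hv n (bracket_mem hv mX hZ) hY, e',
    symp_opR_iterate hv m (bracket_mem hv hZ mY) hX] at h1
  rw [sympIter_opR_iterate hv n m hY hX, sympIter_opR_iterate hv n m (bracket_mem hv hZ hY) hX, e,
    add_comm n m] at h2
  linear_combination h1 - h2

theorem schoutenVanishes_opH (hv : AsympDirection γ₀ v) (m n : ℕ) :
    SchoutenVanishes (γ₀ := γ₀) (opH m) (opH n) := by
  intro ξ η ζ hξ hη hζ
  have hX := hξ.opH0_mem
  have hY := hη.opH0_mem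
  have hZ := hζ.opH0_mem
  have hc := extDeriv_sympIter hv (m + n) hZ hY hX
  simp only [extDeriv] at hc
  simp only [schouten, apply_opH_lieForm hv _ _ hξ hη hζ, apply_opH_lieForm hv _ _ hη hζ hξ,
    apply_opH_lieForm hv _ _ hζ hξ hη, act_symp_sub hv _ _ hX hY hZ, act_symp_sub hv _ _ hY hZ hX,
    act_symp_sub hv _ _ hZ hX hY, add_comm n m]
  linear_combination -2 * hc

end

end VortexFilament

end

theorem theorem6 (γ₀ : ℝ → E3) (hγ₀ : IsReferenceCurve γ₀) :
    (∀ η : NB γ₀ → ScalarField γ₀, IsOneForm η → ∃! X, IsH0 η X) ∧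
    (∀ X ∈ vectorFields γ₀, IsOneForm (riem X) ∧
      opH 0 (riem X) = opJ X ∧ opH 1 (riem X) = opK X) ∧
    (∀ m n : ℕ, IsHamiltonianPair (γ₀ := γ₀) (opH m) (opH n)) := by
  obtain ⟨v, hv⟩ := hγ₀.exists_direction
  have hH : ∀ n, IsHamiltonianOperator (γ₀ := γ₀) (opH n) := fun n =>
    ⟨isSkewOperator_opH hv n, schoutenVanishes_opH hv n n⟩
  refine ⟨fun η hη => hη.existsUnique_isH0, fun X hX => ⟨isOneForm_riem hX, ?_, ?_⟩,
    fun m n => ⟨hH m, hH n, schoutenVanishes_opH hv m n⟩⟩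
  · exact opH0_eq hX fun _ _ => rfl
  · exact congrArg opR (opH0_eq hX fun _ _ => rfl)
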